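/- Let $d\ge 0$ and let $\mathcal T$ be a locally finite face-to-face tiling of $\mathbb E^d$ by convex $d$-polytopes. Embed $\mathbb E^d$ in $\mathbb E^{d+1}$ as the hyperplane $x_{d+1}=0$, and put $\mathbf n_0=(0,\dots,0,-1)$. Two cells are adjacent if they share a $(d-1)$-face, and for adjacent cells $P,Q$ let $\mathbf n_{P,Q}\in\mathbb E^d$ be the unit normal to $P\cap Q$ directed from $P$ to $Q$. For a real function $s$ on the $(d-1)$-faces of $\mathcal T$, the torsion of $s$ around a $(d-2)$-face $R$ is $\sum_{F\supset R}s(F)\mathbf n_F$, the sum being over the $(d-1)$-faces $F$ that contain $R$, with unit normals $\mathbf n_F$ all directed consistently with one direction of rotation around $R$. A canonical scaling is a positive $s$ whose torsion around every $(d-2)$-face is $0$. A lift of a polytope $P\subset\mathbb E^d$ is a polytope $\widetilde P\subset\mathbb E^{d+1}$ of the same dimension whose orthogonal projection is $P$. Given a canonical scaling $s$ and an initial cell $P_0$, for each chain $P_0,P_1,\dots,P_k$ of successively adjacent cells define $L[P_0]=P_0$ with normal $\mathbf n_0$, and let $L[P_0,\dots,P_k]$ be the lift of $P_k$ that meets $L[P_0,\dots,P_{k-1}]$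 in a common face which projects onto $P_{k-1}\cap P_k$, and whose normal is the normal of $L[P_0,\dots,P_{k-1}]$ plus $s(P_{k-1}\cap P_k)\,\mathbf n_{P_{k-1},P_k}$. Let $\mathcal G_{\mathcal T}$ be the family of all $L[P_0,\dots,P_k]$, coinciding point sets being identified. Two members are declared adjacent if they arise consecutively in some chain, and a face $K$ is declared common to two members if they are joined by a sequence of declared-adjacent members whose consecutive ones share $K$. A generatrix of $\mathcal T$ is a $d$-dimensional polyhedral manifold in $\mathbb E^{d+1}$ (a locally finite face-to-face complex of $d$-polytopes whose union is a topological $d$-manifold) whose orthogonal projection to $\mathbb E^d$ is one-to-one and maps its $d$-cells onto the cells of $\mathcal T$. It is called convex if it is the boundary of a closed convex set with nonempty interior of which all its $d$-cells are faces. A real function $s$ on the $(d-1)$-faces describes the normal increments of a generatrix if, for any two of its $d$-cells lying over adjacent cells $P$ and $Q$, with normals $\mathbf h_P,\mathbf h_Q$ normalized to have last coordinate $-1$, one has $\mathbf h_Q-\mathbf h_P=s(P\cap Q)\,\mathbf n_{P,Q}$. Then the following hold. (1) Let $s$ be a canonical scaling of $\mathcal T$ and $P_0$ a cell. For every chain from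 $P_0$ the polytope $L[P_0,\dots,P_k]$ exists and is unique; the declared adjacencies and common faces of $\mathcal G_{\mathcal T}$ are exactly the geometric ones; and $\mathcal G_{\mathcal T}$ is a convex generatrix of $\mathcal T$ whose normal increments are described by $s$. (2) Conversely, the normal increments of any generatrix of $\mathcal T$ are described by a real function $s$ on the $(d-1)$-faces with zero torsion around every $(d-2)$-face; and if the generatrix is convex, then $\mathcal T$ has a canonical scaling $s$ such that $s$ or $-s$ describes the normal increments of the generatrix. -/

import Mathlib

namespace Gen

noncomputable section

/-! ### Polytopes and tilings -/

/-- The Euclidean space of dimension `d`. -/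
abbrev E (d : ℕ) : Type := EuclideanSpace ℝ (Fin d)

/-- The Euclidean space of dimension `d + 1`, as the orthogonal sum of `E d` and the last
coordinate axis. The orthogonal projection onto `E d` is `fun p => p.fst`, and the last
coordinate is `p.snd`. -/
abbrev E' (d : ℕ) : Type := WithLp 2 (E d × ℝ)

section General

variable {V : Type*} [NormedAddCommGroup V] [InnerProductSpace ℝ V]

/-- Dimension of (the affine hull of) a nonempty set. -/
def dim (A : Set V) : ℕ := Module.finrank ℝ (vectorSpan ℝ A)

/-- Convex polytope: the convex hull of finitely many points. -/
def IsPolytope (A : Set V) : Prop := ∃ S : Set V, S.Finite ∧ A = convexHull ℝ S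

/-- `F` is a nonempty face of the convex polytope `A` (`A` itself is a face of `A`). -/
def IsFace (A F : Set V) : Prop := F.Nonempty ∧ IsExposed ℝ A F

/-- `N` is a nonzero vector orthogonal to the affine hull of `A`. -/
def IsNormal (A : Set V) (N : V) : Prop :=
  N ≠ 0 ∧ ∀ x ∈ A, ∀ y ∈ A, inner ℝ N (x - y) = 0

/-- Any two different members meet in the empty set or in a common face. -/
def FaceToFace (T : Set (Set V)) : Prop :=
  ∀ P ∈ T, ∀ Q ∈ T, P ≠ Q → (P ∩ Q).Nonempty → IsFace P (P ∩ Q) ∧ IsFace Q (P ∩ Q)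

/-- Every point has a neighbourhood that meets only finitely many members. -/
def IsLocallyFinite (T : Set (Set V)) : Prop :=
  LocallyFinite fun P : T => (P : Set V)

end General

variable {d : ℕ}

/-- Locally finite face-to-face tiling of `E d` by convex `d`-polytopes, given by its set of
`d`-cells. -/
structure IsTiling (T : Set (Set (E d))) : Prop where
  polytope : ∀ P ∈ T, IsPolytope P
  fullDim : ∀ P ∈ T, (interior P).Nonempty
  cover : ⋃₀ T = Set.univ
  disjoint : ∀ P ∈ T, ∀ Q ∈ T, P ≠ Q → Disjoint (interior P) (interior Q)
  faceToFace : FaceToFace T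
  locallyFinite : IsLocallyFinite T

/-- The `(d-1)`-faces (hyperfaces) of the tiling. -/
def facets (T : Set (Set (E d))) : Set (Set (E d)) :=
  {F | ∃ P ∈ T, IsFace P F ∧ dim F + 1 = d}

/-- The `(d-2)`-faces of the tiling. -/
def ridges (T : Set (Set (E d))) : Set (Set (E d)) :=
  {R | ∃ P ∈ T, IsFace P R ∧ dim R + 2 = d}

/-- The `(d-1)`-faces of the tiling that contain `R`. -/
def facetsAround (T : Set (Set (E d))) (R : Set (E d)) : Set (Set (E d)) :=
  {F | F ∈ facets T ∧ R ⊆ F}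

/-- Two different `d`-cells are adjacent if they have a common `(d-1)`-face. -/
def Adjacent (T : Set (Set (E d))) (P Q : Set (E d)) : Prop :=
  P ∈ T ∧ Q ∈ T ∧ P ≠ Q ∧ (P ∩ Q).Nonempty ∧ dim (P ∩ Q) + 1 = d

/-- `n` is the unit normal to `P ∩ Q` directed from `P` to `Q`. -/
def IsUnitNormal (P Q : Set (E d)) (n : E d) : Prop :=
  ‖n‖ = 1 ∧ (∀ x ∈ P ∩ Q, ∀ y ∈ P ∩ Q, inner ℝ n (x - y) = 0) ∧
    ∀ x ∈ P, ∀ y ∈ Q, inner ℝ n x ≤ inner ℝ n y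

/-- The unit normal to the common `(d-1)`-face of the adjacent cells `P` and `Q`, directed from
`P` to `Q`. -/
def unitNormal (P Q : Set (E d)) : E d := Classical.epsilon (IsUnitNormal P Q)

/-! ### Canonical scalings

A scaling is a function on the set of `(d-1)`-faces of the tiling; it is represented by a function
on all sets, of which only the values at members of `facets T` are ever used. -/

/-- `n` assigns to each `(d-1)`-face `F ⊇ R` its unit normal, all of them directed consistently
with one of the two directions of rotation around the `(d-2)`-face `R`: the plane orthogonal to
`R` is oriented by a quarter turn `J`; if `u` is the unit vector of that plane that points from
`R` into `F`, then `n F = J u`. -/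
def CoherentNormals (T : Set (Set (E d))) (R : Set (E d)) (n : Set (E d) → E d) : Prop :=
  ∃ J : (vectorSpan ℝ R)ᗮ →ₗᵢ[ℝ] (vectorSpan ℝ R)ᗮ, (∀ w, inner ℝ (J w) w = 0) ∧
    ∀ F ∈ facetsAround T R, ∃ u : (vectorSpan ℝ R)ᗮ,
      ‖u‖ = 1 ∧ (u : E d) ∈ vectorSpan ℝ F ∧
      (∀ r ∈ R, ∀ x ∈ F, 0 ≤ inner ℝ (u : E d) (x - r)) ∧ n F = (J u : E d)

/-- The torsion of `s` around `R`, computed with the unit normals `n`. -/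
def torsion (T : Set (Set (E d))) (s : Set (E d) → ℝ) (R : Set (E d)) (n : Set (E d) → E d) :
    E d :=
  ∑ᶠ F ∈ facetsAround T R, s F • n F

/-- The torsion of `s` around every `(d-2)`-face is zero. -/
def ZeroTorsion (T : Set (Set (E d))) (s : Set (E d) → ℝ) : Prop :=
  ∀ R ∈ ridges T, ∀ n : Set (E d) → E d, CoherentNormals T R n → torsion T s R n = 0

/-- Canonical scaling: positive, with zero torsion around every `(d-2)`-face. -/
def IsCanonicalScaling (T : Set (Set (E d))) (s : Set (E d) → ℝ) : Prop :=
  (∀ F ∈ facets T, 0 < s F) ∧ ZeroTorsion T s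

/-! ### Lifts -/

/-- The orthogonal projection of a set to `E d`. -/
def proj (A : Set (E' d)) : Set (E d) := (fun p : E' d => p.fst) '' A

/-- The embedding of `E d` as the hyperplane on which the last coordinate is zero. -/
def embed (x : E d) : E' d := WithLp.toLp 2 (x, 0)

/-- The normal `(0, …, 0, -1)` to that hyperplane. -/
def n₀ : E' d := WithLp.toLp 2 (0, -1)

/-- `A` is a lift of the polytope `P`: a polytope of the same dimension that projects onto `P`. -/
def IsLift (P : Set (E d)) (A : Set (E' d)) : Prop :=
  IsPolytope A ∧ dim A = dim P ∧ proj A = P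

/-- `B` is a lift of `Q` up to the lift `A` of `P`. -/
def IsLiftUpTo (P : Set (E d)) (A : Set (E' d)) (Q : Set (E d)) (B : Set (E' d)) : Prop :=
  IsLift Q B ∧ IsFace A (A ∩ B) ∧ IsFace B (A ∩ B) ∧ proj (A ∩ B) = P ∩ Q

/-- `IsChainLift T s P₀ [Pₖ, …, P₁, P₀] A N`: the polytope `A` is obtained from the chain
`P₀, P₁, …, Pₖ` by lifting the cells one after another, starting from `P₀` in the hyperplane
`E d` with normal `n₀`, each cell being lifted up to the lift of its predecessor with the normal
increment `s (Pᵢ ∩ Pᵢ₊₁) • nᵢ,ᵢ₊₁`; the vector `N` is the resulting normal of `A`.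
(The chain is listed from its last cell to its first one.) -/
inductive IsChainLift (T : Set (Set (E d))) (s : Set (E d) → ℝ) (P₀ : Set (E d)) :
    List (Set (E d)) → Set (E' d) → E' d → Prop
  | base : IsChainLift T s P₀ [P₀] (embed '' P₀) n₀
  | step {c : List (Set (E d))} {P Q : Set (E d)} {A B : Set (E' d)} {N : E' d} :
      IsChainLift T s P₀ (P :: c) A N → Adjacent T P Q → IsLiftUpTo P A Q B →
      IsNormal B (N + embed (s (P ∩ Q) • unitNormal P Q)) →
      IsChainLift T s P₀ (Q :: P :: c) B (N + embed (s (P ∩ Q) • unitNormal P Q))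

/-- A chain of the tiling that starts at `P₀` (listed from its last cell to its first one). -/
def IsChainFrom (T : Set (Set (E d))) (P₀ : Set (E d)) (c : List (Set (E d))) : Prop :=
  c.IsChain (fun Q P => Adjacent T P Q) ∧ c.getLast? = some P₀

/-- The family `𝒢(T, s)` of all lifts along chains that start at `P₀`; lifts that coincide as
point sets are identified. -/
def liftedComplex (T : Set (Set (E d))) (s : Set (E d) → ℝ) (P₀ : Set (E d)) :
    Set (Set (E' d)) :=
  {A | ∃ c N, IsChainLift T s P₀ c A N}

/-- Adjacency of the `d`-faces of `𝒢(T, s)`: they arise one after the other in a chain of lifts. -/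
def LiftAdjacent (T : Set (Set (E d))) (s : Set (E d) → ℝ) (P₀ : Set (E d))
    (A B : Set (E' d)) : Prop :=
  ∃ c P N M, (IsChainLift T s P₀ c A N ∧ IsChainLift T s P₀ (P :: c) B M) ∨
    (IsChainLift T s P₀ c B N ∧ IsChainLift T s P₀ (P :: c) A M)

/-- Incidence in `𝒢(T, s)`: the face `K` of `A` is common to `A` and `B` if there is a chain
of successively adjacent `d`-faces from `A` to `B` whose consecutive members all share `K`. -/
def LiftCommonFace (T : Set (Set (E d))) (s : Set (E d) → ℝ) (P₀ : Set (E d))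
    (A B K : Set (E' d)) : Prop :=
  IsFace A K ∧
    Relation.ReflTransGen (fun X Y => LiftAdjacent T s P₀ X Y ∧ K ⊆ X ∩ Y) A B

/-! ### Generatrices -/

/-- `d`-dimensional polyhedral manifold in `E' d`, given by the set of its `d`-cells: a locally
finite complex of `d`-polytopes, meeting face-to-face, whose union is a topological
`d`-manifold. -/
structure IsPolyhedralManifold (G : Set (Set (E' d))) : Prop where
  polytope : ∀ A ∈ G, IsPolytope A
  nonempty : ∀ A ∈ G, A.Nonempty
  dim_eq : ∀ A ∈ G, dim A = d
  faceToFace : FaceToFace G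
  locallyFinite : IsLocallyFinite G
  manifold : Nonempty (ChartedSpace (E d) (⋃₀ G))

/-- Generatrix of the tiling `T`: a `d`-dimensional polyhedral manifold in `E' d` whose orthogonal
projection to `E d` is one-to-one and coincides with `T`. -/
structure IsGeneratrix (T : Set (Set (E d))) (G : Set (Set (E' d))) : Prop where
  isManifold : IsPolyhedralManifold G
  injOn : Set.InjOn (fun p : E' d => p.fst) (⋃₀ G)
  proj_eq : proj '' G = T

/-- `G` is the boundary of a convex `(d+1)`-dimensional polyhedron whose `d`-dimensional faces are
the members of `G`. -/
def BoundsConvexPolyhedron (G : Set (Set (E' d))) : Prop :=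
  ∃ C : Set (E' d), Convex ℝ C ∧ IsClosed C ∧ (interior C).Nonempty ∧ frontier C = ⋃₀ G ∧
    ∀ A ∈ G, IsFace C A

/-- The scaling `s` describes the normal increments of `G`: if `A` and `B` are the members of `G`
over adjacent cells `P` and `Q`, then their normals with last coordinate `-1` differ by
`s (P ∩ Q)` times the unit normal directed from `P` to `Q`. -/
def HasNormalIncrements (T : Set (Set (E d))) (G : Set (Set (E' d))) (s : Set (E d) → ℝ) : Prop :=
  ∀ A ∈ G, ∀ B ∈ G, Adjacent T (proj A) (proj B) →
    ∀ N M : E' d, IsNormal A N → IsNormal B M → N.snd = -1 → M.snd = -1 →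
      M - N = embed (s (proj A ∩ proj B) • unitNormal (proj A) (proj B))

end

end Gen

namespace Gen

open Set Filter Topology

/-!
The affine functions whose graphs are the cells of a lifting of the tiling form a potential: across
the facet between `P` and `Q` they change by the affine function with gradient `s (P ∩ Q)` times the
unit normal from `P` to `Q` that vanishes on the facet. Such a potential is found by summing the
prescribed changes along segments that avoid all faces of codimension two. The sum around a generic
triangle is zero: by a discrete Stokes formula on each facet it is the sum of the torsions of `s`
around the ridges that meet the triangle, the signs being the intersection numbers. Two points are
joined by a generic segment after arbitrarily small perturbations, so path independence holds for
all pairs of cells.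

If `s` is positive, a potential can only increase against the function of a fixed cell along a
segment that leaves the cell. Hence the piecewise affine function is the maximum of its affine
pieces, its graph is the boundary of its epigraph, and each piece touches it on its own cell only.
Conversely, the cells of a generatrix are graphs of affine functions which agree on common facets,
so they differ there by multiples of the normal, and the differences telescope around each ridge. If
the generatrix bounds a convex set, each of these functions supports the piecewise affine function
strictly from below or from above; the sign of `s` tells which on both sides of a facet, and it is
the same everywhere since adjacent cells connect the tiling.
-/

variable {d : ℕ} {T : Set (Set (E d))}

section Convex

variable {V : Type*} [NormedAddCommGroup V] [InnerProductSpace ℝ V] {A F G K : Set V}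

/-! ### Faces of convex sets -/

lemma IsPolytope.convex (hA : IsPolytope A) : Convex ℝ A := by
  obtain ⟨S, -, rfl⟩ := hA
  exact convex_convexHull ℝ S

lemma IsPolytope.isCompact (hA : IsPolytope A) : IsCompact A := by
  obtain ⟨S, hS, rfl⟩ := hA
  exact hS.isCompact_convexHull ℝ

lemma IsFace.subset (hF : IsFace A F) : F ⊆ A := hF.2.subset

lemma IsFace.refl (hA : A.Nonempty) : IsFace A A := ⟨hA, IsExposed.refl A⟩

lemma IsFace.restrict (hF : IsFace A F) (hFG : F ⊆ G) (hGA : G ⊆ A) : IsFace G F :=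
  ⟨hF.1, hF.2.mono hGA hFG⟩

lemma isFace_of_inner {a : V} {c : ℝ} (hF : F.Nonempty) (hle : ∀ x ∈ A, inner ℝ a x ≤ c)
    (heq : F = {x ∈ A | inner ℝ a x = c}) : IsFace A F := by
  refine ⟨hF, fun _ => ⟨innerSL ℝ a, ?_⟩⟩
  obtain ⟨z, hz⟩ := hF
  rw [heq] at hz ⊢
  ext x
  simp only [mem_ofPred_eq, innerSL_apply_apply]
  refine and_congr_right fun hx => ⟨fun h y hy => by rw [h]; exact hle y hy, fun h => ?_⟩
  exact le_antisymm (hle x hx) (hz.2 ▸ h z hz.1)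

lemma IsFace.exists_inner [CompleteSpace V] (hF : IsFace A F) :
    ∃ (a : V) (c : ℝ), (∀ x ∈ A, inner ℝ a x ≤ c) ∧ F = {x ∈ A | inner ℝ a x = c} := by
  obtain ⟨l, hl⟩ := hF.2 hF.1
  obtain ⟨z, hz⟩ := hF.1
  have inner_eq : ∀ x, inner ℝ ((InnerProductSpace.toDual ℝ V).symm l) x = l x := fun x => by simp
  rw [hl] at hz
  refine ⟨(InnerProductSpace.toDual ℝ V).symm l, l z,
    fun x hx => by rw [inner_eq]; exact hz.2 x hx, ?_⟩
  rw [hl]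
  ext x
  simp only [mem_ofPred_eq, inner_eq]
  refine and_congr_right fun hx => ⟨fun h => le_antisymm (hz.2 x hx) (h z hz.1), fun h y hy => ?_⟩
  rw [h]; exact hz.2 y hy

lemma inner_le_of_mem_convexHull {S : Set V} {a : V} {c : ℝ} (h : ∀ x ∈ S, inner ℝ a x ≤ c) :
    ∀ x ∈ convexHull ℝ S, inner ℝ a x ≤ c :=
  convexHull_min (t := {x : V | inner ℝ a x ≤ c}) h
    (convex_halfSpace_le (innerSL ℝ a).toLinearMap.isLinear c)

-- By Krein–Milman a face is spanned by its extreme points, which are extreme in the polytope.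
lemma IsFace.eq_convexHull_inter {S : Set V} (hS : S.Finite) (hF : IsFace (convexHull ℝ S) F) :
    F = convexHull ℝ (S ∩ F) := by
  have hF_convex : Convex ℝ F := hF.2.convex (convex_convexHull ℝ S)
  have hF_compact : IsCompact F := hF.2.isCompact (hS.isCompact_convexHull ℝ)
  refine subset_antisymm ?_ (convexHull_min inter_subset_right hF_convex)
  have extremePoints_subset : F.extremePoints ℝ ⊆ S ∩ F := fun x hx =>
    ⟨extremePoints_convexHull_subset (hF.2.isExtreme.extremePoints_subset_extremePoints hx), hx.1⟩
  calc F = closure (convexHull ℝ (F.extremePoints ℝ)) :=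
        (closure_convexHull_extremePoints hF_compact hF_convex).symm
    _ ⊆ closure (convexHull ℝ (S ∩ F)) := closure_mono (convexHull_mono extremePoints_subset)
    _ = convexHull ℝ (S ∩ F) := ((hS.inter_of_left F).isClosed_convexHull ℝ).closure_eq

lemma IsFace.isPolytope (hF : IsFace A F) (hA : IsPolytope A) : IsPolytope F := by
  obtain ⟨S, hS, rfl⟩ := hA
  exact ⟨S ∩ F, hS.inter_of_left F, hF.eq_convexHull_inter hS⟩

lemma IsPolytope.finite_faces (hA : IsPolytope A) : {F | IsFace A F}.Finite := by
  obtain ⟨S, hS, rfl⟩ := hA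
  refine (hS.finite_subsets.image (fun B => convexHull ℝ B)).subset fun F hF => ?_
  exact ⟨S ∩ F, inter_subset_left, (IsFace.eq_convexHull_inter hS hF).symm⟩

lemma IsPolytope.exists_pos_inner_add_smul_le (hA : IsPolytope A) {a a' : V} {c c' : ℝ}
    (hle : ∀ x ∈ A, inner ℝ a x ≤ c)
    (hle' : ∀ x ∈ A, inner ℝ a x = c → inner ℝ a' x ≤ c') :
    ∃ ε > 0, ∀ x ∈ A, inner ℝ (a + ε • a') x ≤ c + ε * c' := by
  obtain ⟨S, hS, rfl⟩ := hA
  have hSA := subset_convexHull ℝ S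
  suffices ∀ᶠ ε in 𝓝[>] (0 : ℝ), ∀ x ∈ S, inner ℝ (a + ε • a') x ≤ c + ε * c' by
    obtain ⟨ε, hε, hpos⟩ := (this.and self_mem_nhdsWithin).exists
    exact ⟨ε, hpos, inner_le_of_mem_convexHull hε⟩
  rw [hS.eventually_all]
  intro x hx
  by_cases hxc : inner ℝ a x = c
  · filter_upwards [self_mem_nhdsWithin] with ε hε
    rw [inner_add_left, real_inner_smul_left, hxc]
    gcongr
    · exact (mem_Ioi.1 hε).le
    · exact hle' x (hSA hx) hxc
  · have hlt : inner ℝ a x < c := lt_of_le_of_ne (hle x (hSA hx)) hxc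
    have hleft : ContinuousAt (fun ε : ℝ => inner ℝ (a + ε • a') x) 0 := by fun_prop
    have hright : ContinuousAt (fun ε : ℝ => c + ε * c') 0 := by fun_prop
    filter_upwards [nhdsWithin_le_nhds (hleft.eventually_lt hright (by simpa using hlt))]
      with ε hε using hε.le

-- A functional exposing `G`, perturbed slightly by one exposing `K` in `G`, exposes a face that
-- meets `G` in `K`.
lemma IsFace.trans [CompleteSpace V] (hA : IsPolytope A) (hG : IsFace A G) (hK : IsFace G K) :
    IsFace A K := by
  obtain ⟨a, c, hle, rfl⟩ := hG.exists_inner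
  obtain ⟨a', c', hle', rfl⟩ := hK.exists_inner
  obtain ⟨ε, hε, hbound⟩ := hA.exists_pos_inner_add_smul_le hle fun x hx h => hle' x ⟨hx, h⟩
  have inner_perturbed : ∀ x, inner ℝ a x = c →
      (inner ℝ (a + ε • a') x = c + ε * c' ↔ inner ℝ a' x = c') := fun x hx => by
    rw [inner_add_left, real_inner_smul_left, hx, add_right_inj, mul_right_inj' hε.ne']
  have inter_eq : {x ∈ {x ∈ A | inner ℝ a x = c} | inner ℝ a' x = c'} =
      {x ∈ A | inner ℝ a x = c} ∩ {x ∈ A | inner ℝ (a + ε • a') x = c + ε * c'} := by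
    ext x
    constructor
    · rintro ⟨⟨hx, hxa⟩, hxa'⟩
      exact ⟨⟨hx, hxa⟩, hx, (inner_perturbed x hxa).2 hxa'⟩
    · rintro ⟨⟨hx, hxa⟩, -, hxb⟩
      exact ⟨⟨hx, hxa⟩, (inner_perturbed x hxa).1 hxb⟩
  refine ⟨hK.1, ?_⟩
  obtain ⟨z, hz⟩ := hK.1
  rw [inter_eq] at hz ⊢
  exact hG.2.inter (isFace_of_inner ⟨z, hz.2⟩ hbound rfl).2

lemma inner_eq_zero_of_mem_vectorSpan {a : V} {c : ℝ} (h : ∀ x ∈ A, inner ℝ a x = c) {v : V}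
    (hv : v ∈ vectorSpan ℝ A) : inner ℝ a v = 0 := by
  rw [vectorSpan_def] at hv
  induction hv using Submodule.span_induction with
  | mem v hv =>
    obtain ⟨y, hy, z, hz, rfl⟩ := hv
    simp only [vsub_eq_sub, inner_sub_right, h y hy, h z hz, sub_self]
  | zero => exact inner_zero_right a
  | add v w _ _ hv hw => rw [inner_add_right, hv, hw, add_zero]
  | smul t v _ hv => rw [inner_smul_right, hv, mul_zero]

/-! ### Relative interior -/

lemma mem_intrinsicInterior_iff_eventually {x : V} (hx : x ∈ A) :
    x ∈ intrinsicInterior ℝ A ↔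
      ∀ᶠ v : (affineSpan ℝ A).direction in 𝓝 0, x + (v : V) ∈ A := by
  let p : affineSpan ℝ A := ⟨x, subset_affineSpan ℝ A hx⟩
  have : Nonempty (affineSpan ℝ A) := ⟨p⟩
  have mem_iff : x ∈ intrinsicInterior ℝ A ↔ ∀ᶠ q : affineSpan ℝ A in 𝓝 p, (q : V) ∈ A := by
    rw [mem_intrinsicInterior, Filter.Eventually, ← mem_interior_iff_mem_nhds]
    constructor
    · rintro ⟨q, hq, hqx⟩
      rwa [show q = p from Subtype.ext hqx] at hq
    · exact fun h => ⟨p, h, rfl⟩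
  have map_nhds : map (fun v : (affineSpan ℝ A).direction => v +ᵥ p) (𝓝 0) = 𝓝 p := by
    have := (Homeomorph.vaddConst p).map_nhds_eq (0 : (affineSpan ℝ A).direction)
    rwa [Homeomorph.vaddConst_apply, zero_vadd] at this
  rw [mem_iff, ← map_nhds, eventually_map]
  simp only [p, AffineSubspace.coe_vadd, vadd_eq_add, add_comm]

lemma eventually_add_smul_mem {x v : V} (hx : x ∈ intrinsicInterior ℝ A)
    (hv : v ∈ vectorSpan ℝ A) : ∀ᶠ t in 𝓝 (0 : ℝ), x + t • v ∈ A := by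
  rw [← direction_affineSpan] at hv
  have htendsto : Tendsto (fun t : ℝ => t • (⟨v, hv⟩ : (affineSpan ℝ A).direction))
      (𝓝 0) (𝓝 0) := by
    have : Continuous (fun t : ℝ => t • (⟨v, hv⟩ : (affineSpan ℝ A).direction)) := by fun_prop
    simpa only [zero_smul] using this.tendsto 0
  exact htendsto.eventually
    ((mem_intrinsicInterior_iff_eventually (intrinsicInterior_subset hx)).1 hx)

lemma IsFace.subset_of_mem_intrinsicInterior [CompleteSpace V] (hF : IsFace A F) (hKA : K ⊆ A)
    {x : V} (hx : x ∈ intrinsicInterior ℝ K) (hxF : x ∈ F) : K ⊆ F := by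
  obtain ⟨a, c, hle, rfl⟩ := hF.exists_inner
  intro y hy
  have hv : x - y ∈ vectorSpan ℝ K := vsub_mem_vectorSpan ℝ (intrinsicInterior_subset hx) hy
  obtain ⟨t, htK, ht⟩ : ∃ t : ℝ, x + t • (x - y) ∈ K ∧ 0 < t :=
    (((eventually_add_smul_mem hx hv).filter_mono nhdsWithin_le_nhds).and
      (self_mem_nhdsWithin (s := Ioi (0 : ℝ)))).exists
  have beyond_le := hle _ (hKA htK)
  rw [inner_add_right, inner_smul_right, inner_sub_right, hxF.2] at beyond_le
  have : c - inner ℝ a y ≤ 0 := nonpos_of_mul_nonpos_right (a := t) (by linarith) ht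
  exact ⟨hKA hy, le_antisymm (hle y (hKA hy)) (by linarith)⟩

lemma eventually_add_smul_mem_of_convex (hA : Convex ℝ A) (hKA : K ⊆ A) {r f w : V} {c : ℝ}
    (hr : r ∈ intrinsicInterior ℝ K) (hf : f ∈ A) (hw : w ∈ vectorSpan ℝ K) (hc : 0 ≤ c) :
    ∀ᶠ t in 𝓝[>] (0 : ℝ), r + t • (c • (f - r) + w) ∈ A := by
  have htendsto : Tendsto (fun t : ℝ => t / (1 - t * c)) (𝓝[>] 0) (𝓝 0) := by
    have : ContinuousAt (fun t : ℝ => t / (1 - t * c)) 0 :=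
      ContinuousAt.div (by fun_prop) (by fun_prop) (by simp)
    simpa only [zero_div] using this.tendsto.mono_left nhdsWithin_le_nhds
  have hlt_one : ∀ᶠ t in 𝓝[>] (0 : ℝ), t * c < 1 := by
    have : ContinuousAt (fun t : ℝ => t * c) 0 := by fun_prop
    exact nhdsWithin_le_nhds (this.eventually_lt continuousAt_const (by simp))
  filter_upwards [htendsto.eventually (eventually_add_smul_mem hr hw), hlt_one,
    self_mem_nhdsWithin] with t htK htc ht
  have hne : 1 - t * c ≠ 0 := (sub_pos.2 htc).ne'
  have combination_mem := hA (hKA htK) hf (a := 1 - t * c) (b := t * c) (sub_pos.2 htc).le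
    (mul_nonneg (mem_Ioi.1 ht).le hc) (by ring)
  convert combination_mem using 1
  rw [smul_add (1 - t * c), smul_smul (1 - t * c), mul_div_cancel₀ _ hne]
  module

lemma dim_mono [FiniteDimensional ℝ V] (h : F ⊆ A) : dim F ≤ dim A :=
  Submodule.finrank_mono (vectorSpan_mono ℝ h)

variable [FiniteDimensional ℝ V]

lemma exists_inner_lt_of_notMem_intrinsicInterior (hA : Convex ℝ A) {x : V} (hx : x ∈ A)
    (hxA : x ∉ intrinsicInterior ℝ A) :
    ∃ a : V, (∀ y ∈ A, inner ℝ a y ≤ inner ℝ a x) ∧ ∃ y ∈ A, inner ℝ a y < inner ℝ a x := by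
  let S : Set (affineSpan ℝ A).direction := {v | x + (v : V) ∈ A}
  have hS : Convex ℝ S :=
    (hA.translate_preimage_right x).linear_preimage (affineSpan ℝ A).direction.subtype
  have hzero : 0 ∉ interior S := fun h => hxA <|
    (mem_intrinsicInterior_iff_eventually hx).2 (mem_interior_iff_mem_nhds.1 h)
  have sub_mem : ∀ {y}, y ∈ A → y - x ∈ (affineSpan ℝ A).direction := fun hy => by
    rw [direction_affineSpan]
    exact vsub_mem_vectorSpan ℝ hy hx
  obtain ⟨y, hy⟩ := Set.Nonempty.intrinsicInterior hA ⟨x, hx⟩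
  have hyA := intrinsicInterior_subset hy
  have hyS : ⟨y - x, sub_mem hyA⟩ ∈ interior S := by
    rw [mem_interior_iff_mem_nhds, ← add_zero (⟨y - x, sub_mem hyA⟩ : (affineSpan ℝ A).direction),
      ← map_add_left_nhds, mem_map]
    filter_upwards [(mem_intrinsicInterior_iff_eventually hyA).1 hy] with v hv
    simpa [S, ← add_assoc] using hv
  obtain ⟨f, hf⟩ := geometric_hahn_banach_open_point hS.interior isOpen_interior hzero
  simp only [map_zero] at hf
  have hf_le : ∀ v ∈ S, f v ≤ 0 := fun v hv =>
    closure_minimal (fun v hv => (hf v hv).le) (isClosed_le f.continuous continuous_const)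
      ((hS.closure_interior_eq_closure_of_nonempty_interior ⟨_, hyS⟩).symm ▸ subset_closure hv)
  let a := (InnerProductSpace.toDual ℝ (affineSpan ℝ A).direction).symm f
  have inner_sub : ∀ {z} (hz : z ∈ A), inner ℝ (a : V) z - inner ℝ (a : V) x =
      f ⟨z - x, sub_mem hz⟩ := fun hz => by
    rw [← inner_sub_right, ← InnerProductSpace.toDual_symm_apply, Submodule.coe_inner]
  refine ⟨a, fun z hz => ?_, y, hyA, ?_⟩
  · rw [← sub_nonpos, inner_sub hz]
    exact hf_le _ (by simpa [S] using hz)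
  · rw [← sub_neg, inner_sub hyA]
    exact hf _ hyS

lemma IsFace.eq_of_dim_le (hF : IsFace A F) (hdim : dim A ≤ dim F) : F = A := by
  obtain ⟨a, c, -, heq⟩ := hF.exists_inner
  have hF_eq : ∀ x ∈ F, inner ℝ a x = c := by
    rw [heq]
    exact fun x hx => hx.2
  have hspan : vectorSpan ℝ F = vectorSpan ℝ A :=
    Submodule.eq_of_le_of_finrank_le (vectorSpan_mono ℝ hF.subset) hdim
  obtain ⟨z, hz⟩ := hF.1
  refine subset_antisymm hF.subset fun x hx => ?_
  have hxz : x - z ∈ vectorSpan ℝ F := hspan ▸ vsub_mem_vectorSpan ℝ hx (hF.subset hz)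
  have := inner_eq_zero_of_mem_vectorSpan hF_eq hxz
  rw [inner_sub_right, hF_eq z hz, sub_eq_zero] at this
  rw [heq]
  exact ⟨hx, this⟩

lemma IsFace.dim_lt (hF : IsFace A F) (hne : F ≠ A) : dim F < dim A :=
  not_le.1 fun h => hne (hF.eq_of_dim_le h)

lemma IsPolytope.exists_isFace_mem_intrinsicInterior (hA : IsPolytope A) {x : V} (hx : x ∈ A) :
    ∃ K, IsFace A K ∧ x ∈ intrinsicInterior ℝ K := by
  obtain ⟨K, ⟨hK, hxK⟩, hmin⟩ := exists_minimalFor_of_wellFoundedLT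
    (fun K => IsFace A K ∧ x ∈ K) dim ⟨A, IsFace.refl ⟨x, hx⟩, hx⟩
  refine ⟨K, hK, by_contra fun hxK' => ?_⟩
  obtain ⟨a, hle, y, hy, hlt⟩ :=
    exists_inner_lt_of_notMem_intrinsicInterior (hK.isPolytope hA).convex hxK hxK'
  have hF : IsFace K {z ∈ K | inner ℝ a z = inner ℝ a x} :=
    isFace_of_inner ⟨x, hxK, rfl⟩ hle rfl
  have hdim := hF.dim_lt fun h => hlt.ne ((h.symm ▸ hy :) : y ∈ {z ∈ K | _}).2
  exact hdim.not_ge (hmin ⟨hK.trans hA hF, hxK, rfl⟩ hdim.le)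

end Convex

/-! ### Cells and faces of a tiling -/

lemma tendsto_add_smul_nhdsGT_zero {V : Type*} [NormedAddCommGroup V] [NormedSpace ℝ V]
    (p v : V) : Tendsto (fun t : ℝ => p + t • v) (𝓝[>] 0) (𝓝 p) := by
  have hcont : Continuous fun t : ℝ => p + t • v := by fun_prop
  simpa only [zero_smul, add_zero] using (hcont.tendsto 0).mono_left nhdsWithin_le_nhds

lemma lt_inner_of_mem_interior {V : Type*} [NormedAddCommGroup V] [InnerProductSpace ℝ V]
    {P : Set V} {a p : V} {c : ℝ} (ha : a ≠ 0) (hle : ∀ x ∈ P, c ≤ inner ℝ a x)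
    (hp : p ∈ interior P) : c < inner ℝ a p := by
  obtain ⟨t, ht, ht0⟩ := (((tendsto_add_smul_nhdsGT_zero p (-a)).eventually
    (mem_interior_iff_mem_nhds.1 hp)).and self_mem_nhdsWithin).exists
  have hle_add := hle _ ht
  rw [inner_add_right, inner_smul_right, inner_neg_right] at hle_add
  have : 0 < t * inner ℝ a a := mul_pos ht0 (real_inner_self_pos.2 ha)
  linarith

/-- The nonempty faces of all dimensions of the cells of `T`. -/
def faces (T : Set (Set (E d))) : Set (Set (E d)) := {K | ∃ P ∈ T, IsFace P K}

lemma mem_faces_of_mem_facets {F : Set (E d)} (hF : F ∈ facets T) : F ∈ faces T :=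
  let ⟨P, hP, hF, _⟩ := hF
  ⟨P, hP, hF⟩

lemma mem_faces_of_mem_ridges {R : Set (E d)} (hR : R ∈ ridges T) : R ∈ faces T :=
  let ⟨P, hP, hR, _⟩ := hR
  ⟨P, hP, hR⟩

lemma dim_add_one_of_mem_facets {F : Set (E d)} (hF : F ∈ facets T) : dim F + 1 = d :=
  let ⟨_, _, _, hdim⟩ := hF
  hdim

lemma nonempty_of_mem_faces {K : Set (E d)} (hK : K ∈ faces T) : K.Nonempty :=
  let ⟨_, _, hK⟩ := hK
  hK.1

namespace IsTiling

variable (hT : IsTiling T) {P Q K : Set (E d)}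
include hT

lemma convex (hP : P ∈ T) : Convex ℝ P := (hT.polytope P hP).convex

lemma isClosed (hP : P ∈ T) : IsClosed P := (hT.polytope P hP).isCompact.isClosed

lemma nonempty (hP : P ∈ T) : P.Nonempty := (hT.fullDim P hP).mono interior_subset

lemma vectorSpan_eq_top (hP : P ∈ T) : vectorSpan ℝ P = ⊤ := by
  rw [← AffineSubspace.affineSpan_eq_top_iff_vectorSpan_eq_top_of_nonempty ℝ _ _ (hT.nonempty hP)]
  exact (hT.convex hP).interior_nonempty_iff_affineSpan_eq_top.1 (hT.fullDim P hP)

lemma dim_eq (hP : P ∈ T) : dim P = d := by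
  rw [dim, hT.vectorSpan_eq_top hP, finrank_top, finrank_euclideanSpace_fin]

lemma closure_interior (hP : P ∈ T) : closure (interior P) = P := by
  rw [(hT.convex hP).closure_interior_eq_closure_of_nonempty_interior (hT.fullDim P hP),
    (hT.isClosed hP).closure_eq]

lemma interior_inter_nonempty (hP : P ∈ T) {U : Set (E d)} (hU : IsOpen U)
    (h : (P ∩ U).Nonempty) : (interior P ∩ U).Nonempty := by
  obtain ⟨x, hx, hxU⟩ := h
  rw [← hT.closure_interior hP, mem_closure_iff] at hx
  exact inter_comm U _ ▸ hx U hU hxU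

lemma eq_of_mem_interior (hP : P ∈ T) (hQ : Q ∈ T) {x : E d} (hx : x ∈ interior P)
    (hxQ : x ∈ Q) : P = Q := by
  by_contra hne
  rw [← hT.closure_interior hQ, mem_closure_iff] at hxQ
  obtain ⟨y, hyP, hyQ⟩ := hxQ _ isOpen_interior hx
  exact disjoint_left.1 (hT.disjoint P hP Q hQ hne) hyP hyQ

lemma countable : T.Countable := by
  have := LocallyFinite.countable_univ hT.locallyFinite fun P => hT.nonempty P.2
  exact countable_coe_iff.1 (countable_univ_iff.1 this)

lemma exists_mem_cell (x : E d) : ∃ P ∈ T, x ∈ P := by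
  rw [← mem_sUnion, hT.cover]
  exact mem_univ x

lemma eventually_mem_cell_imp (x : E d) : ∀ᶠ y in 𝓝 x, ∀ P ∈ T, y ∈ P → x ∈ P := by
  filter_upwards [LocallyFinite.eventually_subset hT.locallyFinite (fun P => hT.isClosed P.2) x]
    with y hy P hP hyP
  exact hy (a := ⟨P, hP⟩) hyP

lemma finite_cells_inter_nonempty {C : Set (E d)} (hC : IsCompact C) :
    {P | P ∈ T ∧ (P ∩ C).Nonempty}.Finite := by
  refine ((LocallyFinite.finite_nonempty_inter_compact hT.locallyFinite hC).image
    Subtype.val).subset ?_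
  rintro P ⟨hP, hPC⟩
  exact ⟨⟨P, hP⟩, hPC, rfl⟩

lemma isFace_of_subset (hP : P ∈ T) (hQ : Q ∈ T) (hK : IsFace P K) (hKQ : K ⊆ Q) :
    IsFace Q K := by
  rcases eq_or_ne P Q with rfl | hPQ
  · exact hK
  obtain ⟨x, hx⟩ := hK.1
  obtain ⟨-, hPQ_face⟩ := hT.faceToFace P hP Q hQ hPQ ⟨x, hK.subset hx, hKQ hx⟩
  exact hPQ_face.trans (hT.polytope Q hQ)
    (hK.restrict (subset_inter hK.subset hKQ) inter_subset_left)

lemma isFace_of_mem_facets {F : Set (E d)} (hF : F ∈ facets T) (hP : P ∈ T) (hFP : F ⊆ P) :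
    IsFace P F :=
  let ⟨_, hQ, hFQ, _⟩ := hF
  hT.isFace_of_subset hQ hP hFQ hFP

lemma face_subset_of_mem_intrinsicInterior (hK : K ∈ faces T) (hQ : Q ∈ T) {x : E d}
    (hx : x ∈ intrinsicInterior ℝ K) (hxQ : x ∈ Q) : K ⊆ Q := by
  obtain ⟨P, hP, hK⟩ := hK
  rcases eq_or_ne P Q with rfl | hPQ
  · exact hK.subset
  have hxP := hK.subset (intrinsicInterior_subset hx)
  obtain ⟨hPQ_face, -⟩ := hT.faceToFace P hP Q hQ hPQ ⟨x, hxP, hxQ⟩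
  exact (hPQ_face.subset_of_mem_intrinsicInterior hK.subset hx ⟨hxP, hxQ⟩).trans inter_subset_right

lemma isPolytope_of_mem_faces (hK : K ∈ faces T) : IsPolytope K :=
  let ⟨P, hP, hK⟩ := hK
  hK.isPolytope (hT.polytope P hP)

lemma nonempty_intrinsicInterior_of_mem_faces (hK : K ∈ faces T) :
    (intrinsicInterior ℝ K).Nonempty :=
  (nonempty_of_mem_faces hK).intrinsicInterior (hT.isPolytope_of_mem_faces hK).convex

lemma countable_faces : (faces T).Countable := by
  have faces_eq : faces T = ⋃ P ∈ T, {K | IsFace P K} := by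
    ext K
    simp [faces]
  rw [faces_eq]
  exact hT.countable.biUnion fun P hP => (hT.polytope P hP).finite_faces.countable

lemma finite_faces_inter_nonempty {C : Set (E d)} (hC : IsCompact C) :
    {K | K ∈ faces T ∧ (K ∩ C).Nonempty}.Finite := by
  refine ((hT.finite_cells_inter_nonempty hC).biUnion
    fun P hP => (hT.polytope P hP.1).finite_faces).subset ?_
  rintro K ⟨⟨P, hP, hK⟩, hKC⟩
  exact mem_biUnion (x := P) ⟨hP, hKC.mono (inter_subset_inter_left _ hK.subset)⟩ hK

end IsTiling

/-! ### Facet normals and the two sides of a facet -/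

/-- `ν` is one of the two unit normal vectors of the `(d-1)`-dimensional set `F`. -/
def IsFacetNormal (F : Set (E d)) (ν : E d) : Prop :=
  ‖ν‖ = 1 ∧ ∀ v ∈ vectorSpan ℝ F, inner ℝ ν v = 0

/-- `P` lies in the closed half-space bounded by the hyperplane of `F` into which the normal `ν`
of `F` points. -/
def OnSide (F : Set (E d)) (ν : E d) (P : Set (E d)) : Prop :=
  ∀ f ∈ F, ∀ x ∈ P, inner ℝ ν f ≤ inner ℝ ν x

lemma onSide_neg {F P : Set (E d)} {ν : E d} :
    OnSide F (-ν) P ↔ ∀ f ∈ F, ∀ x ∈ P, inner ℝ ν x ≤ inner ℝ ν f := by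
  simp only [OnSide, inner_neg_left, neg_le_neg_iff]

namespace IsFacetNormal

variable {F : Set (E d)} {ν : E d} (hν : IsFacetNormal F ν)
include hν

lemma ne_zero : ν ≠ 0 := norm_ne_zero_iff.1 (hν.1 ▸ one_ne_zero)

lemma inner_self : inner ℝ ν ν = 1 := by
  rw [real_inner_self_eq_norm_sq, hν.1, one_pow]

lemma neg : IsFacetNormal F (-ν) :=
  ⟨by rw [norm_neg, hν.1], fun v hv => by rw [inner_neg_left, hν.2 v hv, neg_zero]⟩

lemma inner_eq {x y : E d} (hx : x ∈ F) (hy : y ∈ F) : inner ℝ ν x = inner ℝ ν y := by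
  have := hν.2 _ (vsub_mem_vectorSpan ℝ hx hy)
  rwa [vsub_eq_sub, inner_sub_right, sub_eq_zero] at this

lemma mem_vectorSpan (hF : dim F + 1 = d) {v : E d} (hv : inner ℝ ν v = 0) :
    v ∈ vectorSpan ℝ F := by
  have : Fact (Module.finrank ℝ (E d) = Module.finrank ℝ (vectorSpan ℝ F) + 1) :=
    ⟨by rw [finrank_euclideanSpace_fin]; exact hF.symm⟩
  have span_le : vectorSpan ℝ F ≤ (ℝ ∙ ν)ᗮ := fun w hw => by
    rw [Submodule.mem_orthogonal_singleton_iff_inner_right]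
    exact hν.2 w hw
  rw [Submodule.eq_of_le_of_finrank_le span_le
    (Submodule.finrank_orthogonal_span_singleton hν.ne_zero).le,
    Submodule.mem_orthogonal_singleton_iff_inner_right]
  exact hv

lemma eq_smul (hF : dim F + 1 = d) {a : E d} (ha : ∀ v ∈ vectorSpan ℝ F, inner ℝ a v = 0) :
    a = inner ℝ ν a • ν := by
  have hν_residue : inner ℝ ν (a - inner ℝ ν a • ν) = 0 := by
    rw [inner_sub_right, inner_smul_right, hν.inner_self, mul_one, sub_self]
  have ha_residue := ha _ (hν.mem_vectorSpan hF hν_residue)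
  refine sub_eq_zero.1 (inner_self_eq_zero (𝕜 := ℝ).1 ?_)
  rw [inner_sub_left, ha_residue, real_inner_smul_left, hν_residue, mul_zero, sub_zero]

lemma eq_or_eq_neg (hF : dim F + 1 = d) {n : E d} (hn : IsFacetNormal F n) : n = ν ∨ n = -ν := by
  have n_eq := hν.eq_smul hF hn.2
  have abs_eq_one : |inner ℝ ν n| = 1 := by
    rw [← Real.norm_eq_abs, ← mul_one ‖inner ℝ ν n‖, ← hν.1, ← norm_smul, ← n_eq, hn.1, hν.1]
  rcases (abs_eq zero_le_one).1 abs_eq_one with h | h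
  · exact Or.inl (by rw [n_eq, h, one_smul])
  · exact Or.inr (by rw [n_eq, h, neg_one_smul])

lemma inner_sub_pos {P : Set (E d)} (hside : OnSide F ν P) {f p : E d} (hf : f ∈ F)
    (hp : p ∈ interior P) : 0 < inner ℝ ν (p - f) := by
  rw [inner_sub_right, sub_pos]
  exact lt_inner_of_mem_interior hν.ne_zero (hside f hf) hp

end IsFacetNormal

lemma exists_isFacetNormal {F : Set (E d)} (hF : dim F + 1 = d) : ∃ ν, IsFacetNormal F ν := by
  have hne : (vectorSpan ℝ F)ᗮ ≠ ⊥ := by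
    intro h
    rw [Submodule.orthogonal_eq_bot_iff] at h
    rw [dim, h, finrank_top, finrank_euclideanSpace_fin] at hF
    omega
  obtain ⟨a, ha, ha0⟩ := Submodule.exists_mem_ne_zero_of_ne_bot hne
  refine ⟨(‖a‖⁻¹ : ℝ) • a, norm_smul_inv_norm ha0, fun v hv => ?_⟩
  rw [real_inner_smul_left, Submodule.inner_left_of_mem_orthogonal hv ha, mul_zero]

lemma Adjacent.symm {P Q : Set (E d)} (h : Adjacent T P Q) : Adjacent T Q P := by
  obtain ⟨hP, hQ, hne, hPQ, hdim⟩ := h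
  rw [inter_comm] at hPQ hdim
  exact ⟨hQ, hP, hne.symm, hPQ, hdim⟩

namespace IsTiling

variable (hT : IsTiling T) {F P Q : Set (E d)} {ν : E d}
include hT

lemma exists_isFacetNormal_onSide (hF : F ∈ facets T) (hP : P ∈ T) (hFP : F ⊆ P) :
    ∃ n, IsFacetNormal F n ∧ OnSide F n P ∧
      ∀ f ∈ F, ∀ x ∈ P, inner ℝ n x = inner ℝ n f → x ∈ F := by
  have hF_face := hT.isFace_of_mem_facets hF hP hFP
  have hdim := dim_add_one_of_mem_facets hF
  obtain ⟨ν, hν⟩ := exists_isFacetNormal hdim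
  obtain ⟨a, c, hle, rfl⟩ := hF_face.exists_inner
  have ha := hν.eq_smul hdim fun v hv => inner_eq_zero_of_mem_vectorSpan (fun x hx => hx.2) hv
  have inner_a : ∀ x, inner ℝ a x = inner ℝ ν a * inner ℝ ν x := fun x => by
    conv_lhs => rw [ha, real_inner_smul_left]
  rcases lt_trichotomy (inner ℝ ν a) 0 with h | h | h
  · refine ⟨ν, hν, fun f hf x hx => ?_, fun f hf x hx hxf => ⟨hx, ?_⟩⟩
    · have := hle x hx
      rw [← hf.2, inner_a, inner_a] at this
      exact (mul_le_mul_left_of_neg h).1 this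
    · rw [← hf.2, inner_a, hxf, ← inner_a]
  · obtain ⟨f, -, hf⟩ := hF_face.1
    have F_eq : {x ∈ P | inner ℝ a x = c} = P := by
      refine subset_antisymm hF_face.subset fun x hx => ⟨hx, ?_⟩
      rw [← hf, inner_a, inner_a, h, zero_mul, zero_mul]
    rw [F_eq, hT.dim_eq hP] at hdim
    omega
  · refine ⟨-ν, hν.neg, onSide_neg.2 fun f hf x hx => ?_, fun f hf x hx hxf => ⟨hx, ?_⟩⟩
    · have := hle x hx
      rw [← hf.2, inner_a, inner_a] at this
      exact le_of_mul_le_mul_left this h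
    · rw [inner_neg_left, inner_neg_left, neg_inj] at hxf
      rw [← hf.2, inner_a, hxf, ← inner_a]

lemma onSide_or_onSide_neg (hF : F ∈ facets T) (hν : IsFacetNormal F ν) (hP : P ∈ T)
    (hFP : F ⊆ P) : OnSide F ν P ∨ OnSide F (-ν) P := by
  obtain ⟨n, hn, hside, -⟩ := hT.exists_isFacetNormal_onSide hF hP hFP
  rcases hν.eq_or_eq_neg (dim_add_one_of_mem_facets hF) hn with rfl | rfl
  exacts [Or.inl hside, Or.inr hside]

lemma mem_facet_of_inner_eq (hF : F ∈ facets T) (hν : IsFacetNormal F ν) (hP : P ∈ T)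
    (hFP : F ⊆ P) {f x : E d} (hf : f ∈ F) (hx : x ∈ P) (h : inner ℝ ν x = inner ℝ ν f) :
    x ∈ F := by
  obtain ⟨n, hn, -, hmem⟩ := hT.exists_isFacetNormal_onSide hF hP hFP
  rcases hν.eq_or_eq_neg (dim_add_one_of_mem_facets hF) hn with rfl | rfl
  · exact hmem f hf x hx h
  · exact hmem f hf x hx (by rw [inner_neg_left, inner_neg_left, h])

lemma not_onSide_neg_of_onSide (hF : F.Nonempty) (hν : IsFacetNormal F ν) (hP : P ∈ T)
    (hside : OnSide F ν P) : ¬ OnSide F (-ν) P := fun hside' => by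
  obtain ⟨f, hf⟩ := hF
  obtain ⟨p, hp⟩ := hT.fullDim P hP
  have hpos := hν.inner_sub_pos hside hf hp
  have hneg := hν.neg.inner_sub_pos hside' hf hp
  rw [inner_neg_left] at hneg
  linarith

-- Near a relative interior point of `F`, a cell on the side `ν` contains all short segments
-- pointing strictly to that side, so two such cells overlap.
lemma eq_of_onSide (hF : F ∈ facets T) (hν : IsFacetNormal F ν) (hP : P ∈ T) (hQ : Q ∈ T)
    (hFP : F ⊆ P) (hFQ : F ⊆ Q) (hPs : OnSide F ν P) (hQs : OnSide F ν Q) : P = Q := by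
  obtain ⟨r, hr⟩ := hT.nonempty_intrinsicInterior_of_mem_faces (mem_faces_of_mem_facets hF)
  have hrF := intrinsicInterior_subset hr
  obtain ⟨p, hp⟩ := hT.fullDim P hP
  obtain ⟨q, hq⟩ := hT.fullDim Q hQ
  have hpr := hν.inner_sub_pos hPs hrF hp
  have hqr := hν.inner_sub_pos hQs hrF hq
  set c := inner ℝ ν (p - r) / inner ℝ ν (q - r) with hc
  have hw : (p - r) - c • (q - r) ∈ vectorSpan ℝ F := by
    refine hν.mem_vectorSpan (dim_add_one_of_mem_facets hF) ?_
    rw [inner_sub_right, inner_smul_right, hc, div_mul_cancel₀ _ hqr.ne', sub_self]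
  obtain ⟨t, htQ, ht⟩ := ((eventually_add_smul_mem_of_convex (hT.convex hQ) hFQ hr
    (interior_subset hq) hw (div_pos hpr hqr).le).and (Ioc_mem_nhdsGT one_pos)).exists
  rw [add_sub_cancel] at htQ
  exact hT.eq_of_mem_interior hP hQ
    ((hT.convex hP).add_smul_sub_mem_interior (hFP hrF) hp ht) htQ

lemma exists_onSide (hF : F ∈ facets T) (hν : IsFacetNormal F ν) :
    ∃ Q ∈ T, F ⊆ Q ∧ OnSide F ν Q := by
  obtain ⟨r, hr⟩ := hT.nonempty_intrinsicInterior_of_mem_faces (mem_faces_of_mem_facets hF)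
  obtain ⟨t, ht, ht0⟩ := (((tendsto_add_smul_nhdsGT_zero r ν).eventually
    (hT.eventually_mem_cell_imp r)).and self_mem_nhdsWithin).exists
  obtain ⟨Q, hQ, hrQ⟩ := hT.exists_mem_cell (r + t • ν)
  have hFQ := hT.face_subset_of_mem_intrinsicInterior (mem_faces_of_mem_facets hF) hQ hr
    (ht Q hQ hrQ)
  refine ⟨Q, hQ, hFQ, (hT.onSide_or_onSide_neg hF hν hQ hFQ).resolve_right fun hneg => ?_⟩
  have := onSide_neg.1 hneg r (intrinsicInterior_subset hr) _ hrQ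
  rw [inner_add_right, inner_smul_right, hν.inner_self, mul_one, add_le_iff_nonpos_right] at this
  exact this.not_gt ht0

end IsTiling

/-- The cell that contains the facet `F` and lies on the side of `F` into which its unit normal
`ν` points; it exists and is unique in a tiling. -/
noncomputable def side (T : Set (Set (E d))) (F : Set (E d)) (ν : E d) : Set (E d) :=
  Classical.epsilon fun Q => Q ∈ T ∧ F ⊆ Q ∧ OnSide F ν Q

namespace IsTiling

variable (hT : IsTiling T) {F P Q : Set (E d)} {ν : E d}
include hT

lemma side_spec (hF : F ∈ facets T) (hν : IsFacetNormal F ν) :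
    side T F ν ∈ T ∧ F ⊆ side T F ν ∧ OnSide F ν (side T F ν) :=
  Classical.epsilon_spec (p := fun Q => Q ∈ T ∧ F ⊆ Q ∧ OnSide F ν Q) (hT.exists_onSide hF hν)

lemma side_mem (hF : F ∈ facets T) (hν : IsFacetNormal F ν) : side T F ν ∈ T :=
  (hT.side_spec hF hν).1

lemma subset_side (hF : F ∈ facets T) (hν : IsFacetNormal F ν) : F ⊆ side T F ν :=
  (hT.side_spec hF hν).2.1

lemma onSide_side (hF : F ∈ facets T) (hν : IsFacetNormal F ν) : OnSide F ν (side T F ν) :=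
  (hT.side_spec hF hν).2.2

lemma eq_side_of_onSide (hF : F ∈ facets T) (hν : IsFacetNormal F ν) (hP : P ∈ T) (hFP : F ⊆ P)
    (hside : OnSide F ν P) : P = side T F ν :=
  hT.eq_of_onSide hF hν hP (hT.side_mem hF hν) hFP (hT.subset_side hF hν) hside
    (hT.onSide_side hF hν)

lemma eq_side_or_eq_side_neg (hF : F ∈ facets T) (hν : IsFacetNormal F ν) (hP : P ∈ T)
    (hFP : F ⊆ P) : P = side T F ν ∨ P = side T F (-ν) :=
  (hT.onSide_or_onSide_neg hF hν hP hFP).imp (hT.eq_side_of_onSide hF hν hP hFP)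
    (hT.eq_side_of_onSide hF hν.neg hP hFP)

lemma side_neg_inter_side (hF : F ∈ facets T) (hν : IsFacetNormal F ν) :
    side T F (-ν) ∩ side T F ν = F := by
  obtain ⟨f, hf⟩ := nonempty_of_mem_faces (mem_faces_of_mem_facets hF)
  refine subset_antisymm (fun x hx => ?_)
    (subset_inter (hT.subset_side hF hν.neg) (hT.subset_side hF hν))
  refine hT.mem_facet_of_inner_eq hF hν (hT.side_mem hF hν) (hT.subset_side hF hν) hf hx.2 ?_
  exact le_antisymm (onSide_neg.1 (hT.onSide_side hF hν.neg) f hf x hx.1)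
    (hT.onSide_side hF hν f hf x hx.2)

lemma side_neg_ne_side (hF : F ∈ facets T) (hν : IsFacetNormal F ν) :
    side T F (-ν) ≠ side T F ν := fun h =>
  hT.not_onSide_neg_of_onSide (nonempty_of_mem_faces (mem_faces_of_mem_facets hF)) hν
    (hT.side_mem hF hν) (hT.onSide_side hF hν) (h ▸ hT.onSide_side hF hν.neg)

lemma adjacent_side (hF : F ∈ facets T) (hν : IsFacetNormal F ν) :
    Adjacent T (side T F (-ν)) (side T F ν) := by
  refine ⟨hT.side_mem hF hν.neg, hT.side_mem hF hν, hT.side_neg_ne_side hF hν, ?_, ?_⟩ <;>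
    rw [hT.side_neg_inter_side hF hν]
  · exact nonempty_of_mem_faces (mem_faces_of_mem_facets hF)
  · exact dim_add_one_of_mem_facets hF

lemma inter_mem_facets (h : Adjacent T P Q) : P ∩ Q ∈ facets T :=
  let ⟨hP, hQ, hne, hPQ, hdim⟩ := h
  ⟨P, hP, (hT.faceToFace P hP Q hQ hne hPQ).1, hdim⟩

lemma exists_eq_side_of_adjacent (h : Adjacent T P Q) :
    ∃ ν, IsFacetNormal (P ∩ Q) ν ∧ P = side T (P ∩ Q) (-ν) ∧ Q = side T (P ∩ Q) ν := by
  have hF := hT.inter_mem_facets h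
  obtain ⟨hP, hQ, hne, -, hdim⟩ := h
  obtain ⟨ν, hν⟩ := exists_isFacetNormal hdim
  rcases hT.eq_side_or_eq_side_neg hF hν hP inter_subset_left with hP' | hP' <;>
  rcases hT.eq_side_or_eq_side_neg hF hν hQ inter_subset_right with hQ' | hQ'
  · exact absurd (hP'.trans hQ'.symm) hne
  · exact ⟨-ν, hν.neg, by rwa [neg_neg], hQ'⟩
  · exact ⟨ν, hν, hP', hQ'⟩
  · exact absurd (hP'.trans hQ'.symm) hne

lemma unitNormal_side (hF : F ∈ facets T) (hν : IsFacetNormal F ν) :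
    unitNormal (side T F (-ν)) (side T F ν) = ν := by
  have inter_eq := hT.side_neg_inter_side hF hν
  obtain ⟨f, hf⟩ := nonempty_of_mem_faces (mem_faces_of_mem_facets hF)
  have hex : IsUnitNormal (side T F (-ν)) (side T F ν) ν := by
    refine ⟨hν.1, fun x hx y hy => ?_, fun x hx y hy => ?_⟩
    · rw [inter_eq] at hx hy
      exact hν.2 _ (vsub_mem_vectorSpan ℝ hx hy)
    · exact (onSide_neg.1 (hT.onSide_side hF hν.neg) f hf x hx).trans
        (hT.onSide_side hF hν f hf y hy)
  obtain ⟨hnorm, horth, hle⟩ : IsUnitNormal _ _ (unitNormal (side T F (-ν)) (side T F ν)) :=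
    Classical.epsilon_spec ⟨ν, hex⟩
  rw [inter_eq] at horth
  have hn : IsFacetNormal F (unitNormal (side T F (-ν)) (side T F ν)) :=
    ⟨hnorm, fun v hv => inner_eq_zero_of_mem_vectorSpan
      (fun x hx => sub_eq_zero.1 ((inner_sub_right _ x f).symm.trans (horth x hx f hf))) hv⟩
  refine (hν.eq_or_eq_neg (dim_add_one_of_mem_facets hF) hn).resolve_right fun hneg => ?_
  refine hT.not_onSide_neg_of_onSide ⟨f, hf⟩ hν (hT.side_mem hF hν) (hT.onSide_side hF hν) ?_
  rw [← hneg]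
  exact fun f hf x hx => hle f (hT.subset_side hF hν.neg hf) x hx

lemma unitNormal_spec (h : Adjacent T P Q) :
    IsFacetNormal (P ∩ Q) (unitNormal P Q) ∧ OnSide (P ∩ Q) (unitNormal P Q) Q ∧
      OnSide (P ∩ Q) (-unitNormal P Q) P := by
  have hF := hT.inter_mem_facets h
  obtain ⟨ν, hν, hP, hQ⟩ := hT.exists_eq_side_of_adjacent h
  have unitNormal_eq : unitNormal P Q = ν := by
    have := hT.unitNormal_side hF hν
    rwa [← hP, ← hQ] at this
  rw [unitNormal_eq]
  refine ⟨hν, ?_, ?_⟩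
  · have := hT.onSide_side hF hν
    rwa [← hQ] at this
  · have := hT.onSide_side hF hν.neg
    rwa [← hP] at this

lemma unitNormal_eq (h : Adjacent T P Q) (hν : IsFacetNormal (P ∩ Q) ν)
    (hQ : OnSide (P ∩ Q) ν Q) : unitNormal P Q = ν := by
  obtain ⟨hn, hQn, -⟩ := hT.unitNormal_spec h
  refine (hν.eq_or_eq_neg h.2.2.2.2 hn).resolve_right fun hneg => ?_
  exact hT.not_onSide_neg_of_onSide h.2.2.2.1 hν h.2.1 hQ (hneg ▸ hQn)

lemma inner_unitNormal_pos (h : Adjacent T P Q) {x q : E d} (hx : x ∈ P ∩ Q)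
    (hq : q ∈ interior Q) : 0 < inner ℝ (unitNormal P Q) (q - x) :=
  let ⟨hn, hQ, _⟩ := hT.unitNormal_spec h
  hn.inner_sub_pos hQ hx hq

end IsTiling

/-! ### Generic segments and connectivity -/

lemma exists_mem_forall_notMem {S : Set (AffineSubspace ℝ (E d))} (hS : S.Countable)
    (hne : ∀ A ∈ S, A ≠ ⊤) {U : Set (E d)} (hU : IsOpen U) (hU' : U.Nonempty) :
    ∃ x ∈ U, ∀ A ∈ S, x ∉ A := by
  by_contra! hcover
  have hnull : MeasureTheory.volume (⋃ A ∈ S, (A : Set (E d))) = 0 :=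
    (MeasureTheory.measure_biUnion_null_iff hS).2 fun A hA =>
      MeasureTheory.Measure.addHaar_affineSubspace _ A (hne A hA)
  have hsub : U ⊆ ⋃ A ∈ S, (A : Set (E d)) := fun x hx =>
    let ⟨_, hA, hxA⟩ := hcover x hx
    mem_biUnion hA hxA
  exact (hU.measure_pos _ hU').ne' (MeasureTheory.measure_mono_null hsub hnull)

lemma affineSpan_ne_top_of_dim_lt {A : Set (E d)} (h : dim A < d) : affineSpan ℝ A ≠ ⊤ := by
  intro htop
  rw [dim, AffineSubspace.vectorSpan_eq_top_of_affineSpan_eq_top ℝ (E d) (E d) htop, finrank_top,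
    finrank_euclideanSpace_fin] at h
  exact h.false

lemma dim_insert_le {V : Type*} [NormedAddCommGroup V] [InnerProductSpace ℝ V] (x : V)
    (A : Set V) : dim (insert x A) ≤ dim A + 1 :=
  finrank_vectorSpan_insert_le_set ℝ A x

lemma mem_affineSpan_insert_of_mem_segment {V : Type*} [AddCommGroup V] [Module ℝ V] {y z p : V}
    {K : Set V} (hy : y ∉ K) (hp : p ∈ segment ℝ y z) (hpK : p ∈ K) :
    z ∈ affineSpan ℝ (insert y K) := by
  rw [segment_eq_image'] at hp
  obtain ⟨t, -, rfl⟩ := hp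
  have ht : t ≠ 0 := by
    rintro rfl
    simp_all
  have hline := AffineMap.lineMap_mem t⁻¹ (subset_affineSpan ℝ _ (mem_insert y K))
    (subset_affineSpan ℝ _ (mem_insert_of_mem y hpK))
  simpa [AffineMap.lineMap_apply_module', smul_smul, inv_mul_cancel₀ ht] using hline

/-- The segment from `y` to `z` avoids all faces of codimension at least two, so that it passes
from one cell to the next through the relative interior of a `(d-1)`-face. -/
def IsGenericSegment (T : Set (Set (E d))) (y z : E d) : Prop :=
  ∀ K ∈ faces T, dim K + 2 ≤ d → Disjoint (segment ℝ y z) K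

lemma IsGenericSegment.symm {y z : E d} (h : IsGenericSegment T y z) : IsGenericSegment T z y := by
  rwa [IsGenericSegment, segment_symm]

lemma forall_mem_Icc_of_eventually {p : ℝ → Prop} {a b : ℝ} (h_init : p a)
    (h_left : ∀ t ∈ Ioc a b, (∀ t' ∈ Ico a t, p t') → p t)
    (h_right : ∀ t ∈ Ico a b, p t → ∀ᶠ t' in 𝓝[>] t, p t') : ∀ t ∈ Icc a b, p t := by
  suffices Icc a b ⊆ {t | ∀ t' ∈ Icc a t, p t'} from
    fun t ht => this ht t (right_mem_Icc.2 ht.1)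
  apply IsClosed.Icc_subset_of_forall_mem_nhdsWithin
  · refine isClosed_of_closure_subset fun t ht => ?_
    have htI : t ∈ Icc a b := closure_minimal inter_subset_right isClosed_Icc ht
    have h_before : ∀ t' ∈ Ico a t, p t' := fun t' ht' =>
      let ⟨_, hlt, hmem, _⟩ := mem_closure_iff.1 ht (Ioi t') isOpen_Ioi ht'.2
      hmem t' ⟨ht'.1, le_of_lt hlt⟩
    refine ⟨fun t' ht' => ?_, htI⟩
    rcases ht'.2.lt_or_eq with hlt | rfl
    · exact h_before t' ⟨ht'.1, hlt⟩
    rcases ht'.1.eq_or_lt with rfl | hpos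
    exacts [h_init, h_left t' ⟨hpos, htI.2⟩ h_before]
  · intro t' ht'
    obtain rfl : t' = a := by simpa using ht'
    exact h_init
  · rintro t ⟨ht, htI⟩
    obtain ⟨c, hc, hsub⟩ := mem_nhdsGT_iff_exists_Ioo_subset.1
      (h_right t htI (ht t (right_mem_Icc.2 htI.1)))
    filter_upwards [Ioo_mem_nhdsGT hc] with t₁ ht₁ t' ht'
    rcases le_or_gt t' t with hle | hgt
    exacts [ht t' ⟨ht'.1, hle⟩, hsub ⟨hgt, ht'.2.trans_lt ht₁.2⟩]

namespace IsTiling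

variable (hT : IsTiling T) {P Q K : Set (E d)}

include hT

lemma notMem_of_mem_interior (hP : P ∈ T) (hK : K ∈ faces T) (hdim : dim K < d) {x : E d}
    (hx : x ∈ interior P) : x ∉ K := by
  rintro hxK
  obtain ⟨Q, hQ, hKQ⟩ := hK
  obtain rfl := hT.eq_of_mem_interior hP hQ hx (hKQ.subset hxK)
  have hPK := hKQ.subset_of_mem_intrinsicInterior subset_rfl
    (interior_subset_intrinsicInterior hx) hxK
  exact ((hT.dim_eq hP).symm.trans_le (dim_mono hPK)).not_gt hdim

lemma exists_isGenericSegment (hP : P ∈ T) {y : E d} (hy : y ∈ interior P) {U : Set (E d)}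
    (hU : IsOpen U) (hU' : U.Nonempty) : ∃ z ∈ U, IsGenericSegment T y z := by
  obtain ⟨z, hz, hz_avoid⟩ := exists_mem_forall_notMem
    (S := (fun K => affineSpan ℝ (insert y K)) '' {K | K ∈ faces T ∧ dim K + 2 ≤ d})
    ((hT.countable_faces.mono fun _ hK => hK.1).image _)
    (by
      rintro _ ⟨K, hK, rfl⟩
      exact affineSpan_ne_top_of_dim_lt (by linarith [dim_insert_le y K, hK.2])) hU hU'
  refine ⟨z, hz, fun K hK hdim => disjoint_left.2 fun p hp hpK => ?_⟩
  exact hz_avoid _ ⟨K, ⟨hK, hdim⟩, rfl⟩ (mem_affineSpan_insert_of_mem_segment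
    (hT.notMem_of_mem_interior hP hK (by omega) hy) hp hpK)

lemma adjacent_of_mem_inter (hP : P ∈ T) (hQ : Q ∈ T) (hne : P ≠ Q) {x : E d} (hxP : x ∈ P)
    (hxQ : x ∈ Q) (hx : ∀ K ∈ faces T, dim K + 2 ≤ d → x ∉ K) : Adjacent T P Q := by
  refine ⟨hP, hQ, hne, ⟨x, hxP, hxQ⟩, ?_⟩
  obtain ⟨hface, -⟩ := hT.faceToFace P hP Q hQ hne ⟨x, hxP, hxQ⟩
  have hcodim : ¬ dim (P ∩ Q) + 2 ≤ d := fun h => hx _ ⟨P, hP, hface⟩ h ⟨hxP, hxQ⟩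
  have hproper : P ∩ Q ≠ P := fun h =>
    let ⟨_, hp⟩ := hT.fullDim P hP
    hne (hT.eq_of_mem_interior hP hQ hp (inter_eq_left.1 h (interior_subset hp)))
  have hlt := hface.dim_lt hproper
  rw [hT.dim_eq hP] at hlt
  omega

lemma segment_induction (hP : P ∈ T) {y z : E d} (hy : y ∈ interior P)
    (hgen : IsGenericSegment T y z) (C : Set (E d) → ℝ → Prop) (h_init : C P 0)
    (h_mono : ∀ Q t t', t ≤ t' → C Q t → C Q t')
    (h_step : ∀ Q Q' t t', 0 ≤ t' → t' < t → t ≤ 1 → C Q t → Adjacent T Q Q' →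
      y + t' • (z - y) ∈ Q → y + t • (z - y) ∈ Q → y + t • (z - y) ∈ Q' → C Q' t) :
    ∀ t ∈ Icc (0 : ℝ) 1, ∀ Q ∈ T, y + t • (z - y) ∈ Q → C Q t := by
  have h_cells (t : ℝ) : ∀ᶠ t' in 𝓝 t, ∀ Q ∈ T, y + t' • (z - y) ∈ Q → y + t • (z - y) ∈ Q :=
    (show Continuous fun t : ℝ => y + t • (z - y) by fun_prop).continuousAt.eventually
      (hT.eventually_mem_cell_imp _)
  refine forall_mem_Icc_of_eventually ?_ ?_ ?_
  · intro Q hQ hyQ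
    rw [zero_smul, add_zero] at hyQ
    rwa [← hT.eq_of_mem_interior hP hQ hy hyQ]
  · intro t ht h_before Q hQ htQ
    obtain ⟨t', hcell, ht'⟩ :=
      (((h_cells t).filter_mono nhdsWithin_le_nhds).and (Ico_mem_nhdsLT ht.1)).exists
    obtain ⟨Q', hQ', ht'Q'⟩ := hT.exists_mem_cell (y + t' • (z - y))
    have hC : C Q' t := h_mono _ _ _ ht'.2.le (h_before t' ht' Q' hQ' ht'Q')
    have htQ' := hcell Q' hQ' ht'Q'
    rcases eq_or_ne Q' Q with rfl | hne
    · exact hC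
    have hseg : y + t • (z - y) ∈ segment ℝ y z := by
      rw [segment_eq_image']
      exact ⟨t, Ioc_subset_Icc_self ht, rfl⟩
    exact h_step Q' Q t t' ht'.1 ht'.2 ht.2 hC (hT.adjacent_of_mem_inter hQ' hQ hne htQ' htQ
      fun K hK hdim => disjoint_left.1 (hgen K hK hdim) hseg) ht'Q' htQ' htQ
  · intro t _ hC
    filter_upwards [(h_cells t).filter_mono nhdsWithin_le_nhds, self_mem_nhdsWithin]
      with t' hcell ht' Q hQ ht'Q
    exact h_mono _ _ _ (le_of_lt ht') (hC Q hQ (hcell Q hQ ht'Q))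

lemma exists_chain {U : Set (E d)} (hU : IsOpen U) (hUc : Convex ℝ U) (hP : P ∈ T) (hQ : Q ∈ T)
    (hPU : (P ∩ U).Nonempty) (hQU : (Q ∩ U).Nonempty) :
    Relation.ReflTransGen
      (fun A B => Adjacent T A B ∧ (A ∩ U).Nonempty ∧ (B ∩ U).Nonempty) P Q := by
  obtain ⟨y, hy, hyU⟩ := hT.interior_inter_nonempty hP hU hPU
  obtain ⟨z, ⟨hz, hzU⟩, hgen⟩ := hT.exists_isGenericSegment hP hy (isOpen_interior.inter hU)
    (hT.interior_inter_nonempty hQ hU hQU)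
  refine hT.segment_induction hP hy hgen (fun A _ => Relation.ReflTransGen
      (fun A B => Adjacent T A B ∧ (A ∩ U).Nonempty ∧ (B ∩ U).Nonempty) P A) .refl
      (fun _ _ _ _ h => h) ?_ 1 ⟨zero_le_one, le_rfl⟩ Q hQ ?_
  · intro A B t t' ht' htt' ht hC hadj _ hA hB
    have hU_mem := hUc.add_smul_sub_mem hyU hzU ⟨ht'.trans htt'.le, ht⟩
    exact hC.tail ⟨hadj, ⟨_, hA, hU_mem⟩, ⟨_, hB, hU_mem⟩⟩
  · simpa using interior_subset hz

lemma reflTransGen_adjacent (hP : P ∈ T) (hQ : Q ∈ T) :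
    Relation.ReflTransGen (Adjacent T) P Q :=
  Relation.ReflTransGen.mono (fun _ _ h => h.1) _ _
    (hT.exists_chain isOpen_univ convex_univ hP hQ (by simpa using hT.nonempty hP)
      (by simpa using hT.nonempty hQ))

lemma reflTransGen_adjacent_of_mem (hP : P ∈ T) (hQ : Q ∈ T) {x : E d} (hxP : x ∈ P)
    (hxQ : x ∈ Q) :
    Relation.ReflTransGen (fun A B => Adjacent T A B ∧ x ∈ A ∧ x ∈ B) P Q := by
  obtain ⟨ε, hε, h_cells⟩ := Metric.eventually_nhds_iff_ball.1 (hT.eventually_mem_cell_imp x)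
  refine Relation.ReflTransGen.mono ?_ _ _ (hT.exists_chain Metric.isOpen_ball (convex_ball x ε)
    hP hQ ⟨x, hxP, Metric.mem_ball_self hε⟩ ⟨x, hxQ, Metric.mem_ball_self hε⟩)
  rintro A B ⟨hadj, ⟨a, haA, ha⟩, ⟨b, hbB, hb⟩⟩
  exact ⟨hadj, h_cells a ha A hadj.1 haA, h_cells b hb B hadj.2.1 hbB⟩

lemma reflTransGen_adjacent_of_subset (hP : P ∈ T) (hQ : Q ∈ T) (hK : K ∈ faces T) (hKP : K ⊆ P)
    (hKQ : K ⊆ Q) :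
    Relation.ReflTransGen (fun A B => Adjacent T A B ∧ K ⊆ A ∧ K ⊆ B) P Q := by
  obtain ⟨x, hx⟩ := hT.nonempty_intrinsicInterior_of_mem_faces hK
  have hxK := intrinsicInterior_subset hx
  refine Relation.ReflTransGen.mono ?_ _ _
    (hT.reflTransGen_adjacent_of_mem hP hQ (hKP hxK) (hKQ hxK))
  rintro A B ⟨hadj, hA, hB⟩
  exact ⟨hadj, hT.face_subset_of_mem_intrinsicInterior hK hadj.1 hx hA,
    hT.face_subset_of_mem_intrinsicInterior hK hadj.2.1 hx hB⟩

end IsTiling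

/-! ### Quarter turns -/

section QuarterTurn

variable {V : Type*} [NormedAddCommGroup V] [InnerProductSpace ℝ V]

/-- `K` is a quarter turn of the orthogonal complement of `W`, extended by zero on `W`. If `W` has
codimension two, it encodes a direction of rotation around `W`. -/
structure IsQuarterTurn (W : Submodule ℝ V) (K : V →ₗ[ℝ] V) : Prop where
  map_eq_zero : ∀ v ∈ W, K v = 0
  inner_map_comm : ∀ v w, inner ℝ (K v) w = -inner ℝ (K w) v
  inner_map_map : ∀ v ∈ Wᗮ, ∀ w ∈ Wᗮ, inner ℝ (K v) (K w) = inner ℝ v w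

variable {W : Submodule ℝ V} {K : V →ₗ[ℝ] V}

namespace IsQuarterTurn

variable (hK : IsQuarterTurn W K)
include hK

lemma inner_map_self (v : V) : inner ℝ (K v) v = 0 := by
  linarith [hK.inner_map_comm v v]

lemma inner_map_of_mem (v : V) {w : V} (hw : w ∈ W) : inner ℝ (K v) w = 0 := by
  rw [hK.inner_map_comm, hK.map_eq_zero w hw, inner_zero_left, neg_zero]

lemma neg : IsQuarterTurn W (-K) where
  map_eq_zero v hv := by simp [hK.map_eq_zero v hv]
  inner_map_comm v w := by simp [hK.inner_map_comm v w]
  inner_map_map v hv w hw := by simp [hK.inner_map_map v hv w hw]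

lemma inner_map_sub_rotate (x y z : V) :
    inner ℝ (K (z - y)) (x - y) = inner ℝ (K (y - x)) (z - x) := by
  have hzy : z - y = (z - x) - (y - x) := by abel
  rw [hzy, ← neg_sub y x, map_sub, inner_neg_right, inner_sub_left, hK.inner_map_self,
    hK.inner_map_comm (z - x)]
  ring

lemma exists_linearIsometry :
    ∃ J : Wᗮ →ₗᵢ[ℝ] Wᗮ, (∀ w, inner ℝ (J w) w = 0) ∧ ∀ w : Wᗮ, (J w : V) = K w := by
  have maps_to : ∀ w ∈ Wᗮ, K w ∈ Wᗮ := fun w _ v hv => by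
    rw [real_inner_comm, hK.inner_map_of_mem w hv]
  exact ⟨(K.restrict maps_to).isometryOfInner fun v w => hK.inner_map_map v v.2 w w.2,
    fun w => hK.inner_map_self w, fun _ => rfl⟩

lemma map_ne_zero [W.HasOrthogonalProjection] {v : V} (hv : v ∉ W) : K v ≠ 0 := by
  obtain ⟨a, ha, b, hb, rfl⟩ := W.exists_add_mem_mem_orthogonal v
  rw [map_add, hK.map_eq_zero a ha, zero_add]
  intro hKb
  have hb_zero := hK.inner_map_map b hb b hb
  rw [hKb, inner_zero_left] at hb_zero
  rw [inner_self_eq_zero.1 hb_zero.symm, add_zero] at hv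
  exact hv ha

lemma inner_map_ne_zero [FiniteDimensional ℝ V]
    (hW : Module.finrank ℝ W + 2 = Module.finrank ℝ V) {v w : V} (hv : v ∉ W)
    (hw : w ∉ W ⊔ ℝ ∙ v) : inner ℝ (K v) w ≠ 0 := by
  have sup_le_orthogonal : W ⊔ ℝ ∙ v ≤ (ℝ ∙ K v)ᗮ := by
    refine sup_le (fun a ha => ?_) ?_
    · exact Submodule.mem_orthogonal_singleton_iff_inner_right.2 (hK.inner_map_of_mem v ha)
    · rw [Submodule.span_singleton_le_iff_mem, Submodule.mem_orthogonal_singleton_iff_inner_right]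
      exact hK.inner_map_self v
  have lt_sup : W < W ⊔ ℝ ∙ v := by
    refine lt_of_le_of_ne le_sup_left fun h => hv ?_
    rw [h]
    exact Submodule.mem_sup_right (Submodule.mem_span_singleton_self v)
  have finrank_lt := Submodule.finrank_lt_finrank_of_lt lt_sup
  have : Fact (Module.finrank ℝ V = (Module.finrank ℝ W + 1) + 1) := ⟨by omega⟩
  have finrank_orthogonal : Module.finrank ℝ (ℝ ∙ K v)ᗮ = Module.finrank ℝ W + 1 :=
    Submodule.finrank_orthogonal_span_singleton (hK.map_ne_zero hv)
  rw [Submodule.eq_of_le_of_finrank_le sup_le_orthogonal (by omega),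
    Submodule.mem_orthogonal_singleton_iff_inner_right] at hw
  exact hw

end IsQuarterTurn

lemma exists_isQuarterTurn_of_linearIsometry [W.HasOrthogonalProjection] (J : Wᗮ →ₗᵢ[ℝ] Wᗮ)
    (hJ : ∀ w, inner ℝ (J w) w = 0) :
    ∃ K : V →ₗ[ℝ] V, IsQuarterTurn W K ∧ ∀ w : Wᗮ, K w = (J w : V) := by
  have skew : ∀ v w : Wᗮ, inner ℝ (J v) w = -inner ℝ (J w) v := fun v w => by
    have h := hJ (v + w)
    rw [map_add, inner_add_left, inner_add_right, inner_add_right, hJ, hJ] at h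
    linarith
  have inner_coe (a : Wᗮ) (w : V) :
      inner ℝ (a : V) w = inner ℝ a (Wᗮ.orthogonalProjectionOnto w) := by
    rw [Submodule.coe_inner]
    exact (Submodule.inner_orthogonalProjectionOnto_eq_of_mem_left a w).symm
  refine ⟨Wᗮ.subtype ∘ₗ J.toLinearMap ∘ₗ (Wᗮ.orthogonalProjectionOnto).toLinearMap,
    ⟨fun v hv => ?_, fun v w => ?_, fun v hv w hw => ?_⟩, fun w => by simp⟩
  · have : Wᗮ.orthogonalProjectionOnto v = 0 :=
      Submodule.orthogonalProjectionOnto_apply_of_mem_orthogonal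
        (Submodule.le_orthogonal_orthogonal W hv)
    simp [this]
  · simp only [LinearMap.comp_apply, Submodule.subtype_apply, LinearIsometry.coe_toLinearMap,
      ContinuousLinearMap.coe_coe, inner_coe]
    exact skew _ _
  · lift v to Wᗮ using hv
    lift w to Wᗮ using hw
    simp [← Submodule.coe_inner]

lemma exists_isQuarterTurn [FiniteDimensional ℝ V]
    (hW : Module.finrank ℝ W + 2 = Module.finrank ℝ V) : ∃ K : V →ₗ[ℝ] V, IsQuarterTurn W K := by
  have finrank_orthogonal : Module.finrank ℝ Wᗮ = 2 := by
    have := W.finrank_add_finrank_orthogonal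
    omega
  have : Fact (Module.finrank ℝ Wᗮ = 2) := ⟨finrank_orthogonal⟩
  let o : Orientation ℝ Wᗮ (Fin 2) :=
    (((stdOrthonormalBasis ℝ Wᗮ).reindex (finCongr finrank_orthogonal)).toBasis).orientation
  obtain ⟨K, hK, -⟩ := exists_isQuarterTurn_of_linearIsometry
    o.rightAngleRotation.toLinearIsometry o.inner_rightAngleRotation_self
  exact ⟨K, hK⟩

end QuarterTurn

/-! ### Facets around a ridge -/

lemma dim_add_two_of_mem_ridges {R : Set (E d)} (hR : R ∈ ridges T) : dim R + 2 = d :=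
  let ⟨_, _, _, hdim⟩ := hR
  hdim

lemma nonempty_of_mem_ridges {R : Set (E d)} (hR : R ∈ ridges T) : R.Nonempty :=
  nonempty_of_mem_faces (mem_faces_of_mem_ridges hR)

/-- A choice of direction of rotation around the ridge `R`. -/
noncomputable def ridgeTurn (R : Set (E d)) : E d →ₗ[ℝ] E d :=
  Classical.epsilon (IsQuarterTurn (vectorSpan ℝ R))

lemma isQuarterTurn_ridgeTurn {R : Set (E d)} (hR : R ∈ ridges T) :
    IsQuarterTurn (vectorSpan ℝ R) (ridgeTurn R) :=
  Classical.epsilon_spec (exists_isQuarterTurn (by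
    rw [finrank_euclideanSpace_fin]
    exact dim_add_two_of_mem_ridges hR))

/-- `u` is the unit vector orthogonal to `R` that points from the ridge `R` into the facet `F`. -/
structure IsInward (R F : Set (E d)) (u : E d) : Prop where
  norm_eq : ‖u‖ = 1
  mem_orthogonal : u ∈ (vectorSpan ℝ R)ᗮ
  mem_vectorSpan : u ∈ vectorSpan ℝ F
  nonneg : ∀ r ∈ R, ∀ x ∈ F, 0 ≤ inner ℝ u (x - r)

/-- The unit vector orthogonal to the ridge `R` that points from `R` into the facet `F`. -/
noncomputable def inward (R F : Set (E d)) : E d := Classical.epsilon (IsInward R F)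

lemma IsFace.exists_mem_orthogonal {A R : Set (E d)} (hR : IsFace A R) :
    ∃ a ∈ (vectorSpan ℝ R)ᗮ, ∀ r ∈ R, ∀ x ∈ A,
      0 ≤ inner ℝ a (x - r) ∧ (inner ℝ a (x - r) = 0 → x ∈ R) := by
  obtain ⟨a, c, hle, heq⟩ := hR.exists_inner
  have hRc : ∀ r ∈ R, inner ℝ a r = c := fun r hr => by
    rw [heq] at hr
    exact hr.2
  refine ⟨-a, neg_mem fun v hv => ?_, fun r hr x hx => ?_⟩
  · rw [real_inner_comm]
    exact inner_eq_zero_of_mem_vectorSpan hRc hv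
  · rw [inner_neg_left, inner_sub_right, hRc r hr, heq]
    exact ⟨by linarith [hle x hx], fun h => ⟨hx, by linarith⟩⟩

lemma IsFace.exists_isInward {F R : Set (E d)} (hR : IsFace F R) (hne : R ≠ F) :
    ∃ u, IsInward R F u := by
  obtain ⟨a, ha, hside⟩ := hR.exists_mem_orthogonal
  obtain ⟨r, hr⟩ := hR.1
  let u : E d := (vectorSpan ℝ F).orthogonalProjectionOnto a
  have inner_u : ∀ v ∈ vectorSpan ℝ F, inner ℝ u v = inner ℝ a v := fun v hv =>
    Submodule.inner_orthogonalProjectionOnto_eq_of_mem_right ⟨v, hv⟩ a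
  have inner_u_sub : ∀ r ∈ R, ∀ x ∈ F, inner ℝ u (x - r) = inner ℝ a (x - r) := fun r hr x hx =>
    inner_u _ (vsub_mem_vectorSpan ℝ hx (hR.subset hr))
  have hu : u ≠ 0 := fun hu => hne <| hR.subset.antisymm fun x hx =>
    (hside r hr x hx).2 (by rw [← inner_u_sub r hr x hx, hu, inner_zero_left])
  refine ⟨‖u‖⁻¹ • u, ?_, Submodule.smul_mem _ _ fun v hv => ?_,
    Submodule.smul_mem _ _ (Subtype.coe_prop _), fun r hr x hx => ?_⟩
  · rw [norm_smul, norm_inv, norm_norm, inv_mul_cancel₀ (norm_ne_zero_iff.2 hu)]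
  · rw [real_inner_comm, inner_u v (vectorSpan_mono ℝ hR.subset hv), real_inner_comm, ha v hv]
  · rw [real_inner_smul_left, inner_u_sub r hr x hx]
    exact mul_nonneg (inv_nonneg.2 (norm_nonneg u)) (hside r hr x hx).1

section Inward

variable {R F : Set (E d)} {u : E d}

lemma exists_mem_facet_notMem_ridge (hR : R ∈ ridges T) (hF : F ∈ facetsAround T R) :
    ∃ x ∈ F, x ∉ R := by
  by_contra! hFR
  have := dim_mono hFR
  have := dim_add_two_of_mem_ridges hR
  have := dim_add_one_of_mem_facets hF.1
  omega

namespace IsInward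

variable (hu : IsInward R F u)
include hu

lemma inner_self : inner ℝ u u = 1 := by
  rw [real_inner_self_eq_norm_sq, hu.norm_eq, one_pow]

lemma mem_vectorSpan_ridge (hR : R ∈ ridges T) (hF : F ∈ facetsAround T R) {v : E d}
    (hv : v ∈ vectorSpan ℝ F) (huv : inner ℝ u v = 0) : v ∈ vectorSpan ℝ R := by
  have hle : vectorSpan ℝ R ≤ vectorSpan ℝ F ⊓ (ℝ ∙ u)ᗮ := le_inf (vectorSpan_mono ℝ hF.2)
    fun w hw => Submodule.mem_orthogonal_singleton_iff_inner_left.2 (hu.mem_orthogonal w hw)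
  have hlt : vectorSpan ℝ F ⊓ (ℝ ∙ u)ᗮ < vectorSpan ℝ F := by
    refine lt_of_le_of_ne inf_le_left fun h => ?_
    have hu_mem := hu.mem_vectorSpan
    rw [← h, Submodule.mem_inf, Submodule.mem_orthogonal_singleton_iff_inner_left,
      hu.inner_self] at hu_mem
    exact one_ne_zero hu_mem.2
  have finrank_lt := Submodule.finrank_lt_finrank_of_lt hlt
  have hdimR := dim_add_two_of_mem_ridges hR
  have hdimF := dim_add_one_of_mem_facets hF.1
  rw [dim] at hdimR hdimF
  rw [Submodule.eq_of_le_of_finrank_le hle (by omega)]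
  exact ⟨hv, Submodule.mem_orthogonal_singleton_iff_inner_right.2 huv⟩

lemma sub_smul_mem_vectorSpan_ridge (hR : R ∈ ridges T) (hF : F ∈ facetsAround T R) {v : E d}
    (hv : v ∈ vectorSpan ℝ F) : v - inner ℝ u v • u ∈ vectorSpan ℝ R := by
  refine hu.mem_vectorSpan_ridge hR hF (sub_mem hv (Submodule.smul_mem _ _ hu.mem_vectorSpan)) ?_
  rw [inner_sub_right, inner_smul_right, hu.inner_self, mul_one, sub_self]

lemma inner_eq_mul (hR : R ∈ ridges T) (hF : F ∈ facetsAround T R) {a v : E d}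
    (ha : a ∈ (vectorSpan ℝ R)ᗮ) (hv : v ∈ vectorSpan ℝ F) :
    inner ℝ a v = inner ℝ u v * inner ℝ a u := by
  have := Submodule.inner_left_of_mem_orthogonal (hu.sub_smul_mem_vectorSpan_ridge hR hF hv) ha
  rwa [inner_sub_right, inner_smul_right, sub_eq_zero] at this

lemma eq_or_eq_neg (hR : R ∈ ridges T) (hF : F ∈ facetsAround T R) {v : E d} (hv : ‖v‖ = 1)
    (hvR : v ∈ (vectorSpan ℝ R)ᗮ) (hvF : v ∈ vectorSpan ℝ F) : v = u ∨ v = -u := by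
  have residue_mem : v - inner ℝ u v • u ∈ (vectorSpan ℝ R)ᗮ :=
    sub_mem hvR (Submodule.smul_mem _ _ hu.mem_orthogonal)
  have v_eq : v = inner ℝ u v • u := sub_eq_zero.1 <| inner_self_eq_zero.1 <|
    residue_mem _ (hu.sub_smul_mem_vectorSpan_ridge hR hF hvF)
  have abs_eq_one : |inner ℝ u v| = 1 := by
    rw [← Real.norm_eq_abs, ← mul_one ‖inner ℝ u v‖, ← hu.norm_eq, ← norm_smul, ← v_eq, hv,
      hu.norm_eq]
  rcases (abs_eq zero_le_one).1 abs_eq_one with h | h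
  · exact Or.inl (by rw [v_eq, h, one_smul])
  · exact Or.inr (by rw [v_eq, h, neg_one_smul])

end IsInward

namespace IsTiling

variable (hT : IsTiling T)
include hT

lemma isFace_of_mem_ridges {P : Set (E d)} (hR : R ∈ ridges T) (hP : P ∈ T) (hRP : R ⊆ P) :
    IsFace P R := by
  obtain ⟨Q, hQ, hRQ, -⟩ := hR
  exact hT.isFace_of_subset hQ hP hRQ hRP

lemma isFace_of_mem_facetsAround (hR : R ∈ ridges T) (hF : F ∈ facetsAround T R) :
    IsFace F R := by
  obtain ⟨⟨P, hP, hFP, -⟩, hRF⟩ := hF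
  exact (hT.isFace_of_mem_ridges hR hP (hRF.trans hFP.subset)).restrict hRF hFP.subset

lemma isInward_inward (hR : R ∈ ridges T) (hF : F ∈ facetsAround T R) :
    IsInward R F (inward R F) := by
  obtain ⟨x, hx, hxR⟩ := exists_mem_facet_notMem_ridge hR hF
  refine Classical.epsilon_spec ((hT.isFace_of_mem_facetsAround hR hF).exists_isInward ?_)
  rintro rfl
  exact hxR hx

lemma inner_inward_pos (hR : R ∈ ridges T) (hF : F ∈ facetsAround T R) (hu : IsInward R F u)
    {r x : E d} (hr : r ∈ R) (hx : x ∈ F) (hxR : x ∉ R) : 0 < inner ℝ u (x - r) := by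
  refine lt_of_le_of_ne (hu.nonneg r hr x hx) fun h => hxR ?_
  obtain ⟨a, ha, hside⟩ := (hT.isFace_of_mem_facetsAround hR hF).exists_mem_orthogonal
  refine (hside r hr x hx).2 (Submodule.inner_left_of_mem_orthogonal ?_ ha)
  exact hu.mem_vectorSpan_ridge hR hF (vsub_mem_vectorSpan ℝ hx (hF.2 hr)) h.symm

lemma eq_inward (hR : R ∈ ridges T) (hF : F ∈ facetsAround T R) (hu : IsInward R F u) :
    u = inward R F := by
  have hu' := hT.isInward_inward hR hF
  refine (hu'.eq_or_eq_neg hR hF hu.norm_eq hu.mem_orthogonal hu.mem_vectorSpan).resolve_right ?_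
  rintro rfl
  obtain ⟨r, hr⟩ := nonempty_of_mem_ridges hR
  obtain ⟨x, hx, hxR⟩ := exists_mem_facet_notMem_ridge hR hF
  have hpos := hT.inner_inward_pos hR hF hu hr hx hxR
  have hpos' := hT.inner_inward_pos hR hF hu' hr hx hxR
  rw [inner_neg_left] at hpos
  linarith

lemma zeroTorsion_iff {s : Set (E d) → ℝ} :
    ZeroTorsion T s ↔ ∀ R ∈ ridges T, ∀ K, IsQuarterTurn (vectorSpan ℝ R) K →
      ∑ᶠ F ∈ facetsAround T R, s F • K (inward R F) = 0 := by
  refine forall₂_congr fun R hR => ⟨fun h K hK => ?_, fun h n hn => ?_⟩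
  · obtain ⟨J, hJ, hJK⟩ := hK.exists_linearIsometry
    refine h (fun F => K (inward R F)) ⟨J, hJ, fun F hF => ?_⟩
    have hu := hT.isInward_inward hR hF
    exact ⟨⟨_, hu.mem_orthogonal⟩, hu.norm_eq, hu.mem_vectorSpan, hu.nonneg,
      (hJK ⟨_, hu.mem_orthogonal⟩).symm⟩
  · obtain ⟨J, hJ, hn⟩ := hn
    obtain ⟨K, hK, hKJ⟩ := exists_isQuarterTurn_of_linearIsometry J hJ
    refine (finsum_mem_congr rfl fun F hF => ?_).trans (h K hK)
    obtain ⟨u, hu_norm, hu_mem, hu_nonneg, hnu⟩ := hn F hF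
    have hu_eq : (u : E d) = inward R F :=
      hT.eq_inward hR hF ⟨hu_norm, u.2, hu_mem, hu_nonneg⟩
    rw [hnu, ← hKJ, hu_eq]

end IsTiling

namespace IsQuarterTurn

variable {K : E d →ₗ[ℝ] E d} (hK : IsQuarterTurn (vectorSpan ℝ R) K)
include hK

lemma map_eq_smul (hR : R ∈ ridges T) (hF : F ∈ facetsAround T R) (hu : IsInward R F u) {v : E d}
    (hv : v ∈ vectorSpan ℝ F) : K v = inner ℝ u v • K u := by
  have := hK.map_eq_zero _ (hu.sub_smul_mem_vectorSpan_ridge hR hF hv)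
  rwa [map_sub, map_smul, sub_eq_zero] at this

lemma isFacetNormal (hR : R ∈ ridges T) (hF : F ∈ facetsAround T R) (hu : IsInward R F u) :
    IsFacetNormal F (K u) := by
  refine ⟨?_, fun v hv => ?_⟩
  · have := hK.inner_map_map u hu.mem_orthogonal u hu.mem_orthogonal
    rw [real_inner_self_eq_norm_sq, hu.inner_self] at this
    exact (pow_eq_one_iff_of_nonneg (norm_nonneg _) two_ne_zero).1 this
  · rw [hK.inner_map_comm, hK.map_eq_smul hR hF hu hv, real_inner_smul_left, hK.inner_map_self,
      mul_zero, neg_zero]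

end IsQuarterTurn

end Inward

/-! ### Cells around a ridge -/

lemma IsPolytope.exists_sub_smul_support {V : Type*} [NormedAddCommGroup V]
    [InnerProductSpace ℝ V] {P : Set V} (hP : IsPolytope P) {a b r : V}
    (ha : ∀ x ∈ P, 0 ≤ inner ℝ a (x - r))
    (hb : ∀ x ∈ P, inner ℝ a (x - r) = 0 → 0 ≤ inner ℝ b (x - r))
    (hne : ∃ x ∈ P, 0 < inner ℝ a (x - r)) :
    ∃ m : ℝ, (∀ x ∈ P, 0 ≤ inner ℝ (b - m • a) (x - r)) ∧
      ∃ v ∈ P, 0 < inner ℝ a (v - r) ∧ inner ℝ (b - m • a) (v - r) = 0 := by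
  obtain ⟨S, hS, rfl⟩ := hP
  have hSP := subset_convexHull ℝ S
  have nonneg_of_vertices (c : V) (hc : ∀ v ∈ S, 0 ≤ inner ℝ c (v - r)) :
      ∀ x ∈ convexHull ℝ S, 0 ≤ inner ℝ c (x - r) := fun x hx => by
    have := inner_le_of_mem_convexHull (a := -c) (c := inner ℝ (-c) r) (fun v hv => by
      have := hc v hv
      rw [inner_sub_right] at this
      simpa only [inner_neg_left, neg_le_neg_iff] using sub_nonneg.1 this) x hx
    rw [inner_neg_left, inner_neg_left] at this
    rw [inner_sub_right]
    linarith
  have hS_pos : {v ∈ S | 0 < inner ℝ a (v - r)}.Nonempty := by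
    by_contra! hempty
    obtain ⟨x, hx, hpos⟩ := hne
    have := nonneg_of_vertices (-a) (fun v hv => by
      rw [inner_neg_left, neg_nonneg]
      exact not_lt.1 fun h => eq_empty_iff_forall_notMem.1 hempty v ⟨hv, h⟩) x hx
    rw [inner_neg_left] at this
    linarith
  -- The slope `m` is the smallest of the ratios `b / a` at the vertices.
  obtain ⟨v, ⟨hv, hv_pos⟩, hmin⟩ := exists_min_image {v ∈ S | 0 < inner ℝ a (v - r)}
    (fun v => inner ℝ b (v - r) / inner ℝ a (v - r)) (hS.sep _) hS_pos
  refine ⟨inner ℝ b (v - r) / inner ℝ a (v - r), nonneg_of_vertices _ fun w hw => ?_, v, hSP hv,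
    hv_pos, ?_⟩
  · rw [inner_sub_left, real_inner_smul_left, sub_nonneg]
    rcases (ha w (hSP hw)).eq_or_lt with h | h
    · rw [← h, mul_zero]
      exact hb w (hSP hw) h.symm
    · exact (le_div_iff₀ h).1 (hmin w ⟨hw, h⟩)
  · rw [inner_sub_left, real_inner_smul_left, div_mul_cancel₀ _ hv_pos.ne', sub_self]

namespace IsTiling

variable (hT : IsTiling T) {R F F' P : Set (E d)}
include hT

lemma finite_facetsAround (hR : R ∈ ridges T) : (facetsAround T R).Finite := by
  obtain ⟨r, hr⟩ := nonempty_of_mem_ridges hR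
  refine (hT.finite_faces_inter_nonempty (isCompact_singleton (x := r))).subset fun F hF => ?_
  exact ⟨mem_faces_of_mem_facets hF.1, r, hF.2 hr, rfl⟩

lemma inner_inward_nonneg_of_onSide (hR : R ∈ ridges T) (hF : F ∈ facetsAround T R)
    (hF' : F' ∈ facetsAround T R) {ν : E d} (hν : IsFacetNormal F ν) (hside : OnSide F ν P)
    (hF'P : F' ⊆ P) : 0 ≤ inner ℝ ν (inward R F') := by
  obtain ⟨r, hr⟩ := nonempty_of_mem_ridges hR
  obtain ⟨x, hx, hxR⟩ := exists_mem_facet_notMem_ridge hR hF'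
  have hu := hT.isInward_inward hR hF'
  have hνR : ν ∈ (vectorSpan ℝ R)ᗮ := fun v hv => by
    rw [real_inner_comm]
    exact hν.2 v (vectorSpan_mono ℝ hF.2 hv)
  have hνx : 0 ≤ inner ℝ ν (x - r) := by
    rw [inner_sub_right, sub_nonneg]
    exact hside r (hF.2 hr) x (hF'P hx)
  have hxr : x - r ∈ vectorSpan ℝ F' := vsub_mem_vectorSpan ℝ hx (hF'.2 hr)
  rw [hu.inner_eq_mul hR hF' hνR hxr] at hνx
  exact nonneg_of_mul_nonneg_right hνx (hT.inner_inward_pos hR hF' hu hr hx hxR)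

lemma injOn_side (hR : R ∈ ridges T) {K : E d →ₗ[ℝ] E d}
    (hK : IsQuarterTurn (vectorSpan ℝ R) K) :
    InjOn (fun F => side T F (K (inward R F))) (facetsAround T R) := by
  intro F hF F' hF' heq
  obtain ⟨r, hr⟩ := nonempty_of_mem_ridges hR
  have hu := hT.isInward_inward hR hF
  have hu' := hT.isInward_inward hR hF'
  have hν := hK.isFacetNormal hR hF hu
  have hν' := hK.isFacetNormal hR hF' hu'
  obtain ⟨hP, hFP, hside⟩ := hT.side_spec hF.1 hν
  obtain ⟨-, hF'P, hside'⟩ := hT.side_spec hF'.1 hν'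
  simp only at heq
  rw [← heq] at hF'P hside'
  have inner_eq_zero : inner ℝ (K (inward R F)) (inward R F') = 0 := by
    have := hT.inner_inward_nonneg_of_onSide hR hF hF' hν hside hF'P
    have := hT.inner_inward_nonneg_of_onSide hR hF' hF hν' hside' hFP
    linarith [hK.inner_map_comm (inward R F) (inward R F')]
  rcases hu.eq_or_eq_neg hR hF hu'.norm_eq hu'.mem_orthogonal
    (hν.mem_vectorSpan (dim_add_one_of_mem_facets hF.1) inner_eq_zero) with h | h
  · rw [h] at hν'
    refine subset_antisymm (fun x hx => ?_) (fun x hx => ?_)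
    · exact hT.mem_facet_of_inner_eq hF'.1 hν' hP hF'P (hF'.2 hr) (hFP hx)
        (hν.inner_eq hx (hF.2 hr))
    · exact hT.mem_facet_of_inner_eq hF.1 hν hP hFP (hF.2 hr) (hF'P hx)
        (hν'.inner_eq hx (hF'.2 hr))
  · refine absurd (fun f hf x hx => ?_)
      (hT.not_onSide_neg_of_onSide ⟨r, hF.2 hr⟩ hν hP hside)
    rw [h, map_neg] at hside'
    rw [hν.neg.inner_eq hf (hF.2 hr)]
    exact hside' r (hF'.2 hr) x hx

lemma mem_facetsAround_of_support (hR : R ∈ ridges T) (hP : P ∈ T) (hRP : R ⊆ P) {r v a : E d}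
    (hr : r ∈ R) (ha : a ≠ 0) (haP : ∀ x ∈ P, 0 ≤ inner ℝ a (x - r))
    (haR : ∀ x ∈ R, inner ℝ a (x - r) = 0) (hv : v ∈ P) (hvR : v ∉ R)
    (hav : inner ℝ a (v - r) = 0) : {x ∈ P | inner ℝ a (x - r) = 0} ∈ facetsAround T R := by
  have hRF : R ⊆ {x ∈ P | inner ℝ a (x - r) = 0} := fun x hx => ⟨hRP hx, haR x hx⟩
  have hFP : IsFace P {x ∈ P | inner ℝ a (x - r) = 0} := by
    refine isFace_of_inner (a := -a) (c := inner ℝ (-a) r) ⟨r, hRF hr⟩ (fun x hx => ?_) ?_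
    · simpa only [inner_neg_left, neg_le_neg_iff, inner_sub_right, sub_nonneg] using haP x hx
    · ext x
      simp only [inner_neg_left, neg_inj, inner_sub_right, sub_eq_zero]
  refine ⟨⟨P, hP, hFP, ?_⟩, hRF⟩
  have hdim_lt := hFP.dim_lt fun h => by
    obtain ⟨p, hp⟩ := hT.fullDim P hP
    have hpos := lt_inner_of_mem_interior ha (c := inner ℝ a r) (fun x hx => by
      simpa only [inner_sub_right, sub_nonneg] using haP x hx) hp
    have hp_zero := (h.ge (interior_subset hp)).2
    rw [inner_sub_right] at hp_zero
    linarith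
  have hlt_dim := ((hT.isFace_of_mem_ridges hR hP hRP).restrict hRF hFP.subset).dim_lt fun h =>
    hvR (h ▸ ⟨hv, hav⟩)
  have := dim_add_two_of_mem_ridges hR
  rw [hT.dim_eq hP] at hdim_lt
  omega

lemma onSide_map_inward (hR : R ∈ ridges T) (hF : F ∈ facetsAround T R) {K : E d →ₗ[ℝ] E d}
    (hK : IsQuarterTurn (vectorSpan ℝ R) K) {a b r v : E d} (hr : r ∈ R)
    (ha : a ∈ (vectorSpan ℝ R)ᗮ) (hv : v ∈ F) (hav : 0 < inner ℝ a (v - r))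
    (hbP : ∀ x ∈ P, 0 ≤ inner ℝ b (x - r)) (hbF : ∀ x ∈ F, inner ℝ b (x - r) = 0)
    (hba : 0 < inner ℝ b (K a)) : OnSide F (K (inward R F)) P := by
  have hu := hT.isInward_inward hR hF
  have hν := hK.isFacetNormal hR hF hu
  have hb_eq := hν.eq_smul (dim_add_one_of_mem_facets hF.1) (a := b) fun w hw =>
    inner_eq_zero_of_mem_vectorSpan (A := F) (c := inner ℝ b r)
      (fun x hx => by simpa only [inner_sub_right, sub_eq_zero] using hbF x hx) hw
  have inner_inward_pos : 0 < inner ℝ (inward R F) a := by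
    have hvr : v - r ∈ vectorSpan ℝ F := vsub_mem_vectorSpan ℝ hv (hF.2 hr)
    rw [hu.inner_eq_mul hR hF ha hvr, mul_comm] at hav
    rw [real_inner_comm]
    exact pos_of_mul_pos_left hav (hu.nonneg r hr v hv)
  have coeff_pos : 0 < inner ℝ (K (inward R F)) b := by
    rw [hb_eq, real_inner_smul_left, hK.inner_map_map _ hu.mem_orthogonal a ha] at hba
    exact pos_of_mul_pos_left hba inner_inward_pos.le
  intro f hf x hx
  have hfx : 0 ≤ inner ℝ b (x - r) - inner ℝ b (f - r) := by
    rw [hbF f hf, sub_zero]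
    exact hbP x hx
  rw [← inner_sub_right, sub_sub_sub_cancel_right, hb_eq, real_inner_smul_left] at hfx
  rw [← sub_nonneg, ← inner_sub_right]
  exact nonneg_of_mul_nonneg_right hfx coeff_pos

-- The facet of `P` to be found is cut out by the last hyperplane through `R` that still supports
-- `P` when a supporting hyperplane is turned around `R`.
lemma surjOn_side (hR : R ∈ ridges T) {K : E d →ₗ[ℝ] E d}
    (hK : IsQuarterTurn (vectorSpan ℝ R) K) :
    SurjOn (fun F => side T F (K (inward R F))) (facetsAround T R) {P | P ∈ T ∧ R ⊆ P} := by
  rintro P ⟨hP, hRP⟩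
  obtain ⟨r, hr⟩ := nonempty_of_mem_ridges hR
  obtain ⟨a, ha, hsupport⟩ := (hT.isFace_of_mem_ridges hR hP hRP).exists_mem_orthogonal
  have inner_sub_eq_zero {b : E d} (hb : b ∈ (vectorSpan ℝ R)ᗮ) {x : E d} (hx : x ∈ R) :
      inner ℝ b (x - r) = 0 :=
    Submodule.inner_left_of_mem_orthogonal (vsub_mem_vectorSpan ℝ hx hr) hb
  have hKa : K a ∈ (vectorSpan ℝ R)ᗮ := fun v hv => by
    rw [real_inner_comm, hK.inner_map_of_mem a hv]
  obtain ⟨p, hp, hpR⟩ : ∃ p ∈ P, p ∉ R := by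
    by_contra! hPR
    have := dim_mono hPR
    have := dim_add_two_of_mem_ridges hR
    have := hT.dim_eq hP
    omega
  obtain ⟨m, hψP, v, hv, hav, hψv⟩ := (hT.polytope P hP).exists_sub_smul_support (b := K a)
    (fun x hx => (hsupport r hr x hx).1)
    (fun x hx h => (inner_sub_eq_zero hKa ((hsupport r hr x hx).2 h)).ge)
    ⟨p, hp, (hsupport r hr p hp).1.lt_of_ne fun h => hpR ((hsupport r hr p hp).2 h.symm)⟩
  set ψ := K a - m • a
  have inner_ψ_pos : 0 < inner ℝ ψ (K a) := by
    rw [inner_sub_left, real_inner_smul_left, hK.inner_map_map a ha a ha, real_inner_comm (K a) a,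
      hK.inner_map_self, mul_zero, sub_zero, real_inner_self_pos]
    rintro rfl
    rw [inner_zero_left] at hav
    exact hav.false
  have hψ_ne : ψ ≠ 0 := fun h => by
    rw [h, inner_zero_left] at inner_ψ_pos
    exact inner_ψ_pos.false
  have hψR : ψ ∈ (vectorSpan ℝ R)ᗮ := sub_mem hKa (Submodule.smul_mem _ _ ha)
  have hF := hT.mem_facetsAround_of_support hR hP hRP hr hψ_ne hψP
    (fun x hx => inner_sub_eq_zero hψR hx) hv
    (fun hvR => hav.ne' (inner_sub_eq_zero ha hvR)) hψv
  set F := {x ∈ P | inner ℝ ψ (x - r) = 0}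
  have hν := hK.isFacetNormal hR hF (hT.isInward_inward hR hF)
  exact ⟨F, hF, (hT.eq_side_of_onSide hF.1 hν hP (sep_subset _ _) (hT.onSide_map_inward hR hF hK hr
    ha ⟨hv, hψv⟩ hav hψP (fun x hx => hx.2) inner_ψ_pos)).symm⟩

lemma bijOn_side (hR : R ∈ ridges T) {K : E d →ₗ[ℝ] E d}
    (hK : IsQuarterTurn (vectorSpan ℝ R) K) :
    BijOn (fun F => side T F (K (inward R F))) (facetsAround T R) {P | P ∈ T ∧ R ⊆ P} := by
  refine ⟨fun F hF => ?_, hT.injOn_side hR hK, hT.surjOn_side hR hK⟩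
  have hν := hK.isFacetNormal hR hF (hT.isInward_inward hR hF)
  exact ⟨hT.side_mem hF.1 hν, hF.2.trans (hT.subset_side hF.1 hν)⟩

-- Every cell around a ridge lies on the positive side of one facet and on the negative side of
-- another, so the sum of the increments telescopes.
lemma zeroTorsion_of_increments {s : Set (E d) → ℝ} {h : Set (E d) → E d}
    (hs : ∀ F ∈ facets T, ∀ ν, IsFacetNormal F ν → s F • ν = h (side T F ν) - h (side T F (-ν))) :
    ZeroTorsion T s := by
  rw [hT.zeroTorsion_iff]
  intro R hR K hK
  have sum_side {K : E d →ₗ[ℝ] E d} (hK : IsQuarterTurn (vectorSpan ℝ R) K) :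
      ∑ᶠ F ∈ facetsAround T R, h (side T F (K (inward R F))) = ∑ᶠ P ∈ {P | P ∈ T ∧ R ⊆ P}, h P :=
    finsum_mem_eq_of_bijOn _ (hT.bijOn_side hR hK) fun _ _ => rfl
  calc ∑ᶠ F ∈ facetsAround T R, s F • K (inward R F)
      = ∑ᶠ F ∈ facetsAround T R,
          (h (side T F (K (inward R F))) - h (side T F ((-K) (inward R F)))) :=
        finsum_mem_congr rfl fun F hF =>
          hs F hF.1 _ (hK.isFacetNormal hR hF (hT.isInward_inward hR hF))
    _ = 0 := by
        rw [finsum_mem_sub_distrib _ _ (hT.finite_facetsAround hR), sum_side hK, sum_side hK.neg,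
          sub_self]

end IsTiling

/-! ### A discrete Stokes formula -/

namespace IsTiling

variable (hT : IsTiling T) {R F : Set (E d)}
include hT

lemma mem_intrinsicInterior_or_exists_ridge (hF : F ∈ facets T) {x : E d} (hx : x ∈ F)
    (hlow : ∀ K ∈ faces T, dim K + 3 ≤ d → x ∉ K) :
    x ∈ intrinsicInterior ℝ F ∨ ∃ R ∈ ridges T, R ⊆ F ∧ x ∈ intrinsicInterior ℝ R := by
  obtain ⟨K, hK, hxK⟩ :=
    (hT.isPolytope_of_mem_faces (mem_faces_of_mem_facets hF)).exists_isFace_mem_intrinsicInterior hx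
  obtain ⟨P, hP, hFP, hdim⟩ := hF
  have hKP := hFP.trans (hT.polytope P hP) hK
  rcases eq_or_ne K F with rfl | hKF
  · exact Or.inl hxK
  · have hK_lt := hK.dim_lt hKF
    have hK_low : ¬ dim K + 3 ≤ d := fun h => hlow K ⟨P, hP, hKP⟩ h (intrinsicInterior_subset hxK)
    exact Or.inr ⟨K, ⟨P, hP, hKP, by omega⟩, hK.subset, hxK⟩

lemma mem_intrinsicInterior_of_mem_ridge (hR : R ∈ ridges T) (hF : F ∈ facetsAround T R) {x : E d}
    (hx : x ∈ R) (hlow : ∀ K ∈ faces T, dim K + 3 ≤ d → x ∉ K) : x ∈ intrinsicInterior ℝ R := by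
  have hRF := hT.isFace_of_mem_facetsAround hR hF
  have hdimR := dim_add_two_of_mem_ridges hR
  rcases hT.mem_intrinsicInterior_or_exists_ridge hF.1 (hF.2 hx) hlow with h | ⟨R', hR', hR'F, h⟩
  · have := dim_mono (hRF.subset_of_mem_intrinsicInterior subset_rfl h hx)
    have := dim_add_one_of_mem_facets hF.1
    omega
  · have hR'R := hRF.subset_of_mem_intrinsicInterior hR'F h hx
    have hface := (hT.isFace_of_mem_facetsAround hR' ⟨hF.1, hR'F⟩).restrict hR'R hRF.subset
    have := dim_add_two_of_mem_ridges hR'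
    rwa [← hface.eq_of_dim_le (by omega)]

lemma eventually_mem_facet (hR : R ∈ ridges T) (hF : F ∈ facetsAround T R) {r v : E d}
    (hr : r ∈ intrinsicInterior ℝ R) (hv : v ∈ vectorSpan ℝ F)
    (hpos : 0 < inner ℝ (inward R F) v) : ∀ᶠ t in 𝓝[>] (0 : ℝ), r + t • v ∈ F := by
  have hu := hT.isInward_inward hR hF
  have hrR := intrinsicInterior_subset hr
  obtain ⟨x, hx, hxR⟩ := exists_mem_facet_notMem_ridge hR hF
  have hx_pos := hT.inner_inward_pos hR hF hu hrR hx hxR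
  have hxr : x - r ∈ vectorSpan ℝ F := vsub_mem_vectorSpan ℝ hx (hF.2 hrR)
  set c := inner ℝ (inward R F) v / inner ℝ (inward R F) (x - r)
  have hw : v - c • (x - r) ∈ vectorSpan ℝ R := by
    refine hu.mem_vectorSpan_ridge hR hF (sub_mem hv (Submodule.smul_mem _ _ hxr)) ?_
    rw [inner_sub_right, inner_smul_right, div_mul_cancel₀ _ hx_pos.ne', sub_self]
  have := eventually_add_smul_mem_of_convex
    (hT.isPolytope_of_mem_faces (mem_faces_of_mem_facets hF.1)).convex hF.2 hr hx hw
    (c := c) (div_pos hpos hx_pos).le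
  simpa only [add_sub_cancel] using this

lemma finite_ridges_subset (hF : F ∈ facets T) : {R ∈ ridges T | R ⊆ F}.Finite :=
  (hT.isPolytope_of_mem_faces (mem_faces_of_mem_facets hF)).finite_faces.subset
    fun _ hR => hT.isFace_of_mem_facetsAround hR.1 ⟨hF, hR.2⟩

end IsTiling

/-- The segment from `p` to `q` enters the facet `F` through the ridge `R`. -/
structure EntersThrough (T : Set (Set (E d))) (p q : E d) (F R : Set (E d)) : Prop where
  mem_ridges : R ∈ ridges T
  subset : R ⊆ F
  nonempty : (segment ℝ p q ∩ R).Nonempty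
  inner_pos : 0 < inner ℝ (inward R F) (q - p)

lemma exists_first_mem_of_segment {V : Type*} [NormedAddCommGroup V] [NormedSpace ℝ V] {F : Set V}
    (hF : IsClosed F) {p q : V} (hp : p ∉ F) (hne : (segment ℝ p q ∩ F).Nonempty) :
    ∃ r ∈ segment ℝ p q ∩ F, ¬ ∀ᶠ t in 𝓝[>] (0 : ℝ), r + t • (p - q) ∈ F := by
  have hcompact : IsCompact {t ∈ Icc (0 : ℝ) 1 | p + t • (q - p) ∈ F} := by
    have : Continuous fun t : ℝ => p + t • (q - p) := by fun_prop
    exact isCompact_Icc.inter_right (hF.preimage this)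
  rw [segment_eq_image'] at hne ⊢
  obtain ⟨_, ⟨t₁, ht₁, rfl⟩, ht₁F⟩ := hne
  obtain ⟨t₀, ⟨ht₀, ht₀F⟩, hmin⟩ := hcompact.exists_isLeast ⟨t₁, ht₁, ht₁F⟩
  refine ⟨_, ⟨⟨t₀, ht₀, rfl⟩, ht₀F⟩, fun h => ?_⟩
  have ht₀_pos : 0 < t₀ := ht₀.1.lt_of_ne fun h0 => hp (by
    rwa [← h0, zero_smul, add_zero] at ht₀F)
  obtain ⟨ε, hεF, hε⟩ := (h.and (Ioo_mem_nhdsGT ht₀_pos)).exists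
  have hεF' : p + (t₀ - ε) • (q - p) ∈ F := by
    convert hεF using 1
    module
  have := hmin ⟨⟨sub_nonneg.2 hε.2.le, by linarith [hε.1, ht₀.2]⟩, hεF'⟩
  linarith [hε.1]

namespace EntersThrough

variable (hT : IsTiling T) {p q : E d} {F R R' : Set (E d)} (hF : F ∈ facets T)
include hT hF

lemma notMem_of_lt (h : EntersThrough T p q F R) {t t' : ℝ} (ht : p + t • (q - p) ∈ R)
    (htt' : t' < t) : p + t' • (q - p) ∉ F := by
  intro hF'
  have hnonneg := (hT.isInward_inward h.mem_ridges ⟨hF, h.subset⟩).nonneg _ ht _ hF'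
  rw [add_sub_add_left_eq_sub, ← sub_smul, inner_smul_right] at hnonneg
  exact (mul_neg_of_neg_of_pos (sub_neg.2 htt') h.inner_pos).not_ge hnonneg

lemma notMem (h : EntersThrough T p q F R) (hp : p ∉ R) : p ∉ F := by
  obtain ⟨_, hseg, hr⟩ := h.nonempty
  rw [segment_eq_image'] at hseg
  obtain ⟨t, ht, rfl⟩ := hseg
  have ht_pos : 0 < t := ht.1.lt_of_ne fun h0 => hp (by
    simpa only [← h0, zero_smul, add_zero] using hr)
  simpa only [zero_smul, add_zero] using h.notMem_of_lt hT hF hr ht_pos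

lemma eq (h : EntersThrough T p q F R) (h' : EntersThrough T p q F R')
    (hlow : ∀ K ∈ faces T, dim K + 3 ≤ d → Disjoint (segment ℝ p q) K) : R = R' := by
  obtain ⟨_, hseg, hr⟩ := h.nonempty
  obtain ⟨_, hseg', hr'⟩ := h'.nonempty
  have hlow' := fun K hK hdim => disjoint_left.1 (hlow K hK hdim) hseg
  rw [segment_eq_image'] at hseg hseg'
  obtain ⟨t, -, rfl⟩ := hseg
  obtain ⟨t', -, rfl⟩ := hseg'
  obtain rfl : t = t' := by
    rcases lt_trichotomy t t' with hlt | heq | hlt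
    · exact absurd (h.subset hr) (h'.notMem_of_lt hT hF hr' hlt)
    · exact heq
    · exact absurd (h'.subset hr') (h.notMem_of_lt hT hF hr hlt)
  have hRF : F ∈ facetsAround T R := ⟨hF, h.subset⟩
  have hR'F : F ∈ facetsAround T R' := ⟨hF, h'.subset⟩
  exact subset_antisymm
    ((hT.isFace_of_mem_facetsAround h'.mem_ridges hR'F).subset_of_mem_intrinsicInterior h.subset
      (hT.mem_intrinsicInterior_of_mem_ridge h.mem_ridges hRF hr hlow') hr')
    ((hT.isFace_of_mem_facetsAround h.mem_ridges hRF).subset_of_mem_intrinsicInterior h'.subset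
      (hT.mem_intrinsicInterior_of_mem_ridge h'.mem_ridges hR'F hr' hlow') hr)

end EntersThrough

namespace IsTiling

variable (hT : IsTiling T) {F : Set (E d)} {p q : E d} (hF : F ∈ facets T)
  (hpq : q - p ∈ vectorSpan ℝ F)
  (hlow : ∀ K ∈ faces T, dim K + 3 ≤ d → Disjoint (segment ℝ p q) K)
include hT hF hpq hlow

lemma exists_entersThrough (hp : p ∉ F) (hne : (segment ℝ p q ∩ F).Nonempty)
    (htrans : ∀ R ∈ ridges T, R ⊆ F → (segment ℝ p q ∩ R).Nonempty →
      inner ℝ (inward R F) (q - p) ≠ 0) : ∃ R, EntersThrough T p q F R := by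
  have hclosed := (hT.isPolytope_of_mem_faces (mem_faces_of_mem_facets hF)).isCompact.isClosed
  obtain ⟨r, ⟨hrseg, hrF⟩, hfirst⟩ := exists_first_mem_of_segment hclosed hp hne
  have hqp : p - q ∈ vectorSpan ℝ F := by
    rw [← neg_sub]
    exact neg_mem hpq
  obtain ⟨R, hR, hRF, hrel⟩ := (hT.mem_intrinsicInterior_or_exists_ridge hF hrF
    fun K hK hdim => disjoint_left.1 (hlow K hK hdim) hrseg).resolve_left fun h =>
      hfirst ((eventually_add_smul_mem h hqp).filter_mono nhdsWithin_le_nhds)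
  have hR_ne : (segment ℝ p q ∩ R).Nonempty := ⟨r, hrseg, intrinsicInterior_subset hrel⟩
  refine ⟨R, hR, hRF, hR_ne, not_le.1 fun hle => hfirst ?_⟩
  refine hT.eventually_mem_facet hR ⟨hF, hRF⟩ hrel hqp ?_
  rw [← neg_sub, inner_neg_right, neg_pos]
  exact hle.lt_of_ne (htrans R hR hRF hR_ne)

open Classical in
lemma finsum_entersThrough (hp : ∀ R ∈ ridges T, p ∉ R)
    (htrans : ∀ R ∈ ridges T, R ⊆ F → (segment ℝ p q ∩ R).Nonempty →
      inner ℝ (inward R F) (q - p) ≠ 0) :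
    ∑ᶠ R ∈ {R ∈ ridges T | R ⊆ F}, (if EntersThrough T p q F R then (1 : ℝ) else 0) =
      if p ∉ F ∧ (segment ℝ p q ∩ F).Nonempty then 1 else 0 := by
  split_ifs with h
  · obtain ⟨R, hR⟩ := hT.exists_entersThrough hF hpq hlow h.1 h.2 htrans
    rw [finsum_mem_eq_finite_toFinset_sum _ (hT.finite_ridges_subset hF),
      Finset.sum_eq_single_of_mem R, if_pos hR]
    · exact (Finite.mem_toFinset _).2 ⟨hR.mem_ridges, hR.subset⟩
    · exact fun R' _ hne => if_neg fun hR' => hne (hR'.eq hT hF hR hlow)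
  · refine finsum_mem_eq_zero_of_forall_eq_zero fun R _ => if_neg fun hR => h ?_
    exact ⟨hR.notMem hT hF (hp R hR.mem_ridges),
      hR.nonempty.mono (inter_subset_inter_right _ hR.subset)⟩

omit hT hF hpq hlow in
open Classical in
lemma ite_notMem_sub_ite_notMem (F : Set (E d)) (p q : E d) :
    ((if p ∉ F ∧ (segment ℝ p q ∩ F).Nonempty then (1 : ℝ) else 0) -
      if q ∉ F ∧ (segment ℝ p q ∩ F).Nonempty then 1 else 0) =
      F.indicator 1 q - F.indicator 1 p := by
  simp only [indicator_apply, Pi.one_apply]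
  by_cases hp : p ∈ F
  · have hne : (segment ℝ p q ∩ F).Nonempty := ⟨p, left_mem_segment ℝ p q, hp⟩
    by_cases hq : q ∈ F <;> simp [hp, hq, hne]
  · by_cases hq : q ∈ F
    · have hne : (segment ℝ p q ∩ F).Nonempty := ⟨q, right_mem_segment ℝ p q, hq⟩
      simp [hp, hq, hne]
    · simp [hp, hq]

-- A one-dimensional fundamental theorem: counting the entries of the segment minus its exits
-- compares its two ends.
open Classical in
lemma finsum_sign_inward (hp : ∀ R ∈ ridges T, p ∉ R) (hq : ∀ R ∈ ridges T, q ∉ R)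
    (htrans : ∀ R ∈ ridges T, R ⊆ F → (segment ℝ p q ∩ R).Nonempty →
      inner ℝ (inward R F) (q - p) ≠ 0) :
    ∑ᶠ R ∈ {R ∈ ridges T | R ⊆ F},
        (if (segment ℝ p q ∩ R).Nonempty then Real.sign (inner ℝ (inward R F) (q - p)) else 0) =
      F.indicator 1 q - F.indicator 1 p := by
  have hfinite := hT.finite_ridges_subset hF
  have hqp : p - q ∈ vectorSpan ℝ F := by
    rw [← neg_sub]
    exact neg_mem hpq
  have inner_sub_comm (R : Set (E d)) :
      inner ℝ (inward R F) (p - q) = -inner ℝ (inward R F) (q - p) := by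
    rw [← inner_neg_right, neg_sub]
  have entries := hT.finsum_entersThrough hF hpq hlow hp htrans
  have exits := hT.finsum_entersThrough hF hqp (by rwa [segment_symm]) hq fun R hR hRF hne => by
    rw [inner_sub_comm, neg_ne_zero]
    exact htrans R hR hRF (by rwa [segment_symm])
  calc _ = ∑ᶠ R ∈ {R ∈ ridges T | R ⊆ F}, ((if EntersThrough T p q F R then (1 : ℝ) else 0) -
          if EntersThrough T q p F R then 1 else 0) := finsum_mem_congr rfl fun R ⟨hR, hRF⟩ => by
        by_cases hne : (segment ℝ p q ∩ R).Nonempty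
        · have hne' : (segment ℝ q p ∩ R).Nonempty := by rwa [segment_symm]
          rcases (htrans R hR hRF hne).lt_or_gt with h | h
          · rw [if_pos hne, Real.sign_of_neg h, if_neg fun h' => h.not_gt h'.inner_pos,
              if_pos ⟨hR, hRF, hne', by rw [inner_sub_comm]; linarith⟩, zero_sub]
          · rw [if_pos hne, Real.sign_of_pos h, if_pos ⟨hR, hRF, hne, h⟩, if_neg fun h' => by
              linarith [h'.inner_pos, inner_sub_comm R], sub_zero]
        · rw [if_neg hne, if_neg fun h => hne h.nonempty, if_neg fun h => hne (by
            rw [segment_symm]; exact h.nonempty), sub_zero]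
    _ = (if p ∉ F ∧ (segment ℝ p q ∩ F).Nonempty then 1 else 0) -
          if q ∉ F ∧ (segment ℝ p q ∩ F).Nonempty then 1 else 0 := by
        rw [finsum_mem_sub_distrib _ _ hfinite, entries, exits, segment_symm ℝ q p]
    _ = F.indicator 1 q - F.indicator 1 p := ite_notMem_sub_ite_notMem F p q

end IsTiling

open Classical in
/-- The signed number of crossings of the segment from `a` to `b` with the facet `F` with normal
`ν`. -/
noncomputable def crossing (F : Set (E d)) (ν a b : E d) : ℝ :=
  if (segment ℝ a b ∩ F).Nonempty then Real.sign (inner ℝ ν (b - a)) else 0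

lemma crossing_comm (F : Set (E d)) (ν a b : E d) : crossing F ν a b = -crossing F ν b a := by
  rw [crossing, crossing, segment_symm, ← neg_sub a b, inner_neg_right, Real.sign_neg, neg_ite,
    neg_zero]

lemma crossing_neg (F : Set (E d)) (ν a b : E d) : crossing F (-ν) a b = -crossing F ν a b := by
  rw [crossing, crossing, inner_neg_left, Real.sign_neg, neg_ite, neg_zero]

lemma crossing_eq_zero {F A : Set (E d)} (hA : Disjoint A F) {a b : E d} (hab : segment ℝ a b ⊆ A)
    (ν : E d) : crossing F ν a b = 0 :=
  if_neg (not_nonempty_iff_eq_empty.2 (hA.mono_left hab).inter_eq)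

lemma crossing_eq_indicator {F : Set (E d)} {ν f a b p : E d} (hν : IsFacetNormal F ν) (hf : f ∈ F)
    (hp : p ∈ segment ℝ a b) (hpf : inner ℝ ν p = inner ℝ ν f) (hab : 0 < inner ℝ ν (b - a)) :
    crossing F ν a b = F.indicator 1 p := by
  have hiff : (segment ℝ a b ∩ F).Nonempty ↔ p ∈ F := by
    refine ⟨fun ⟨r, hr, hrF⟩ => ?_, fun hpF => ⟨p, hp, hpF⟩⟩
    rw [segment_eq_image'] at hp hr
    obtain ⟨t, -, rfl⟩ := hp
    obtain ⟨t', -, rfl⟩ := hr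
    rw [← hν.inner_eq hrF hf, inner_add_right, inner_add_right, inner_smul_right, inner_smul_right,
      add_right_inj] at hpf
    rwa [mul_right_cancel₀ hab.ne' hpf]
  classical
  rw [crossing, Real.sign_of_pos hab, if_congr hiff rfl rfl, indicator_apply, Pi.one_apply]

open Classical in
/-- The signed number of crossings of the triangle with vertices `x`, `y` and `z` with the
ridge `R`. -/
noncomputable def ridgeCrossing (R : Set (E d)) (x y z : E d) : ℝ :=
  if (convexHull ℝ {x, y, z} ∩ R).Nonempty then Real.sign (inner ℝ (ridgeTurn R (y - x)) (z - x))
  else 0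

lemma insert_pair_rotate {α : Type*} (x y z : α) : ({y, z, x} : Set α) = {x, y, z} := by
  rw [pair_comm z x, insert_comm]

lemma ridgeCrossing_rotate {R : Set (E d)} (hR : R ∈ ridges T) (x y z : E d) :
    ridgeCrossing R y z x = ridgeCrossing R x y z := by
  rw [ridgeCrossing, ridgeCrossing, (isQuarterTurn_ridgeTurn hR).inner_map_sub_rotate,
    insert_pair_rotate]

/-- General position of a triangle with respect to the tiling. -/
structure IsGenericTriangle (T : Set (Set (E d))) (x y z : E d) : Prop where
  notMem_affineSpan : ∀ F ∈ facets T,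
    x ∉ affineSpan ℝ F ∧ y ∉ affineSpan ℝ F ∧ z ∉ affineSpan ℝ F
  isGenericSegment : IsGenericSegment T x y ∧ IsGenericSegment T y z ∧ IsGenericSegment T z x
  disjoint : ∀ K ∈ faces T, dim K + 3 ≤ d → Disjoint (convexHull ℝ {x, y, z}) K
  inner_ridgeTurn_ne_zero : ∀ R ∈ ridges T, inner ℝ (ridgeTurn R (y - x)) (z - x) ≠ 0

lemma IsGenericTriangle.rotate {x y z : E d} (h : IsGenericTriangle T x y z) :
    IsGenericTriangle T y z x where
  notMem_affineSpan F hF :=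
    let ⟨hx, hy, hz⟩ := h.notMem_affineSpan F hF
    ⟨hy, hz, hx⟩
  isGenericSegment :=
    let ⟨hxy, hyz, hzx⟩ := h.isGenericSegment
    ⟨hyz, hzx, hxy⟩
  disjoint := by
    rw [insert_pair_rotate]
    exact h.disjoint
  inner_ridgeTurn_ne_zero R hR := by
    rw [(isQuarterTurn_ridgeTurn hR).inner_map_sub_rotate]
    exact h.inner_ridgeTurn_ne_zero R hR

lemma IsFacetNormal.mem_affineSpan {F : Set (E d)} {ν f x : E d} (hν : IsFacetNormal F ν)
    (hdim : dim F + 1 = d) (hf : f ∈ F) (h : inner ℝ ν x = inner ℝ ν f) : x ∈ affineSpan ℝ F := by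
  have hxf : x - f ∈ vectorSpan ℝ F :=
    hν.mem_vectorSpan hdim (by rw [inner_sub_right, h, sub_self])
  simpa only [vadd_eq_add, sub_add_cancel] using
    vadd_mem_affineSpan_of_mem_affineSpan_of_mem_vectorSpan (subset_affineSpan ℝ F hf) hxf

section HyperplaneSection

variable {V : Type*} [NormedAddCommGroup V] [InnerProductSpace ℝ V] {ν x y z : V} {c : ℝ}

lemma exists_inner_add_smul_eq (hx : inner ℝ ν x < c) (hy : c < inner ℝ ν y) :
    ∃ τ ∈ Ioc (0 : ℝ) 1, inner ℝ ν (x + τ • (y - x)) = c := by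
  have hxy : 0 < inner ℝ ν (y - x) := by
    rw [inner_sub_right]
    linarith
  refine ⟨(c - inner ℝ ν x) / inner ℝ ν (y - x), ⟨div_pos (sub_pos.2 hx) hxy, ?_⟩, ?_⟩
  · rw [div_le_one hxy, inner_sub_right]
    linarith
  · rw [inner_add_right, inner_smul_right, div_mul_cancel₀ _ hxy.ne', add_sub_cancel]

lemma disjoint_convexHull_of_lt_inner {s F : Set V} (hs : ∀ v ∈ s, c < inner ℝ ν v)
    (hF : ∀ v ∈ F, inner ℝ ν v = c) : Disjoint (convexHull ℝ s) F := by
  refine disjoint_left.2 fun r hr hrF => ?_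
  have hconvex : Convex ℝ {v | c < inner ℝ ν v} :=
    convex_halfSpace_gt (innerₛₗ ℝ ν).isLinear c
  have hlt : c < inner ℝ ν r := convexHull_min hs hconvex hr
  exact hlt.ne' (hF r hrF)

lemma mem_segment_of_mem_convexHull_of_inner_eq {r : V} {τ τ' : ℝ} (hx : inner ℝ ν x < c)
    (hτ : 0 < τ) (hy : inner ℝ ν (x + τ • (y - x)) = c)
    (hτ' : 0 < τ') (hz : inner ℝ ν (x + τ' • (z - x)) = c)
    (hr : r ∈ convexHull ℝ {x, y, z}) (hrc : inner ℝ ν r = c) :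
    r ∈ segment ℝ (x + τ • (y - x)) (x + τ' • (z - x)) := by
  simp only [convexHull_insert (insert_nonempty y {z}), convexHull_pair, convexJoin_singleton_left,
    mem_iUnion, exists_prop] at hr
  obtain ⟨_, ⟨b, b', hb, hb', hbb', rfl⟩, a, a', -, ha', haa', rfl⟩ := hr
  obtain rfl := eq_sub_of_add_eq haa'
  obtain rfl := eq_sub_of_add_eq hbb'
  rw [inner_add_right, inner_smul_right] at hy hz
  have weights : (a' * (1 - b') / τ + a' * b' / τ') * (c - inner ℝ ν x) = c - inner ℝ ν x := by
    have hτy : (c - inner ℝ ν x) / τ = inner ℝ ν (y - x) := by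
      rw [← hy, add_sub_cancel_left, mul_div_cancel_left₀ _ hτ.ne']
    have hτz : (c - inner ℝ ν x) / τ' = inner ℝ ν (z - x) := by
      rw [← hz, add_sub_cancel_left, mul_div_cancel_left₀ _ hτ'.ne']
    calc _ = a' * (1 - b') * ((c - inner ℝ ν x) / τ) + a' * b' * ((c - inner ℝ ν x) / τ') := by
          ring
      _ = c - inner ℝ ν x := by
          rw [hτy, hτz, ← hrc]
          simp only [inner_add_right, inner_smul_right, inner_sub_right]
          ring
  have weights_sum := mul_right_cancel₀ (sub_pos.2 hx).ne' (weights.trans (one_mul _).symm)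
  refine ⟨_, _, div_nonneg (mul_nonneg ha' hb) hτ.le, div_nonneg (mul_nonneg ha' hb') hτ'.le,
    weights_sum, ?_⟩
  calc _ = (a' * (1 - b') / τ + a' * b' / τ') • x + (a' * (1 - b') / τ * τ) • (y - x) +
        (a' * b' / τ' * τ') • (z - x) := by module
    _ = _ := by
      rw [weights_sum, div_mul_cancel₀ _ hτ.ne', div_mul_cancel₀ _ hτ'.ne']
      module

end HyperplaneSection

lemma sign_mul_of_pos {k : ℝ} (hk : 0 < k) (a : ℝ) : Real.sign (k * a) = Real.sign a := by
  rcases lt_trichotomy a 0 with ha | rfl | ha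
  · rw [Real.sign_of_neg ha, Real.sign_of_neg (mul_neg_of_pos_of_neg hk ha)]
  · rw [mul_zero]
  · rw [Real.sign_of_pos ha, Real.sign_of_pos (mul_pos hk ha)]

/-- The discrete Stokes formula for the facet `F` with normal `ν`: the signed number of crossings
of the boundary of a triangle with `F` is the sum of the signed numbers of crossings of the
triangle with the ridges of `F`, each weighted by the orientation `±1` which the quarter turn
around the ridge gives to `F`. -/
def FacetStokes (T : Set (Set (E d))) (F : Set (E d)) (ν x y z : E d) : Prop :=
  crossing F ν x y + crossing F ν y z + crossing F ν z x =
    ∑ᶠ R ∈ {R ∈ ridges T | R ⊆ F}, ridgeCrossing R x y z * inner ℝ ν (ridgeTurn R (inward R F))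

namespace FacetStokes

variable {F : Set (E d)} {ν x y z : E d}

lemma neg (h : FacetStokes T F ν x y z) : FacetStokes T F (-ν) x y z := by
  simp only [FacetStokes, crossing_neg, inner_neg_left, mul_neg, finsum_neg_distrib]
  rw [← h, neg_add, neg_add]

lemma rotate (h : FacetStokes T F ν x y z) : FacetStokes T F ν y z x := by
  rw [FacetStokes, ← add_rotate, h]
  exact finsum_mem_congr rfl fun R hR => by rw [ridgeCrossing_rotate hR.1 x y z]

lemma of_disjoint (hdisj : Disjoint (convexHull ℝ {x, y, z}) F) : FacetStokes T F ν x y z := by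
  have segment_subset {a b : E d} (ha : a ∈ ({x, y, z} : Set (E d)))
      (hb : b ∈ ({x, y, z} : Set (E d))) : segment ℝ a b ⊆ convexHull ℝ {x, y, z} :=
    segment_subset_convexHull ha hb
  rw [FacetStokes, crossing_eq_zero hdisj (segment_subset (by simp) (by simp)),
    crossing_eq_zero hdisj (segment_subset (by simp) (by simp)),
    crossing_eq_zero hdisj (segment_subset (by simp) (by simp)), add_zero, add_zero]
  refine (finsum_mem_eq_zero_of_forall_eq_zero fun R hR => ?_).symm
  rw [ridgeCrossing, if_neg, zero_mul]
  exact not_nonempty_iff_eq_empty.2 (hdisj.mono_right hR.2).inter_eq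

end FacetStokes

namespace IsTiling

variable (hT : IsTiling T) {R F : Set (E d)} (hF : F ∈ facets T) {ν x y z : E d}
  (hν : IsFacetNormal F ν)
include hT hF hν

section

variable {τ τ' : ℝ}
  (hpq : x + τ' • (z - x) - (x + τ • (y - x)) ∈ vectorSpan ℝ F)
include hpq

lemma mul_inner_ridgeTurn (hR : R ∈ ridges T) (hRF : R ⊆ F) :
    τ' * inner ℝ (ridgeTurn R (y - x)) (z - x) =
      -(inner ℝ (inward R F) (x + τ' • (z - x) - (x + τ • (y - x))) *
        (inner ℝ ν (ridgeTurn R (inward R F)) * inner ℝ ν (y - x))) := by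
  have hK := isQuarterTurn_ridgeTurn hR
  have hu := hT.isInward_inward hR ⟨hF, hRF⟩
  set e := x + τ' • (z - x) - (x + τ • (y - x))
  have turn_e : inner ℝ (ridgeTurn R e) (y - x) =
      -(τ' * inner ℝ (ridgeTurn R (y - x)) (z - x)) := by
    have he : e = τ' • (z - x) - τ • (y - x) := by
      simp only [e]
      abel
    rw [he, map_sub, map_smul, map_smul, inner_sub_left, real_inner_smul_left,
      real_inner_smul_left, hK.inner_map_self, hK.inner_map_comm (z - x)]
    ring
  have turn_inward := hν.eq_smul (dim_add_one_of_mem_facets hF)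
    (hK.isFacetNormal hR ⟨hF, hRF⟩ hu).2
  rw [hK.map_eq_smul hR ⟨hF, hRF⟩ hu hpq, real_inner_smul_left, turn_inward,
    real_inner_smul_left] at turn_e
  rw [← neg_eq_iff_eq_neg, ← turn_e]

lemma sign_inner_ridgeTurn_mul (hτ' : 0 < τ') (hy : 0 < inner ℝ ν (y - x)) (hR : R ∈ ridges T)
    (hRF : R ⊆ F) :
    Real.sign (inner ℝ (ridgeTurn R (y - x)) (z - x)) * inner ℝ ν (ridgeTurn R (inward R F)) =
      -Real.sign (inner ℝ (inward R F) (x + τ' • (z - x) - (x + τ • (y - x)))) := by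
  have hK := isQuarterTurn_ridgeTurn hR
  have hu := hT.isInward_inward hR ⟨hF, hRF⟩
  have key := hT.mul_inner_ridgeTurn hF hν hpq hR hRF
  rw [← sign_mul_of_pos hτ', key]
  rcases hν.eq_or_eq_neg (dim_add_one_of_mem_facets hF) (hK.isFacetNormal hR ⟨hF, hRF⟩ hu)
    with h | h
  · rw [h, hν.inner_self, one_mul, mul_one, Real.sign_neg, mul_comm, sign_mul_of_pos hy]
  · rw [h, inner_neg_right, hν.inner_self, neg_one_mul, mul_neg_one, mul_neg, neg_neg, mul_comm,
      sign_mul_of_pos hy]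

end

open Classical in
lemma facetStokes_of_inner_lt (hg : IsGenericTriangle T x y z) {f : E d} (hf : f ∈ F)
    (hx : inner ℝ ν x < inner ℝ ν f) (hy : inner ℝ ν f < inner ℝ ν y)
    (hz : inner ℝ ν f < inner ℝ ν z) : FacetStokes T F ν x y z := by
  have hyx : 0 < inner ℝ ν (y - x) := by rw [inner_sub_right]; linarith
  have hzx : 0 < inner ℝ ν (z - x) := by rw [inner_sub_right]; linarith
  obtain ⟨τ, hτ, hp⟩ := exists_inner_add_smul_eq hx hy
  obtain ⟨τ', hτ', hq⟩ := exists_inner_add_smul_eq hx hz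
  have hpq : x + τ' • (z - x) - (x + τ • (y - x)) ∈ vectorSpan ℝ F :=
    hν.mem_vectorSpan (dim_add_one_of_mem_facets hF) (by rw [inner_sub_right, hp, hq, sub_self])
  have hp_mem := (convex_segment x y).add_smul_sub_mem (left_mem_segment ℝ x y)
    (right_mem_segment ℝ x y) (Ioc_subset_Icc_self hτ)
  have hq_mem := (convex_segment x z).add_smul_sub_mem (left_mem_segment ℝ x z)
    (right_mem_segment ℝ x z) (Ioc_subset_Icc_self hτ')
  have hsub : segment ℝ (x + τ • (y - x)) (x + τ' • (z - x)) ⊆ convexHull ℝ {x, y, z} :=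
    (convex_convexHull ℝ _).segment_subset
      (segment_subset_convexHull (by simp) (by simp) hp_mem)
      (segment_subset_convexHull (by simp) (by simp) hq_mem)
  have hmeet {R : Set (E d)} (hRF : R ⊆ F) : (convexHull ℝ {x, y, z} ∩ R).Nonempty ↔
      (segment ℝ (x + τ • (y - x)) (x + τ' • (z - x)) ∩ R).Nonempty :=
    ⟨fun ⟨r, hr, hrR⟩ => ⟨r, mem_segment_of_mem_convexHull_of_inner_eq hx hτ.1 hp hτ'.1 hq hr
      (hν.inner_eq (hRF hrR) hf), hrR⟩, fun h => h.mono (inter_subset_inter_left _ hsub)⟩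
  have hsum := hT.finsum_sign_inward hF hpq
    (fun K hK hdim => (hg.disjoint K hK hdim).mono_left hsub)
    (fun R hR => disjoint_left.1 (hg.isGenericSegment.1 R (mem_faces_of_mem_ridges hR)
      (dim_add_two_of_mem_ridges hR).le) hp_mem)
    (fun R hR => disjoint_left.1 (hg.isGenericSegment.2.2.symm R (mem_faces_of_mem_ridges hR)
      (dim_add_two_of_mem_ridges hR).le) hq_mem)
    (fun R hR hRF _ h0 => hg.inner_ridgeTurn_ne_zero R hR (by
      have key := hT.mul_inner_ridgeTurn hF hν hpq hR hRF
      rw [h0, zero_mul, neg_zero] at key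
      exact (mul_eq_zero.1 key).resolve_left hτ'.1.ne'))
  have hyz : crossing F ν y z = 0 :=
    crossing_eq_zero (disjoint_convexHull_of_lt_inner (s := {y, z}) (by simp [hy, hz])
      fun v hv => hν.inner_eq hv hf) (convexHull_pair y z).ge ν
  rw [FacetStokes, crossing_comm F ν z x, hyz, crossing_eq_indicator hν hf hp_mem hp hyx,
    crossing_eq_indicator hν hf hq_mem hq hzx, add_zero, ← sub_eq_add_neg, ← neg_sub, ← hsum,
    ← finsum_mem_neg_distrib _ (hT.finite_ridges_subset hF)]
  refine finsum_mem_congr rfl fun R hR => ?_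
  rw [ridgeCrossing, if_congr (hmeet hR.2) rfl rfl, ite_mul, zero_mul,
    hT.sign_inner_ridgeTurn_mul hF hν hpq hτ'.1 hyx hR.1 hR.2, neg_ite, neg_zero]

theorem facet_stokes (hg : IsGenericTriangle T x y z) : FacetStokes T F ν x y z := by
  obtain ⟨f, hf⟩ := nonempty_of_mem_faces (mem_faces_of_mem_facets hF)
  have hne {v : E d} (hv : v ∉ affineSpan ℝ F) : inner ℝ ν v ≠ inner ℝ ν f :=
    fun h => hv (hν.mem_affineSpan (dim_add_one_of_mem_facets hF) hf h)
  have below {ν x y z : E d} (hν : IsFacetNormal F ν) (hx : inner ℝ ν f < inner ℝ ν x)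
      (hy : inner ℝ ν f < inner ℝ ν y) (hz : inner ℝ ν f < inner ℝ ν z) : FacetStokes T F ν x y z :=
    .of_disjoint <| disjoint_convexHull_of_lt_inner (by simp [hx, hy, hz])
      fun v hv => hν.inner_eq hv hf
  obtain ⟨hx, hy, hz⟩ := hg.notMem_affineSpan F hF
  have hneg {v w : E d} : inner ℝ (-ν) v < inner ℝ (-ν) w ↔ inner ℝ ν w < inner ℝ ν v := by
    rw [inner_neg_left, inner_neg_left, neg_lt_neg_iff]
  have alone_above {x y z : E d} (hg : IsGenericTriangle T x y z)
      (hx : inner ℝ ν f < inner ℝ ν x) (hy : inner ℝ ν y < inner ℝ ν f)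
      (hz : inner ℝ ν z < inner ℝ ν f) : FacetStokes T F ν x y z := by
    simpa only [neg_neg] using
      (hT.facetStokes_of_inner_lt hF hν.neg hg hf (hneg.2 hx) (hneg.2 hy) (hneg.2 hz)).neg
  rcases (hne hx).lt_or_gt with hx | hx <;> rcases (hne hy).lt_or_gt with hy | hy <;>
    rcases (hne hz).lt_or_gt with hz | hz
  · simpa only [neg_neg] using (below hν.neg (hneg.2 hx) (hneg.2 hy) (hneg.2 hz)).neg
  · exact (alone_above hg.rotate.rotate hz hx hy).rotate
  · exact (alone_above hg.rotate hy hz hx).rotate.rotate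
  · exact hT.facetStokes_of_inner_lt hF hν hg hf hx hy hz
  · exact alone_above hg hx hy hz
  · exact (hT.facetStokes_of_inner_lt hF hν hg.rotate hf hy hz hx).rotate.rotate
  · exact (hT.facetStokes_of_inner_lt hF hν hg.rotate.rotate hf hz hx hy).rotate
  · exact below hν hx hy hz

end IsTiling

/-! ### Integrating a scaling along segments -/

/-- A chosen unit normal of the facet `F`; it orients `F`. -/
noncomputable def facetNormal (F : Set (E d)) : E d := Classical.epsilon (IsFacetNormal F)

lemma isFacetNormal_facetNormal {F : Set (E d)} (hF : F ∈ facets T) :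
    IsFacetNormal F (facetNormal F) :=
  Classical.epsilon_spec (exists_isFacetNormal (dim_add_one_of_mem_facets hF))

/-- The affine function `x ↦ ⟪n, x - y⟫`, encoded as the pair of its gradient and its constant
term, which is linear in `n`. -/
noncomputable def affinePair (y : E d) : E d →ₗ[ℝ] E d × ℝ := LinearMap.id.prod (-innerₗ (E d) y)

lemma affinePair_apply (y n : E d) : affinePair y n = (n, -inner ℝ y n) := rfl

lemma IsFacetNormal.affinePair_eq {F : Set (E d)} {ν x y : E d} (hν : IsFacetNormal F ν)
    (hx : x ∈ F) (hy : y ∈ F) : affinePair x ν = affinePair y ν := by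
  rw [affinePair_apply, affinePair_apply, real_inner_comm, hν.inner_eq hx hy, real_inner_comm]

/-- The affine function with gradient `facetNormal F` that vanishes on the facet `F`, computed at
a chosen point of `F`. -/
noncomputable def facetAffine (F : Set (E d)) : E d × ℝ :=
  affinePair (Classical.epsilon (· ∈ F)) (facetNormal F)

lemma facetAffine_eq {F : Set (E d)} (hF : F ∈ facets T) {x : E d} (hx : x ∈ F) :
    facetAffine F = affinePair x (facetNormal F) :=
  (isFacetNormal_facetNormal hF).affinePair_eq
    (Classical.epsilon_spec (p := (· ∈ F)) ⟨x, hx⟩) hx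

/-- The sum of the increments of the scaling `s` along the segment from `a` to `b`. -/
noncomputable def segSum (T : Set (Set (E d))) (s : Set (E d) → ℝ) (a b : E d) : E d × ℝ :=
  ∑ᶠ F ∈ facets T, (crossing F (facetNormal F) a b * s F) • facetAffine F

lemma segSum_comm (s : Set (E d) → ℝ) (a b : E d) : segSum T s a b = -segSum T s b a := by
  simp_rw [segSum, ← finsum_neg_distrib]
  refine finsum_mem_congr rfl fun F _ => ?_
  rw [crossing_comm, neg_mul, neg_smul]

lemma segSum_eq_sum (s : Set (E d) → ℝ) {A : Set (E d)} {S : Finset (Set (E d))}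
    (hS : ∀ F, F ∈ S ↔ F ∈ facets T ∧ (F ∩ A).Nonempty) {a b : E d} (hab : segment ℝ a b ⊆ A) :
    segSum T s a b = ∑ F ∈ S, (crossing F (facetNormal F) a b * s F) • facetAffine F := by
  rw [segSum, finsum_mem_eq_sum_of_inter_support_eq]
  ext F
  refine and_congr_left fun h => ⟨fun hF => (hS F).2 ⟨hF, ?_⟩, fun h => ((hS F).1 h).1⟩
  by_contra hdisj
  rw [inter_comm, ← not_disjoint_iff_nonempty_inter, not_not] at hdisj
  rw [Function.mem_support, crossing_eq_zero hdisj hab, zero_mul, zero_smul] at h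
  exact h rfl

namespace IsTiling

variable (hT : IsTiling T) {s : Set (E d) → ℝ}
include hT

lemma finsum_facetsAround_smul_facetAffine (hs : ZeroTorsion T s) {R : Set (E d)}
    (hR : R ∈ ridges T) :
    ∑ᶠ F ∈ facetsAround T R,
      s F • inner ℝ (facetNormal F) (ridgeTurn R (inward R F)) • facetAffine F = 0 := by
  obtain ⟨r, hr⟩ := nonempty_of_mem_ridges hR
  have hK := isQuarterTurn_ridgeTurn hR
  calc _ = ∑ᶠ F ∈ facetsAround T R, affinePair r (s F • ridgeTurn R (inward R F)) := by
        refine finsum_mem_congr rfl fun F hF => ?_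
        rw [facetAffine_eq hF.1 (hF.2 hr), ← map_smul, ← map_smul,
          ← (isFacetNormal_facetNormal hF.1).eq_smul (dim_add_one_of_mem_facets hF.1)
            (hK.isFacetNormal hR hF (hT.isInward_inward hR hF)).2]
    _ = affinePair r (∑ᶠ F ∈ facetsAround T R, s F • ridgeTurn R (inward R F)) :=
        ((affinePair r).toAddMonoidHom.map_finsum_mem _ (hT.finite_facetsAround hR)).symm
    _ = 0 := by rw [hT.zeroTorsion_iff.1 hs R hR _ hK, map_zero]

lemma crossings_smul_facetAffine (s : Set (E d) → ℝ) {x y z : E d} (hg : IsGenericTriangle T x y z)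
    {S : Finset (Set (E d))}
    (hS : ∀ R, R ∈ S ↔ R ∈ ridges T ∧ (R ∩ convexHull ℝ {x, y, z}).Nonempty) {F : Set (E d)}
    (hF : F ∈ facets T) [DecidablePred fun R => R ⊆ F] :
    (crossing F (facetNormal F) x y * s F) • facetAffine F +
        (crossing F (facetNormal F) y z * s F) • facetAffine F +
        (crossing F (facetNormal F) z x * s F) • facetAffine F =
      ∑ R ∈ S with R ⊆ F, ridgeCrossing R x y z •
        s F • inner ℝ (facetNormal F) (ridgeTurn R (inward R F)) • facetAffine F := by
  have hstokes := hT.facet_stokes hF (isFacetNormal_facetNormal hF) hg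
  rw [FacetStokes, finsum_mem_eq_sum_of_inter_support_eq (t := S.filter (· ⊆ F))] at hstokes
  · rw [← add_smul, ← add_smul, ← add_mul, ← add_mul, hstokes, Finset.sum_mul, Finset.sum_smul]
    refine Finset.sum_congr rfl fun R _ => ?_
    rw [smul_smul, smul_smul, mul_right_comm, mul_assoc]
  · ext R
    rw [Finset.coe_filter]
    refine and_congr_left fun h => ?_
    have hmeet : (R ∩ convexHull ℝ {x, y, z}).Nonempty := by
      by_contra hempty
      rw [Function.mem_support, ridgeCrossing, if_neg (by rwa [inter_comm]), zero_mul] at h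
      exact h rfl
    exact ⟨fun hR => ⟨(hS R).2 ⟨hR.1, hmeet⟩, hR.2⟩, fun hR => ⟨((hS R).1 hR.1).1, hR.2⟩⟩

theorem segSum_triangle (hs : ZeroTorsion T s) {x y z : E d} (hg : IsGenericTriangle T x y z) :
    segSum T s x y + segSum T s y z + segSum T s z x = 0 := by
  classical
  have hfin := hT.finite_faces_inter_nonempty ((toFinite {x, y, z}).isCompact_convexHull ℝ)
  obtain ⟨SF, hSF⟩ := (hfin.subset fun F (hF : F ∈ facets T ∧ _) =>
    ⟨mem_faces_of_mem_facets hF.1, hF.2⟩).exists_finset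
  obtain ⟨SR, hSR⟩ := (hfin.subset fun R (hR : R ∈ ridges T ∧ _) =>
    ⟨mem_faces_of_mem_ridges hR.1, hR.2⟩).exists_finset
  have hsegment {a b : E d} (ha : a ∈ ({x, y, z} : Set (E d)))
      (hb : b ∈ ({x, y, z} : Set (E d))) : segment ℝ a b ⊆ convexHull ℝ {x, y, z} :=
    segment_subset_convexHull ha hb
  rw [segSum_eq_sum s hSF (hsegment (a := x) (b := y) (by simp) (by simp)),
    segSum_eq_sum s hSF (hsegment (a := y) (b := z) (by simp) (by simp)),
    segSum_eq_sum s hSF (hsegment (a := z) (b := x) (by simp) (by simp)),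
    ← Finset.sum_add_distrib, ← Finset.sum_add_distrib,
    Finset.sum_congr rfl fun F hF => hT.crossings_smul_facetAffine s hg hSR ((hSF F).1 hF).1]
  simp_rw [Finset.sum_filter]
  rw [Finset.sum_comm]
  refine Finset.sum_eq_zero fun R hR => ?_
  obtain ⟨hR, r, hr, hr_hull⟩ := (hSR R).1 hR
  have hsum := hT.finsum_facetsAround_smul_facetAffine hs hR
  have facetsAround_eq : facetsAround T R = (SF.filter (R ⊆ ·) : Finset (Set (E d))) := by
    ext F
    rw [Finset.coe_filter]
    exact ⟨fun h => ⟨(hSF F).2 ⟨h.1, r, h.2 hr, hr_hull⟩, h.2⟩, fun h => ⟨((hSF F).1 h.1).1, h.2⟩⟩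
  rw [facetsAround_eq, finsum_mem_coe_finset] at hsum
  rw [← Finset.sum_filter, ← Finset.smul_sum, hsum, smul_zero]

end IsTiling

/-! ### Points, pairs and triangles in general position -/

/-- `x` lies in no affine hull of a proper face of a cell. -/
def IsGenericPoint (T : Set (Set (E d))) (x : E d) : Prop :=
  ∀ K ∈ faces T, dim K < d → x ∉ affineSpan ℝ K

/-- `x` and `y` are generic points whose segment is generic and parallel to no ridge, so that a
third vertex can be found that completes them to a generic triangle. -/
structure IsGenericPair (T : Set (Set (E d))) (x y : E d) : Prop where
  left : IsGenericPoint T x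
  right : IsGenericPoint T y
  isGenericSegment : IsGenericSegment T x y
  notMem_vectorSpan : ∀ R ∈ ridges T, y - x ∉ vectorSpan ℝ R

/-- The affine hulls of the proper faces of the cells. -/
def pointObstructions (T : Set (Set (E d))) : Set (AffineSubspace ℝ (E d)) :=
  affineSpan ℝ '' {K | K ∈ faces T ∧ dim K < d}

/-- Affine subspaces such that `x` and every generic point outside them form a generic pair. -/
def pairObstructions (T : Set (Set (E d))) (x : E d) : Set (AffineSubspace ℝ (E d)) :=
  pointObstructions T ∪
    (fun K => affineSpan ℝ (insert x K)) '' {K | K ∈ faces T ∧ dim K + 2 ≤ d} ∪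
    (fun R => AffineSubspace.mk' x (vectorSpan ℝ R)) '' ridges T

/-- Affine subspaces such that every point outside them completes the generic pair `x`, `y` to a
generic triangle. -/
def triangleObstructions (T : Set (Set (E d))) (x y : E d) : Set (AffineSubspace ℝ (E d)) :=
  pairObstructions T x ∪ pairObstructions T y ∪
    (fun K => affineSpan ℝ (insert x (insert y K))) '' {K | K ∈ faces T ∧ dim K + 3 ≤ d} ∪
    (fun R => AffineSubspace.mk' x (vectorSpan ℝ R ⊔ ℝ ∙ (y - x))) '' ridges T

lemma mk'_ne_top_of_finrank_lt {x : E d} {W : Submodule ℝ (E d)} (h : Module.finrank ℝ W < d) :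
    AffineSubspace.mk' x W ≠ ⊤ := by
  intro htop
  have hW := AffineSubspace.direction_mk' x W
  rw [htop, AffineSubspace.direction_top] at hW
  rw [← hW, finrank_top, finrank_euclideanSpace_fin] at h
  exact h.false

lemma ne_top_of_mem_pointObstructions {A : AffineSubspace ℝ (E d)} (hA : A ∈ pointObstructions T) :
    A ≠ ⊤ := by
  obtain ⟨K, hK, rfl⟩ := hA
  exact affineSpan_ne_top_of_dim_lt hK.2

lemma ne_top_of_mem_pairObstructions {x : E d} {A : AffineSubspace ℝ (E d)}
    (hA : A ∈ pairObstructions T x) : A ≠ ⊤ := by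
  rcases hA with (hA | ⟨K, hK, rfl⟩) | ⟨R, hR, rfl⟩
  · exact ne_top_of_mem_pointObstructions hA
  · exact affineSpan_ne_top_of_dim_lt (by linarith [dim_insert_le x K, hK.2])
  · have hdim : Module.finrank ℝ (vectorSpan ℝ R) + 2 = d := dim_add_two_of_mem_ridges hR
    exact mk'_ne_top_of_finrank_lt (by omega)

lemma ne_top_of_mem_triangleObstructions {x y : E d} {A : AffineSubspace ℝ (E d)}
    (hA : A ∈ triangleObstructions T x y) : A ≠ ⊤ := by
  rcases hA with ((hA | hA) | ⟨K, hK, rfl⟩) | ⟨R, hR, rfl⟩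
  · exact ne_top_of_mem_pairObstructions hA
  · exact ne_top_of_mem_pairObstructions hA
  · exact affineSpan_ne_top_of_dim_lt
      (by linarith [dim_insert_le y K, dim_insert_le x (insert y K), hK.2])
  · have hdim : Module.finrank ℝ (vectorSpan ℝ R) + 2 = d := dim_add_two_of_mem_ridges hR
    have hsup := Submodule.finrank_add_le_finrank_add_finrank (vectorSpan ℝ R) (ℝ ∙ (y - x))
    have hline : Module.finrank ℝ (ℝ ∙ (y - x)) ≤ 1 := by
      simpa using finrank_span_le_card (R := ℝ) {y - x}
    exact mk'_ne_top_of_finrank_lt (by omega)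

lemma IsGenericPoint.isGenericPair {x y : E d} (hx : IsGenericPoint T x)
    (hy : ∀ A ∈ pairObstructions T x, y ∉ A) : IsGenericPair T x y where
  left := hx
  right K hK hdim := hy _ (Or.inl (Or.inl ⟨K, ⟨hK, hdim⟩, rfl⟩))
  isGenericSegment K hK hdim := disjoint_left.2 fun _ hp hpK =>
    hy _ (Or.inl (Or.inr ⟨K, ⟨hK, hdim⟩, rfl⟩)) (mem_affineSpan_insert_of_mem_segment
      (fun hxK => hx K hK (by omega) (subset_affineSpan ℝ K hxK)) hp hpK)
  notMem_vectorSpan R hR h := hy _ (Or.inr ⟨R, hR, rfl⟩) (AffineSubspace.mem_mk'.2 h)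

lemma disjoint_convexHull_of_notMem_affineSpan {V : Type*} [AddCommGroup V] [Module ℝ V]
    {K : Set V} {x y z : V} (hxy : Disjoint (segment ℝ x y) K)
    (hz : z ∉ affineSpan ℝ (insert x (insert y K))) : Disjoint (convexHull ℝ {x, y, z}) K := by
  rw [disjoint_left]
  intro p hp hpK
  rw [← insert_pair_rotate, ← insert_pair_rotate, convexHull_insert (insert_nonempty _ _),
    convexHull_pair, convexJoin_singleton_left, mem_iUnion₂] at hp
  obtain ⟨m, hm, hp⟩ := hp
  refine hz (affineSpan_le.2 (insert_subset ?_ ?_)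
    (mem_affineSpan_insert_of_mem_segment (disjoint_left.1 hxy hm) (segment_symm ℝ z m ▸ hp) hpK))
  · have hxy_subset : ({x, y} : Set V) ⊆ insert x (insert y K) :=
      insert_subset_insert (singleton_subset_iff.2 (mem_insert y K))
    rw [← convexHull_pair] at hm
    exact affineSpan_mono ℝ hxy_subset (convexHull_subset_affineSpan _ hm)
  · exact ((subset_insert y K).trans (subset_insert x _)).trans (subset_affineSpan ℝ _)

lemma IsGenericPair.isGenericTriangle {x y z : E d} (h : IsGenericPair T x y)
    (hz : ∀ A ∈ triangleObstructions T x y, z ∉ A) :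
    IsGenericTriangle T x y z ∧ IsGenericPair T x z := by
  have hxz := h.left.isGenericPair fun A hA => hz A (Or.inl (Or.inl (Or.inl hA)))
  have hyz := h.right.isGenericPair fun A hA => hz A (Or.inl (Or.inl (Or.inr hA)))
  refine ⟨⟨fun F hF => ?_, ⟨h.isGenericSegment, hyz.isGenericSegment, hxz.isGenericSegment.symm⟩,
    fun K hK hdim => ?_, fun R hR => ?_⟩, hxz⟩
  · have hF' := mem_faces_of_mem_facets hF
    have hdim : dim F < d := (dim_add_one_of_mem_facets hF).le
    exact ⟨h.left F hF' hdim, h.right F hF' hdim, hxz.right F hF' hdim⟩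
  · exact disjoint_convexHull_of_notMem_affineSpan (h.isGenericSegment K hK (by omega))
      (hz _ (Or.inl (Or.inr ⟨K, ⟨hK, hdim⟩, rfl⟩)))
  · refine (isQuarterTurn_ridgeTurn hR).inner_map_ne_zero ?_ (h.notMem_vectorSpan R hR)
      fun hmem => hz _ (Or.inr ⟨R, hR, rfl⟩) (AffineSubspace.mem_mk'.2 hmem)
    rw [finrank_euclideanSpace_fin]
    exact dim_add_two_of_mem_ridges hR

namespace IsTiling

variable (hT : IsTiling T)
include hT

lemma countable_pointObstructions : (pointObstructions T).Countable :=
  (hT.countable_faces.mono fun _ h => h.1).image _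

lemma countable_pairObstructions (x : E d) : (pairObstructions T x).Countable :=
  (hT.countable_pointObstructions.union
    ((hT.countable_faces.mono fun _ h => h.1).image _)).union
    ((hT.countable_faces.mono fun _ => mem_faces_of_mem_ridges).image _)

lemma countable_triangleObstructions (x y : E d) : (triangleObstructions T x y).Countable :=
  (((hT.countable_pairObstructions x).union (hT.countable_pairObstructions y)).union
    ((hT.countable_faces.mono fun _ h => h.1).image _)).union
    ((hT.countable_faces.mono fun _ => mem_faces_of_mem_ridges).image _)

lemma exists_isGenericPoint {U : Set (E d)} (hU : IsOpen U) (hU' : U.Nonempty) :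
    ∃ x ∈ U, IsGenericPoint T x := by
  obtain ⟨x, hx, h⟩ := exists_mem_forall_notMem hT.countable_pointObstructions
    (fun A => ne_top_of_mem_pointObstructions) hU hU'
  exact ⟨x, hx, fun K hK hdim => h _ ⟨K, ⟨hK, hdim⟩, rfl⟩⟩

lemma exists_isGenericPair {x : E d} (hx : IsGenericPoint T x) {U : Set (E d)} (hU : IsOpen U)
    (hU' : U.Nonempty) : ∃ y ∈ U, IsGenericPair T x y := by
  obtain ⟨y, hy, h⟩ := exists_mem_forall_notMem (hT.countable_pairObstructions x)
    (fun A => ne_top_of_mem_pairObstructions) hU hU'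
  exact ⟨y, hy, hx.isGenericPair h⟩

lemma exists_isGenericTriangle {x y y' : E d} (h : IsGenericPair T x y)
    (h' : IsGenericPair T x y') {U : Set (E d)} (hU : IsOpen U) (hU' : U.Nonempty) :
    ∃ z ∈ U, IsGenericTriangle T x y z ∧ IsGenericTriangle T x y' z ∧ IsGenericPair T x z := by
  obtain ⟨z, hz, hz_avoid⟩ := exists_mem_forall_notMem
    ((hT.countable_triangleObstructions x y).union (hT.countable_triangleObstructions x y'))
    (fun A hA => hA.elim ne_top_of_mem_triangleObstructions ne_top_of_mem_triangleObstructions)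
    hU hU'
  have htri := h.isGenericTriangle fun A hA => hz_avoid A (Or.inl hA)
  have htri' := h'.isGenericTriangle fun A hA => hz_avoid A (Or.inr hA)
  exact ⟨z, hz, htri.1, htri'.1, htri.2⟩

end IsTiling

/-! ### The potential of a scaling with zero torsion -/

/-- The affine functions `g P` attached to the cells `P`, encoded by their gradients and constant
terms, have the increments described by `s`: across `P ∩ Q` they change by the affine function
that vanishes on `P ∩ Q` and has the gradient `s (P ∩ Q) • unitNormal P Q`. -/
def IsPotential (T : Set (Set (E d))) (s : Set (E d) → ℝ) (g : Set (E d) → E d × ℝ) : Prop :=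
  ∀ P Q, Adjacent T P Q → ∀ x ∈ P ∩ Q, g Q - g P = s (P ∩ Q) • affinePair x (unitNormal P Q)

namespace IsTiling

variable (hT : IsTiling T)
include hT

lemma segSum_of_mem_interior (s : Set (E d) → ℝ) {P : Set (E d)} (hP : P ∈ T) {a b : E d}
    (ha : a ∈ interior P) (hb : b ∈ interior P) : segSum T s a b = 0 := by
  refine finsum_mem_eq_zero_of_forall_eq_zero fun F hF => ?_
  have hdisj : Disjoint (interior P) F := disjoint_left.2 fun _ =>
    hT.notMem_of_mem_interior hP (mem_faces_of_mem_facets hF) (dim_add_one_of_mem_facets hF).le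
  rw [crossing_eq_zero hdisj ((hT.convex hP).interior.segment_subset ha hb), zero_mul, zero_smul]

variable {P Q : Set (E d)}

lemma nonempty_segment_inter (h : Adjacent T P Q) {a b : E d} (ha : a ∈ P) (hb : b ∈ Q)
    (hab : segment ℝ a b ⊆ P ∪ Q) : (segment ℝ a b ∩ (P ∩ Q)).Nonempty :=
  isPreconnected_closed_iff.1 (convex_segment a b).isPreconnected _ _ (hT.isClosed h.1)
    (hT.isClosed h.2.1) hab ⟨a, left_mem_segment ℝ a b, ha⟩ ⟨b, right_mem_segment ℝ a b, hb⟩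

lemma eq_inter_of_forall_cell {F : Set (E d)} (hF : F ∈ facets T)
    (hcell : ∀ A ∈ T, F ⊆ A → A = P ∨ A = Q) : F = P ∩ Q := by
  obtain ⟨ν, hν⟩ := exists_isFacetNormal (dim_add_one_of_mem_facets hF)
  have hne := hT.side_neg_ne_side hF hν
  rw [← hT.side_neg_inter_side hF hν]
  rcases hcell _ (hT.side_mem hF hν) (hT.subset_side hF hν) with h | h <;>
    rcases hcell _ (hT.side_mem hF hν.neg) (hT.subset_side hF hν.neg) with h' | h'
  · exact absurd (h'.trans h.symm) hne
  · rw [h, h', inter_comm]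
  · rw [h, h']
  · exact absurd (h'.trans h.symm) hne

lemma crossing_smul_facetAffine (h : Adjacent T P Q) {a b x : E d}
    (hmeet : (segment ℝ a b ∩ (P ∩ Q)).Nonempty) (hab : 0 < inner ℝ (unitNormal P Q) (b - a))
    (hx : x ∈ P ∩ Q) :
    crossing (P ∩ Q) (facetNormal (P ∩ Q)) a b • facetAffine (P ∩ Q) =
      affinePair x (unitNormal P Q) := by
  have hF := hT.inter_mem_facets h
  rw [facetAffine_eq hF hx, crossing, if_pos hmeet]
  rcases (hT.unitNormal_spec h).1.eq_or_eq_neg (dim_add_one_of_mem_facets hF)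
    (isFacetNormal_facetNormal hF) with hn | hn
  · rw [hn, Real.sign_of_pos hab, one_smul]
  · rw [hn, inner_neg_left, Real.sign_of_neg (neg_neg_of_pos hab), map_neg, smul_neg, neg_one_smul,
      neg_neg]

lemma segSum_of_adjacent (s : Set (E d) → ℝ) (h : Adjacent T P Q) {a b x : E d}
    (ha : a ∈ interior P) (hb : b ∈ interior Q)
    (hcell : ∀ A ∈ T, (segment ℝ a b ∩ A).Nonempty → A = P ∨ A = Q) (hx : x ∈ P ∩ Q) :
    segSum T s a b = s (P ∩ Q) • affinePair x (unitNormal P Q) := by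
  have hF := hT.inter_mem_facets h
  have hcover : segment ℝ a b ⊆ P ∪ Q := fun p hp => by
    obtain ⟨A, hA, hpA⟩ := hT.exists_mem_cell p
    rcases hcell A hA ⟨p, hp, hpA⟩ with rfl | rfl
    exacts [Or.inl hpA, Or.inr hpA]
  have hmeet := hT.nonempty_segment_inter h (interior_subset ha) (interior_subset hb) hcover
  have hab : 0 < inner ℝ (unitNormal P Q) (b - a) := by
    obtain ⟨-, -, hP⟩ := hT.unitNormal_spec h
    have hPa := (onSide_neg.1 hP) x hx a (interior_subset ha)
    have hQb := hT.inner_unitNormal_pos h hx hb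
    rw [inner_sub_right] at hQb ⊢
    linarith
  have eq_inter {F : Set (E d)} (hF : F ∈ facets T) (hFab : (segment ℝ a b ∩ F).Nonempty) :
      F = P ∩ Q := hT.eq_inter_of_forall_cell hF fun A hA hFA =>
    hcell A hA (hFab.mono (inter_subset_inter_right _ hFA))
  rw [segSum_eq_sum s (S := {P ∩ Q}) (fun F => ?_) subset_rfl, Finset.sum_singleton,
    mul_comm, mul_smul, hT.crossing_smul_facetAffine h hmeet hab hx]
  rw [Finset.mem_singleton, inter_comm F]
  exact ⟨fun hF' => hF' ▸ ⟨hF, hmeet⟩, fun hF' => eq_inter hF'.1 hF'.2⟩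

lemma exists_ball_forall_cell (h : Adjacent T P Q) :
    ∃ f ε, 0 < ε ∧ f ∈ P ∩ Q ∧ ∀ A ∈ T, (Metric.ball f ε ∩ A).Nonempty → A = P ∨ A = Q := by
  have hF := hT.inter_mem_facets h
  obtain ⟨f, hf⟩ := hT.nonempty_intrinsicInterior_of_mem_faces (mem_faces_of_mem_facets hF)
  obtain ⟨ε, hε, hball⟩ := Metric.eventually_nhds_iff_ball.1 (hT.eventually_mem_cell_imp f)
  refine ⟨f, ε, hε, intrinsicInterior_subset hf, fun A hA ⟨y, hy, hyA⟩ => ?_⟩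
  have hFA := hT.face_subset_of_mem_intrinsicInterior (mem_faces_of_mem_facets hF) hA hf
    (hball y hy A hA hyA)
  obtain ⟨ν, hν, hP, hQ⟩ := hT.exists_eq_side_of_adjacent h
  exact (hT.eq_side_or_eq_side_neg hF hν hA hFA).symm.imp (·.trans hP.symm) (·.trans hQ.symm)

lemma segSum_eq_segSum_of_mem_interior {s : Set (E d) → ℝ} (hs : ZeroTorsion T s) (hP : P ∈ T)
    {x y z : E d} (hg : IsGenericTriangle T x y z) (hy : y ∈ interior P) (hz : z ∈ interior P) :
    segSum T s x y = segSum T s x z := by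
  have htriangle := hT.segSum_triangle hs hg
  rwa [hT.segSum_of_mem_interior s hP hy hz, add_zero, segSum_comm s z x, ← sub_eq_add_neg,
    sub_eq_zero] at htriangle

lemma segSum_sub_segSum {s : Set (E d) → ℝ} (hs : ZeroTorsion T s) (h : Adjacent T P Q)
    {x y p q : E d} (hx : x ∈ P ∩ Q) (hyp : IsGenericPair T y p) (hyq : IsGenericPair T y q)
    (hp : p ∈ interior P) (hq : q ∈ interior Q) :
    segSum T s y q - segSum T s y p = s (P ∩ Q) • affinePair x (unitNormal P Q) := by
  obtain ⟨f, ε, hε, hf, hcell⟩ := hT.exists_ball_forall_cell h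
  have hf_mem : f ∈ Metric.ball f ε := Metric.mem_ball_self hε
  obtain ⟨w, ⟨hwP, hw⟩, hypw, -, hyw⟩ := hT.exists_isGenericTriangle hyp hyp
    (isOpen_interior.inter Metric.isOpen_ball)
    (hT.interior_inter_nonempty h.1 Metric.isOpen_ball ⟨f, hf.1, hf_mem⟩)
  obtain ⟨w', ⟨hwQ, hw'⟩, hyww', hyqw', -⟩ := hT.exists_isGenericTriangle hyw hyq
    (isOpen_interior.inter Metric.isOpen_ball)
    (hT.interior_inter_nonempty h.2.1 Metric.isOpen_ball ⟨f, hf.2, hf_mem⟩)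
  have hww' : segSum T s w w' = s (P ∩ Q) • affinePair x (unitNormal P Q) :=
    hT.segSum_of_adjacent s h hwP hwQ (fun A hA hAw => hcell A hA
      (hAw.mono (inter_subset_inter_left _ ((convex_ball f ε).segment_subset hw hw')))) hx
  have htriangle := hT.segSum_triangle hs hyww'
  rw [segSum_comm s w' y] at htriangle
  rw [hT.segSum_eq_segSum_of_mem_interior hs h.1 hypw hp hwP,
    hT.segSum_eq_segSum_of_mem_interior hs h.2.1 hyqw' hq hwQ, ← hww']
  exact (eq_sub_of_add_eq' (add_neg_eq_zero.1 htriangle)).symm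

theorem exists_isPotential {s : Set (E d) → ℝ} (hs : ZeroTorsion T s) {P₀ : Set (E d)}
    (hP₀ : P₀ ∈ T) : ∃ g : Set (E d) → E d × ℝ, g P₀ = 0 ∧ IsPotential T s g := by
  obtain ⟨y, -, hy⟩ := hT.exists_isGenericPoint isOpen_interior (hT.fullDim P₀ hP₀)
  choose! z hz hyz using fun P hP => hT.exists_isGenericPair hy isOpen_interior (hT.fullDim P hP)
  refine ⟨fun P => segSum T s y (z P) - segSum T s y (z P₀), sub_self _, fun P Q h x hx => ?_⟩
  dsimp only
  rw [sub_sub_sub_cancel_right]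
  exact hT.segSum_sub_segSum hs h hx (hyz P h.1) (hyz Q h.2.1) (hz P h.1) (hz Q h.2.1)

end IsTiling

/-! ### Graphs of affine functions -/

/-- The value at `x` of the affine function with gradient `g.1` and constant term `g.2`. -/
noncomputable def evalPair (g : E d × ℝ) (x : E d) : ℝ := inner ℝ g.1 x + g.2

lemma evalPair_sub (g g' : E d × ℝ) (x : E d) :
    evalPair (g - g') x = evalPair g x - evalPair g' x := by
  simp only [evalPair, Prod.fst_sub, Prod.snd_sub, inner_sub_left]
  ring

lemma evalPair_smul (c : ℝ) (g : E d × ℝ) (x : E d) : evalPair (c • g) x = c * evalPair g x := by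
  simp only [evalPair, Prod.smul_fst, Prod.smul_snd, real_inner_smul_left, smul_eq_mul, mul_add]

lemma evalPair_affinePair (y n x : E d) : evalPair (affinePair y n) x = inner ℝ n (x - y) := by
  rw [evalPair, affinePair_apply, inner_sub_right, real_inner_comm y n, sub_eq_add_neg]

lemma evalPair_combo (g : E d × ℝ) (x y : E d) {a b : ℝ} (hab : a + b = 1) :
    evalPair g (a • x + b • y) = a * evalPair g x + b * evalPair g y := by
  simp only [evalPair, inner_add_right, inner_smul_right]
  linear_combination -g.2 * hab

lemma continuous_evalPair (g : E d × ℝ) : Continuous (evalPair g) := by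
  unfold evalPair
  fun_prop

lemma ext_fst_snd {p q : E' d} (hfst : p.fst = q.fst) (hsnd : p.snd = q.snd) : p = q :=
  (WithLp.linearEquiv 2 ℝ (E d × ℝ)).injective (Prod.ext hfst hsnd)

lemma inner_eq_fst_add_snd (p q : E' d) :
    inner ℝ p q = inner ℝ p.fst q.fst + p.snd * q.snd := by
  rw [WithLp.prod_inner_apply]
  exact congrArg _ (mul_comm _ _)

/-- The affine map of `E d` onto the graph of an affine function. -/
noncomputable def liftMap (g : E d × ℝ) : E d →ᵃ[ℝ] E' d where
  toFun x := WithLp.toLp 2 (x, evalPair g x)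
  linear := (WithLp.linearEquiv 2 ℝ (E d × ℝ)).symm.toLinearMap ∘ₗ
    LinearMap.id.prod (innerₗ (E d) g.1)
  map_vadd' x v := by
    apply (WithLp.linearEquiv 2 ℝ (E d × ℝ)).injective
    simp [evalPair, inner_add_right, add_assoc]

@[simp] lemma liftMap_fst (g : E d × ℝ) (x : E d) : (liftMap g x).fst = x := rfl

@[simp] lemma liftMap_snd (g : E d × ℝ) (x : E d) : (liftMap g x).snd = evalPair g x := rfl

lemma liftMap_injective (g : E d × ℝ) : Function.Injective (liftMap g) :=
  Function.LeftInverse.injective (g := fun p : E' d => p.fst) (liftMap_fst g)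

/-- The graph over `P` of an affine function. -/
noncomputable def graphOver (g : E d × ℝ) (P : Set (E d)) : Set (E' d) := liftMap g '' P

/-- The normal with last coordinate `-1` of the graph of an affine function. -/
noncomputable def graphNormal (g : E d × ℝ) : E' d := WithLp.toLp 2 (g.1, -1)

@[simp] lemma graphNormal_fst (g : E d × ℝ) : (graphNormal g).fst = g.1 := rfl

@[simp] lemma graphNormal_snd (g : E d × ℝ) : (graphNormal g).snd = -1 := rfl

lemma inner_graphNormal (g : E d × ℝ) (p : E' d) :
    inner ℝ (graphNormal g) p = evalPair g p.fst - p.snd - g.2 := by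
  rw [inner_eq_fst_add_snd, graphNormal_fst, graphNormal_snd, evalPair]
  ring

section GraphOver

variable {g g' : E d × ℝ} {P Q F : Set (E d)} {K : Set (E' d)}

lemma mem_graphOver {p : E' d} : p ∈ graphOver g P ↔ p.fst ∈ P ∧ p.snd = evalPair g p.fst := by
  constructor
  · rintro ⟨x, hx, rfl⟩
    exact ⟨hx, rfl⟩
  · rintro ⟨hfst, hsnd⟩
    exact ⟨p.fst, hfst, ext_fst_snd rfl hsnd.symm⟩

lemma proj_graphOver (g : E d × ℝ) (P : Set (E d)) : proj (graphOver g P) = P := by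
  rw [proj, graphOver, image_image]
  exact image_id P

lemma graphOver_zero (P : Set (E d)) : graphOver 0 P = embed '' P := by
  refine image_congr fun x _ => ext_fst_snd rfl ?_
  simp [evalPair, embed]

lemma graphOver_congr (h : ∀ x ∈ P, evalPair g x = evalPair g' x) :
    graphOver g P = graphOver g' P :=
  image_congr fun x hx => ext_fst_snd rfl (h x hx)

lemma graphOver_inter (h : ∀ x ∈ P ∩ Q, evalPair g x = evalPair g' x) :
    graphOver g P ∩ graphOver g' Q = graphOver g (P ∩ Q) := by
  ext p
  rw [mem_inter_iff, mem_graphOver, mem_graphOver, mem_graphOver]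
  constructor
  · rintro ⟨⟨hP, hsnd⟩, hQ, -⟩
    exact ⟨⟨hP, hQ⟩, hsnd⟩
  · rintro ⟨hPQ, hsnd⟩
    exact ⟨⟨hPQ.1, hsnd⟩, hPQ.2, hsnd.trans (h _ hPQ)⟩

lemma eq_graphOver_proj_of_subset (h : K ⊆ graphOver g P) : K = graphOver g (proj K) := by
  rw [graphOver, proj, image_image]
  refine (image_congr fun p hp => ?_).trans (image_id K) |>.symm
  exact ext_fst_snd rfl (mem_graphOver.1 (h hp)).2.symm

lemma isPolytope_graphOver (g : E d × ℝ) (hP : IsPolytope P) : IsPolytope (graphOver g P) := by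
  obtain ⟨S, hS, rfl⟩ := hP
  exact ⟨liftMap g '' S, hS.image _, (liftMap g).image_convexHull S⟩

lemma dim_graphOver (g : E d × ℝ) (P : Set (E d)) : dim (graphOver g P) = dim P := by
  rw [dim, dim, graphOver, ← AffineMap.map_vectorSpan]
  exact (Submodule.equivMapOfInjective _
    ((liftMap g).linear_injective_iff.2 (liftMap_injective g)) _).finrank_eq.symm

lemma isFace_graphOver (g : E d × ℝ) (h : IsFace P F) :
    IsFace (graphOver g P) (graphOver g F) := by
  obtain ⟨a, c, hle, heq⟩ := h.exists_inner
  have inner_horizontal (p : E' d) :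
      inner ℝ (WithLp.toLp 2 (a, (0 : ℝ)) : E' d) p = inner ℝ a p.fst := by
    rw [inner_eq_fst_add_snd, WithLp.toLp_fst, WithLp.toLp_snd, zero_mul, add_zero]
  refine isFace_of_inner (a := WithLp.toLp 2 (a, (0 : ℝ))) (c := c) (h.1.image _)
    (fun p hp => ?_) ?_
  · rw [inner_horizontal]
    exact hle _ (mem_graphOver.1 hp).1
  · ext p
    rw [mem_ofPred_eq, mem_graphOver, mem_graphOver, inner_horizontal, heq, mem_ofPred_eq]
    tauto

lemma isFace_proj_of_isFace_graphOver (h : IsFace (graphOver g P) K) : IsFace P (proj K) := by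
  obtain ⟨a, c, hle, heq⟩ := h.exists_inner
  have inner_liftMap (x : E d) : inner ℝ a (liftMap g x) =
      inner ℝ (a.fst + a.snd • g.1) x + a.snd * g.2 := by
    rw [inner_eq_fst_add_snd, inner_add_left, real_inner_smul_left, liftMap_fst, liftMap_snd,
      evalPair]
    ring
  refine isFace_of_inner (a := a.fst + a.snd • g.1) (c := c - a.snd * g.2) (h.1.image _)
    (fun x hx => ?_) ?_
  · have := hle _ ⟨x, hx, rfl⟩
    rw [inner_liftMap] at this
    linarith
  · ext x
    have mem_proj_iff : x ∈ proj K ↔ liftMap g x ∈ K := by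
      refine ⟨?_, fun hx => ⟨_, hx, rfl⟩⟩
      rintro ⟨p, hp, rfl⟩
      obtain ⟨y, -, rfl⟩ := h.subset hp
      exact hp
    rw [mem_proj_iff, heq, mem_ofPred_eq, mem_ofPred_eq, inner_liftMap, graphOver,
      (liftMap_injective g).mem_set_image, eq_sub_iff_add_eq]

lemma isNormal_graphOver (g : E d × ℝ) (P : Set (E d)) :
    IsNormal (graphOver g P) (graphNormal g) := by
  refine ⟨fun h => ?_, fun p hp q hq => ?_⟩
  · simpa using congrArg WithLp.snd h
  · rw [inner_sub_right, inner_graphNormal, inner_graphNormal, (mem_graphOver.1 hp).2,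
      (mem_graphOver.1 hq).2, sub_self, sub_self, sub_self]

lemma IsNormal.eq_graphNormal (hP : vectorSpan ℝ P = ⊤) (hne : P.Nonempty) {N : E' d}
    (h : IsNormal (graphOver g P) N) (hN : N.snd = -1) : N = graphNormal g := by
  obtain ⟨x, hx⟩ := hne
  have inner_eq : ∀ y ∈ P, inner ℝ (N.fst - g.1) y = inner ℝ (N.fst - g.1) x := fun y hy => by
    have := h.2 _ ⟨y, hy, rfl⟩ _ ⟨x, hx, rfl⟩
    rw [inner_sub_right, inner_eq_fst_add_snd, inner_eq_fst_add_snd, hN] at this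
    simp only [liftMap_fst, liftMap_snd, evalPair] at this
    rw [inner_sub_left, inner_sub_left]
    linarith
  have inner_self : inner ℝ (N.fst - g.1) (N.fst - g.1) = 0 :=
    inner_eq_zero_of_mem_vectorSpan inner_eq (hP ▸ Submodule.mem_top)
  exact ext_fst_snd (sub_eq_zero.1 (inner_self_eq_zero.1 inner_self)) hN

end GraphOver

/-! ### The convex function of a positive potential -/

/-- The affine functions attached to the cells agree where the cells meet. -/
def Agree (T : Set (Set (E d))) (g : Set (E d) → E d × ℝ) : Prop :=
  ∀ P ∈ T, ∀ Q ∈ T, ∀ x, x ∈ P → x ∈ Q → evalPair (g P) x = evalPair (g Q) x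

/-- The piecewise affine function that is given by `g P` on each cell `P`. -/
noncomputable def piecewiseFn (T : Set (Set (E d))) (g : Set (E d) → E d × ℝ) (x : E d) : ℝ :=
  evalPair (g (Classical.epsilon fun P => P ∈ T ∧ x ∈ P)) x

section Potential

variable {s : Set (E d) → ℝ} {g : Set (E d) → E d × ℝ} {P Q : Set (E d)}

lemma IsPotential.eval_sub (hg : IsPotential T s g) (h : Adjacent T P Q) {x : E d}
    (hx : x ∈ P ∩ Q) (y : E d) :
    evalPair (g Q) y - evalPair (g P) y = s (P ∩ Q) * inner ℝ (unitNormal P Q) (y - x) := by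
  rw [← evalPair_sub, hg P Q h x hx, evalPair_smul, evalPair_affinePair]

lemma IsPotential.agree (hT : IsTiling T) (hg : IsPotential T s g) : Agree T g := by
  intro P hP Q hQ x hxP hxQ
  have hchain := hT.reflTransGen_adjacent_of_mem hP hQ hxP hxQ
  induction hchain with
  | refl => rfl
  | tail _ h ih =>
    have hsub := hg.eval_sub h.1 ⟨h.2.1, h.2.2⟩ x
    rw [sub_self, inner_zero_right, mul_zero, sub_eq_zero] at hsub
    rw [ih h.1.1 h.2.1, hsub]

namespace IsTiling

variable (hT : IsTiling T)
include hT

lemma piecewiseFn_eq (hg : Agree T g) (hP : P ∈ T) {x : E d} (hx : x ∈ P) :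
    piecewiseFn T g x = evalPair (g P) x := by
  obtain ⟨hQ, hxQ⟩ := Classical.epsilon_spec (p := fun P => P ∈ T ∧ x ∈ P) (hT.exists_mem_cell x)
  exact hg _ hQ P hP x hxQ hx

lemma continuous_piecewiseFn (hg : Agree T g) : Continuous (piecewiseFn T g) := by
  refine hT.locallyFinite.continuous ?_ (fun P => hT.isClosed P.2) fun P => ?_
  · rw [← sUnion_eq_iUnion, hT.cover]
  · exact (continuous_evalPair (g P)).continuousOn.congr fun x hx => hT.piecewiseFn_eq hg P.2 hx

lemma evalPair_le_evalPair_of_isGenericSegment (hs : ∀ F ∈ facets T, 0 < s F)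
    (hg : IsPotential T s g) (hP : P ∈ T) (hQ : Q ∈ T) {y z : E d} (hy : y ∈ interior P)
    (hgen : IsGenericSegment T y z) (hzQ : z ∈ Q) : evalPair (g P) z ≤ evalPair (g Q) z := by
  refine hT.segment_induction hP hy hgen (fun A _ => evalPair (g P) z ≤ evalPair (g A) z) le_rfl
    (fun _ _ _ _ h => h) ?_ 1 ⟨zero_le_one, le_rfl⟩ Q hQ (by simpa using hzQ)
  intro A B t t' _ htt' ht1 hle hadj hA hA' hB
  refine hle.trans (sub_nonneg.1 ?_)
  set w := y + t • (z - y) with hw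
  rw [hg.eval_sub hadj ⟨hA', hB⟩]
  have inner_direction (τ : ℝ) : inner ℝ (unitNormal A B) (y + τ • (z - y) - w) =
      (τ - t) * inner ℝ (unitNormal A B) (z - y) := by
    rw [hw, add_sub_add_left_eq_sub, ← sub_smul, inner_smul_right]
  have inner_nonpos : inner ℝ (unitNormal A B) (y + t' • (z - y) - w) ≤ 0 := by
    rw [inner_sub_right, sub_nonpos]
    exact onSide_neg.1 (hT.unitNormal_spec hadj).2.2 _ ⟨hA', hB⟩ _ hA
  rw [inner_direction, mul_nonpos_iff] at inner_nonpos
  have direction_nonneg : 0 ≤ inner ℝ (unitNormal A B) (z - y) := by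
    rcases inner_nonpos with h | h
    · linarith [h.1]
    · exact h.2
  have inner_z := inner_direction 1
  rw [one_smul, add_sub_cancel] at inner_z
  rw [inner_z]
  exact mul_nonneg (hs _ (hT.inter_mem_facets hadj)).le
    (mul_nonneg (sub_nonneg.2 ht1) direction_nonneg)

lemma evalPair_le_piecewiseFn (hs : ∀ F ∈ facets T, 0 < s F) (hg : IsPotential T s g)
    (hP : P ∈ T) (x : E d) : evalPair (g P) x ≤ piecewiseFn T g x := by
  have hagree := hg.agree hT
  obtain ⟨y, hy⟩ := hT.fullDim P hP
  have hclosed : IsClosed {x | evalPair (g P) x ≤ piecewiseFn T g x} :=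
    isClosed_le (continuous_evalPair _) (hT.continuous_piecewiseFn hagree)
  suffices hdense : Dense {x | evalPair (g P) x ≤ piecewiseFn T g x} from
    eq_univ_iff_forall.1 (hclosed.closure_eq.symm.trans hdense.closure_eq) x
  refine dense_iff_inter_open.2 fun U hU hU' => ?_
  obtain ⟨z, hzU, hgen⟩ := hT.exists_isGenericSegment hP hy hU hU'
  obtain ⟨Q, hQ, hzQ⟩ := hT.exists_mem_cell z
  refine ⟨z, hzU, ?_⟩
  rw [mem_ofPred_eq, hT.piecewiseFn_eq hagree hQ hzQ]
  exact hT.evalPair_le_evalPair_of_isGenericSegment hs hg hP hQ hy hgen hzQ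

lemma convexOn_piecewiseFn (hs : ∀ F ∈ facets T, 0 < s F) (hg : IsPotential T s g) :
    ConvexOn ℝ univ (piecewiseFn T g) := by
  refine ⟨convex_univ, fun x _ y _ a b ha hb hab => ?_⟩
  obtain ⟨Q, hQ, hx⟩ := hT.exists_mem_cell (a • x + b • y)
  rw [hT.piecewiseFn_eq (hg.agree hT) hQ hx, evalPair_combo _ _ _ hab, smul_eq_mul, smul_eq_mul]
  gcongr <;> exact hT.evalPair_le_piecewiseFn hs hg hQ _

/-- The contact set of the piecewise affine function with its affine piece on `P` is convex; if it
were larger than `P`, its interior would meet a neighbour of `P`, on which the increment is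
positive. -/
lemma evalPair_lt_piecewiseFn (hs : ∀ F ∈ facets T, 0 < s F) (hg : IsPotential T s g)
    (hP : P ∈ T) {x : E d} (hx : x ∉ P) : evalPair (g P) x < piecewiseFn T g x := by
  have hagree := hg.agree hT
  by_contra! hle
  set Z := {w | piecewiseFn T g w ≤ evalPair (g P) w}
  have hZ : Convex ℝ Z := fun a ha b hb α β hα hβ hαβ => by
    have := (hT.convexOn_piecewiseFn hs hg).2 (mem_univ a) (mem_univ b) hα hβ hαβ
    rw [mem_ofPred_eq, evalPair_combo _ _ _ hαβ]
    exact this.trans (add_le_add (mul_le_mul_of_nonneg_left ha hα)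
      (mul_le_mul_of_nonneg_left hb hβ))
  have hPZ : P ⊆ Z := fun w hw => (hT.piecewiseFn_eq hagree hP hw).le
  obtain ⟨y, hy⟩ := hT.fullDim P hP
  have hyZ := interior_mono hPZ hy
  obtain ⟨t, ht, htI⟩ := (((tendsto_add_smul_nhdsGT_zero x (y - x)).eventually
    ((hT.isClosed hP).isOpen_compl.mem_nhds hx)).and (Ioo_mem_nhdsGT zero_lt_one)).exists
  have hwZ : x + t • (y - x) ∈ interior Z :=
    hZ.add_smul_sub_mem_interior hle hyZ ⟨htI.1, htI.2.le⟩
  obtain ⟨Q, hQ, hwQ⟩ := hT.exists_mem_cell (x + t • (y - x))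
  have hchain := hT.exists_chain isOpen_interior hZ.interior hP hQ ⟨y, interior_subset hy, hyZ⟩
    ⟨_, hwQ, hwZ⟩
  obtain rfl | ⟨A, ⟨hadj, -, hAZ⟩, -⟩ := hchain.cases_head
  · exact ht hwQ
  obtain ⟨q, hqA, hqZ⟩ := hT.interior_inter_nonempty hadj.2.1 isOpen_interior hAZ
  obtain ⟨f, hf⟩ := hadj.2.2.2.1
  have hq_le : q ∈ Z := interior_subset hqZ
  rw [mem_ofPred_eq, hT.piecewiseFn_eq hagree hadj.2.1 (interior_subset hqA), ← sub_nonpos,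
    hg.eval_sub hadj hf] at hq_le
  exact hq_le.not_gt (mul_pos (hs _ (hT.inter_mem_facets hadj))
    (hT.inner_unitNormal_pos hadj hf hqA))

end IsTiling

end Potential

/-! ### The complex of graphs over the cells -/

/-- The complex of the graphs over the cells of the affine functions attached to them. -/
noncomputable def graphComplex (T : Set (Set (E d))) (g : Set (E d) → E d × ℝ) :
    Set (Set (E' d)) := (fun P => graphOver (g P) P) '' T

/-- The epigraph of a function on `E d`, as a subset of `E' d`. -/
def epigraph (f : E d → ℝ) : Set (E' d) := {p | f p.fst ≤ p.snd}

section Epigraph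

variable {f : E d → ℝ}

lemma convex_epigraph (hf : ConvexOn ℝ univ f) : Convex ℝ (epigraph f) := by
  have := hf.convex_epigraph.linear_preimage (WithLp.linearEquiv 2 ℝ (E d × ℝ)).toLinearMap
  simp only [mem_univ, true_and] at this
  exact this

lemma isClosed_epigraph (hf : Continuous f) : IsClosed (epigraph f) :=
  isClosed_le (hf.comp (WithLp.continuous_fst ..)) (WithLp.continuous_snd ..)

lemma interior_epigraph (hf : Continuous f) :
    interior (epigraph f) = {p : E' d | f p.fst < p.snd} := by
  refine Subset.antisymm (fun p hp => ?_) (interior_maximal (fun p hp => ?_)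
    (isOpen_lt (hf.comp (WithLp.continuous_fst ..)) (WithLp.continuous_snd ..)))
  · have h_ray : Tendsto (fun t : ℝ => p + t • (n₀ : E' d)) (𝓝[>] 0) (𝓝 p) :=
      tendsto_add_smul_nhdsGT_zero p n₀
    obtain ⟨t, ht, ht0⟩ := ((h_ray.eventually (mem_interior_iff_mem_nhds.1 hp)).and
      self_mem_nhdsWithin).exists
    have hfst : (p + t • (n₀ : E' d)).fst = p.fst := by simp [n₀]
    have hsnd : (p + t • (n₀ : E' d)).snd = p.snd - t := by simp [n₀, sub_eq_add_neg]
    have hle : f (p + t • (n₀ : E' d)).fst ≤ (p + t • (n₀ : E' d)).snd := ht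
    rw [hfst, hsnd] at hle
    exact hle.trans_lt (sub_lt_self _ ht0)
  · exact le_of_lt (mem_ofPred_eq ▸ hp)

lemma nonempty_interior_epigraph (hf : Continuous f) : (interior (epigraph f)).Nonempty := by
  rw [interior_epigraph hf]
  exact ⟨WithLp.toLp 2 (0, f 0 + 1), lt_add_one (f 0)⟩

lemma frontier_epigraph (hf : Continuous f) :
    frontier (epigraph f) = {p : E' d | p.snd = f p.fst} := by
  ext p
  rw [(isClosed_epigraph hf).frontier_eq, interior_epigraph hf, Set.mem_sdiff, epigraph,
    mem_ofPred_eq, mem_ofPred_eq, mem_ofPred_eq, not_lt, and_comm, ← le_antisymm_iff]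

end Epigraph

section GraphComplex

variable {s : Set (E d) → ℝ} {g : Set (E d) → E d × ℝ} {P Q : Set (E d)}

lemma graphOver_inter_graphOver (hg : Agree T g) (hP : P ∈ T) (hQ : Q ∈ T) :
    graphOver (g P) P ∩ graphOver (g Q) Q = graphOver (g P) (P ∩ Q) :=
  graphOver_inter fun x hx => hg P hP Q hQ x hx.1 hx.2

lemma proj_image_graphComplex (g : Set (E d) → E d × ℝ) : proj '' graphComplex T g = T := by
  simp_rw [graphComplex, image_image, proj_graphOver, image_id']

namespace IsTiling

variable (hT : IsTiling T)
include hT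

lemma mem_sUnion_graphComplex (hg : Agree T g) {p : E' d} :
    p ∈ ⋃₀ graphComplex T g ↔ p.snd = piecewiseFn T g p.fst := by
  constructor
  · rintro ⟨_, ⟨P, hP, rfl⟩, hp⟩
    obtain ⟨hfst, hsnd⟩ := mem_graphOver.1 hp
    rw [hsnd, hT.piecewiseFn_eq hg hP hfst]
  · intro h
    obtain ⟨P, hP, hp⟩ := hT.exists_mem_cell p.fst
    exact ⟨_, ⟨P, hP, rfl⟩, mem_graphOver.2 ⟨hp, h.trans (hT.piecewiseFn_eq hg hP hp)⟩⟩

lemma isLocallyFinite_graphComplex (g : Set (E d) → E d × ℝ) :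
    IsLocallyFinite (graphComplex T g) := by
  have proj_mem (A : graphComplex T g) : proj A.1 ∈ T :=
    (proj_image_graphComplex g).subset (mem_image_of_mem proj A.2)
  have proj_injective : Function.Injective fun A : graphComplex T g => (⟨_, proj_mem A⟩ : T) := by
    rintro ⟨_, P, hP, rfl⟩ ⟨_, Q, hQ, rfl⟩ h
    simp only [Subtype.mk.injEq, proj_graphOver] at h
    subst h
    rfl
  exact ((hT.locallyFinite.comp_injective proj_injective).preimage_continuous
    (WithLp.continuous_fst ..)).subset fun A p hp => ⟨p, hp, rfl⟩

/-- The orthogonal projection, as a homeomorphism of the union of the graphs onto the space. -/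
noncomputable def graphHomeomorph (hg : Agree T g) : ⋃₀ graphComplex T g ≃ₜ E d where
  toFun p := p.1.fst
  invFun x := ⟨WithLp.toLp 2 (x, piecewiseFn T g x), (hT.mem_sUnion_graphComplex hg).2 rfl⟩
  left_inv p := Subtype.ext (ext_fst_snd rfl ((hT.mem_sUnion_graphComplex hg).1 p.2).symm)
  right_inv _ := rfl
  continuous_toFun := (WithLp.continuous_fst ..).comp continuous_subtype_val
  continuous_invFun := by
    have := hT.continuous_piecewiseFn hg
    fun_prop

lemma faceToFace_graphComplex (hg : Agree T g) : FaceToFace (graphComplex T g) := by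
  rintro _ ⟨P, hP, rfl⟩ _ ⟨Q, hQ, rfl⟩ hne hmeet
  have hPQ : P ≠ Q := fun h => hne (by rw [h])
  have hinter := graphOver_inter_graphOver hg hP hQ
  have hinter' := graphOver_inter_graphOver hg hQ hP
  rw [inter_comm, inter_comm Q P] at hinter'
  beta_reduce at hmeet ⊢
  obtain ⟨hfaceP, hfaceQ⟩ := hT.faceToFace P hP Q hQ hPQ (image_nonempty.1 (hinter ▸ hmeet))
  exact ⟨hinter ▸ isFace_graphOver _ hfaceP, hinter' ▸ isFace_graphOver _ hfaceQ⟩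

theorem isPolyhedralManifold_graphComplex (hg : Agree T g) :
    IsPolyhedralManifold (graphComplex T g) where
  polytope := by
    rintro _ ⟨P, hP, rfl⟩
    exact isPolytope_graphOver _ (hT.polytope P hP)
  nonempty := by
    rintro _ ⟨P, hP, rfl⟩
    exact (hT.nonempty hP).image _
  dim_eq := by
    rintro _ ⟨P, hP, rfl⟩
    rw [dim_graphOver, hT.dim_eq hP]
  faceToFace := hT.faceToFace_graphComplex hg
  locallyFinite := hT.isLocallyFinite_graphComplex g
  manifold := ⟨(hT.graphHomeomorph hg).toOpenPartialHomeomorph.singletonChartedSpace rfl⟩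

theorem isGeneratrix_graphComplex (hg : Agree T g) : IsGeneratrix T (graphComplex T g) where
  isManifold := hT.isPolyhedralManifold_graphComplex hg
  injOn p hp q hq h := congrArg Subtype.val
    ((hT.graphHomeomorph hg).injective (a₁ := ⟨p, hp⟩) (a₂ := ⟨q, hq⟩) h)
  proj_eq := proj_image_graphComplex g

theorem hasNormalIncrements_graphComplex (hg : IsPotential T s g) :
    HasNormalIncrements T (graphComplex T g) s := by
  rintro _ ⟨P, hP, rfl⟩ _ ⟨Q, hQ, rfl⟩ hadj N M hN hM hN1 hM1
  simp only [proj_graphOver] at hadj ⊢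
  rw [hN.eq_graphNormal (hT.vectorSpan_eq_top hP) (hT.nonempty hP) hN1,
    hM.eq_graphNormal (hT.vectorSpan_eq_top hQ) (hT.nonempty hQ) hM1]
  obtain ⟨x, hx⟩ := hadj.2.2.2.1
  exact ext_fst_snd (congrArg Prod.fst (hg P Q hadj x hx) :) (sub_self _)

lemma isFace_epigraph_piecewiseFn (hs : ∀ F ∈ facets T, 0 < s F) (hg : IsPotential T s g)
    (hP : P ∈ T) : IsFace (epigraph (piecewiseFn T g)) (graphOver (g P) P) := by
  refine isFace_of_inner (a := graphNormal (g P)) (c := -(g P).2) ((hT.nonempty hP).image _)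
    (fun p hp => ?_) ?_
  · rw [inner_graphNormal]
    linarith [hT.evalPair_le_piecewiseFn hs hg hP p.fst, mem_ofPred_eq ▸ hp]
  · ext p
    rw [mem_graphOver, mem_ofPred_eq, epigraph, mem_ofPred_eq, inner_graphNormal, sub_eq_neg_self,
      sub_eq_zero, eq_comm (a := p.snd)]
    refine and_congr_left fun hp => ⟨fun hfst => ?_, fun hle => ?_⟩
    · rw [hT.piecewiseFn_eq (hg.agree hT) hP hfst, hp]
    · by_contra hfst
      exact hle.not_gt (hp ▸ hT.evalPair_lt_piecewiseFn hs hg hP hfst)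

theorem boundsConvexPolyhedron_graphComplex (hs : ∀ F ∈ facets T, 0 < s F)
    (hg : IsPotential T s g) : BoundsConvexPolyhedron (graphComplex T g) := by
  have hcont := hT.continuous_piecewiseFn (hg.agree hT)
  refine ⟨epigraph (piecewiseFn T g), convex_epigraph (hT.convexOn_piecewiseFn hs hg),
    isClosed_epigraph hcont, nonempty_interior_epigraph hcont, ?_, ?_⟩
  · rw [frontier_epigraph hcont]
    exact Set.ext fun p => (hT.mem_sUnion_graphComplex (hg.agree hT)).symm
  · rintro _ ⟨P, hP, rfl⟩
    exact hT.isFace_epigraph_piecewiseFn hs hg hP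

end IsTiling

end GraphComplex

/-! ### Lifts along chains -/

lemma eq_graphOver_of_isNormal {g : E d × ℝ} {B : Set (E' d)} (hN : IsNormal B (graphNormal g))
    {q : E' d} (hq : q ∈ B) (hqg : q.snd = evalPair g q.fst) : B = graphOver g (proj B) := by
  refine eq_graphOver_proj_of_subset (P := proj B) fun p hp => mem_graphOver.2 ⟨⟨p, hp, rfl⟩, ?_⟩
  have hpq := hN.2 p hp q hq
  rw [inner_sub_right, inner_graphNormal, inner_graphNormal] at hpq
  linarith

lemma mem_graphComplex {g : Set (E d) → E d × ℝ} {P : Set (E d)} (hP : P ∈ T) :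
    graphOver (g P) P ∈ graphComplex T g :=
  mem_image_of_mem _ hP

lemma graphOver_inj {g h : E d × ℝ} {P Q : Set (E d)} (hPQ : graphOver g P = graphOver h Q) :
    P = Q := by
  rw [← proj_graphOver g P, hPQ, proj_graphOver]

section ChainLift

variable {s : Set (E d) → ℝ} {g : Set (E d) → E d × ℝ} {P₀ P Q : Set (E d)}
  {c : List (Set (E d))} {A B : Set (E' d)} {N M : E' d}

lemma IsPotential.graphNormal_add (hg : IsPotential T s g) (h : Adjacent T P Q) :
    graphNormal (g P) + embed (s (P ∩ Q) • unitNormal P Q) = graphNormal (g Q) := by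
  obtain ⟨x, hx⟩ := h.2.2.2.1
  have hfst : (g Q).1 - (g P).1 = s (P ∩ Q) • unitNormal P Q := congrArg Prod.fst (hg P Q h x hx)
  rw [← hfst]
  exact ext_fst_snd (add_sub_cancel _ _) (add_zero _)

lemma isChainLift_base (s : Set (E d) → ℝ) (h0 : g P₀ = 0) :
    IsChainLift T s P₀ [P₀] (graphOver (g P₀) P₀) (graphNormal (g P₀)) := by
  rw [h0, graphOver_zero]
  exact .base

lemma IsLiftUpTo.eq_graphOver (hg : Agree T g) (h : Adjacent T P Q)
    (hB : IsLiftUpTo P (graphOver (g P) P) Q B) (hN : IsNormal B (graphNormal (g Q))) :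
    B = graphOver (g Q) Q := by
  obtain ⟨⟨-, -, hprojB⟩, -, -, hinter⟩ := hB
  obtain ⟨x, hx⟩ := h.2.2.2.1
  obtain ⟨q, ⟨hqA, hqB⟩, -⟩ := hinter.symm ▸ hx
  obtain ⟨hqP, hqg⟩ := mem_graphOver.1 hqA
  have hqQ : q.fst ∈ Q := hprojB ▸ ⟨q, hqB, rfl⟩
  have hgraph := eq_graphOver_of_isNormal hN hqB (hqg.trans (hg P h.1 Q h.2.1 _ hqP hqQ))
  rwa [hprojB] at hgraph

namespace IsTiling

variable (hT : IsTiling T)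
include hT

lemma isChainLift_eq (hg : IsPotential T s g) (hP₀ : P₀ ∈ T) (h0 : g P₀ = 0)
    (h : IsChainLift T s P₀ c A N) :
    ∃ P c', c = P :: c' ∧ P ∈ T ∧ A = graphOver (g P) P ∧ N = graphNormal (g P) := by
  induction h with
  | base => exact ⟨P₀, [], rfl, hP₀, by rw [h0, graphOver_zero], by rw [h0]; rfl⟩
  | @step c P Q A B N _ hadj hlift hN ih =>
    obtain ⟨P', c', hc, -, rfl, rfl⟩ := ih
    obtain ⟨rfl, rfl⟩ := List.cons.inj hc
    rw [hg.graphNormal_add hadj] at hN ⊢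
    exact ⟨Q, _, rfl, hadj.2.1, hlift.eq_graphOver (hg.agree hT) hadj hN, rfl⟩

lemma isLiftUpTo_graphOver (hg : Agree T g) (h : Adjacent T P Q) :
    IsLiftUpTo P (graphOver (g P) P) Q (graphOver (g Q) Q) := by
  have hinter := graphOver_inter_graphOver hg h.1 h.2.1
  have hinter' := graphOver_inter_graphOver hg h.2.1 h.1
  rw [inter_comm, inter_comm Q P] at hinter'
  obtain ⟨hfaceP, hfaceQ⟩ := hT.faceToFace P h.1 Q h.2.1 h.2.2.1 h.2.2.2.1
  exact ⟨⟨isPolytope_graphOver _ (hT.polytope Q h.2.1), dim_graphOver _ _, proj_graphOver _ _⟩,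
    hinter ▸ isFace_graphOver _ hfaceP, hinter' ▸ isFace_graphOver _ hfaceQ,
    by rw [hinter, proj_graphOver]⟩

lemma isChainLift_step (hg : IsPotential T s g)
    (hc : IsChainLift T s P₀ (P :: c) (graphOver (g P) P) (graphNormal (g P)))
    (h : Adjacent T P Q) :
    IsChainLift T s P₀ (Q :: P :: c) (graphOver (g Q) Q) (graphNormal (g Q)) := by
  have hstep := hc.step h (hT.isLiftUpTo_graphOver (hg.agree hT) h)
  rw [hg.graphNormal_add h] at hstep
  exact hstep (isNormal_graphOver _ _)

lemma isChainLift_of_isChainFrom (hg : IsPotential T s g) (h0 : g P₀ = 0)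
    (hc : IsChainFrom T P₀ (P :: c)) :
    IsChainLift T s P₀ (P :: c) (graphOver (g P) P) (graphNormal (g P)) := by
  obtain ⟨hchain, hlast⟩ := hc
  induction c generalizing P with
  | nil =>
    obtain rfl : P = P₀ := Option.some.inj hlast
    exact isChainLift_base s h0
  | cons Q c ih =>
    rw [List.isChain_cons_cons] at hchain
    rw [List.getLast?_cons_cons] at hlast
    exact hT.isChainLift_step hg (ih hchain.2 hlast) hchain.1

theorem existsUnique_isChainLift (hg : IsPotential T s g) (hP₀ : P₀ ∈ T) (h0 : g P₀ = 0)
    (hc : IsChainFrom T P₀ c) : ∃! A, ∃ N, IsChainLift T s P₀ c A N := by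
  obtain ⟨P, c, rfl⟩ : ∃ P c', c = P :: c' :=
    List.exists_cons_of_ne_nil fun h => by simp [IsChainFrom, h] at hc
  refine ⟨_, ⟨_, hT.isChainLift_of_isChainFrom hg h0 hc⟩, ?_⟩
  rintro A ⟨N, hA⟩
  obtain ⟨Q, _, heq, -, rfl, -⟩ := hT.isChainLift_eq hg hP₀ h0 hA
  rw [(List.cons.inj heq).1]

lemma exists_isChainLift (hg : IsPotential T s g) (hP₀ : P₀ ∈ T) (h0 : g P₀ = 0) (hP : P ∈ T) :
    ∃ c, IsChainLift T s P₀ (P :: c) (graphOver (g P) P) (graphNormal (g P)) := by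
  induction hT.reflTransGen_adjacent hP₀ hP with
  | refl => exact ⟨[], isChainLift_base s h0⟩
  | tail _ hadj ih =>
    obtain ⟨c, hc⟩ := ih hadj.1
    exact ⟨_, hT.isChainLift_step hg hc hadj⟩

theorem liftedComplex_eq (hg : IsPotential T s g) (hP₀ : P₀ ∈ T) (h0 : g P₀ = 0) :
    liftedComplex T s P₀ = graphComplex T g := by
  ext A
  constructor
  · rintro ⟨c, N, h⟩
    obtain ⟨P, _, -, hP, rfl, -⟩ := hT.isChainLift_eq hg hP₀ h0 h
    exact mem_graphComplex hP
  · rintro ⟨P, hP, rfl⟩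
    obtain ⟨c, hc⟩ := hT.exists_isChainLift hg hP₀ h0 hP
    exact ⟨_, _, hc⟩

lemma adjacent_of_isChainLift_cons {R : Set (E d)} (hg : IsPotential T s g) (hP₀ : P₀ ∈ T)
    (h0 : g P₀ = 0) (hP : IsChainLift T s P₀ c (graphOver (g P) P) N)
    (hQ : IsChainLift T s P₀ (R :: c) (graphOver (g Q) Q) M) : Adjacent T P Q := by
  obtain ⟨P', _, rfl, -, hP', -⟩ := hT.isChainLift_eq hg hP₀ h0 hP
  obtain ⟨R', _, hR, -, hQ', -⟩ := hT.isChainLift_eq hg hP₀ h0 hQ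
  obtain ⟨rfl, rfl⟩ := List.cons.inj hR
  obtain rfl := graphOver_inj hP'
  obtain rfl := graphOver_inj hQ'
  cases hQ with
  | step _ hadj _ _ => exact hadj

lemma liftAdjacent_graphOver (hg : IsPotential T s g) (hP₀ : P₀ ∈ T) (h0 : g P₀ = 0) :
    LiftAdjacent T s P₀ (graphOver (g P) P) (graphOver (g Q) Q) ↔ Adjacent T P Q := by
  constructor
  · rintro ⟨c, R, N, M, ⟨hP, hQ⟩ | ⟨hQ, hP⟩⟩
    · exact hT.adjacent_of_isChainLift_cons hg hP₀ h0 hP hQ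
    · exact (hT.adjacent_of_isChainLift_cons hg hP₀ h0 hQ hP).symm
  · intro h
    obtain ⟨c, hc⟩ := hT.exists_isChainLift hg hP₀ h0 h.1
    exact ⟨_, _, _, _, Or.inl ⟨hc, hT.isChainLift_step hg hc h⟩⟩

theorem liftAdjacent_iff (hg : IsPotential T s g) (hP₀ : P₀ ∈ T) (h0 : g P₀ = 0)
    (hA : A ∈ graphComplex T g) (hB : B ∈ graphComplex T g) :
    LiftAdjacent T s P₀ A B ↔ A ≠ B ∧ (A ∩ B).Nonempty ∧ dim (A ∩ B) + 1 = d := by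
  obtain ⟨P, hP, rfl⟩ := hA
  obtain ⟨Q, hQ, rfl⟩ := hB
  have hne : graphOver (g P) P ≠ graphOver (g Q) Q ↔ P ≠ Q :=
    not_congr ⟨graphOver_inj, fun h => by rw [h]⟩
  have hnonempty : (graphOver (g P) (P ∩ Q)).Nonempty ↔ (P ∩ Q).Nonempty := image_nonempty
  beta_reduce
  rw [hT.liftAdjacent_graphOver hg hP₀ h0, graphOver_inter_graphOver (hg.agree hT) hP hQ,
    dim_graphOver, hne, hnonempty]
  exact ⟨fun h => h.2.2, fun h => ⟨hP, hQ, h⟩⟩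

lemma isFace_graphOver_iff_subset (hP : P ∈ T) (hQ : Q ∈ T) {K : Set (E' d)}
    (hK : IsFace (graphOver (g P) P) K) :
    IsFace (graphOver (g Q) Q) K ↔ K ⊆ graphOver (g Q) Q := by
  refine ⟨IsFace.subset, fun hKQ => ?_⟩
  have hproj := isFace_proj_of_isFace_graphOver hK
  have hprojQ : proj K ⊆ Q := (image_mono hKQ).trans (proj_graphOver (g Q) Q).subset
  rw [eq_graphOver_proj_of_subset hKQ]
  exact isFace_graphOver (g Q) (hT.isFace_of_subset hP hQ hproj hprojQ)

theorem liftCommonFace_iff (hg : IsPotential T s g) (hP₀ : P₀ ∈ T) (h0 : g P₀ = 0)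
    (hA : A ∈ graphComplex T g) (hB : B ∈ graphComplex T g) (K : Set (E' d)) :
    LiftCommonFace T s P₀ A B K ↔ IsFace A K ∧ IsFace B K := by
  have hagree := hg.agree hT
  obtain ⟨P, hP, rfl⟩ := hA
  obtain ⟨Q, hQ, rfl⟩ := hB
  refine and_congr_right fun hK => ?_
  have hproj := isFace_proj_of_isFace_graphOver hK
  rw [hT.isFace_graphOver_iff_subset hP hQ hK]
  constructor
  · intro h
    rcases h.cases_tail with h | ⟨_, -, h⟩
    · exact hK.subset.trans h.ge
    · exact h.2.trans inter_subset_right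
  · intro hKQ
    have subset_graphOver {X : Set (E d)} (hX : X ∈ T) (hKX : proj K ⊆ X) :
        K ⊆ graphOver (g X) X := fun p hp => by
      obtain ⟨hpP, hpg⟩ := mem_graphOver.1 (hK.subset hp)
      have hpX := hKX ⟨p, hp, rfl⟩
      exact mem_graphOver.2 ⟨hpX, hpg.trans (hagree P hP X hX _ hpP hpX)⟩
    have hprojQ : proj K ⊆ Q := (image_mono hKQ).trans (proj_graphOver (g Q) Q).subset
    refine (hT.reflTransGen_adjacent_of_subset hP hQ ⟨P, hP, hproj⟩ hproj.subset hprojQ).lift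
      (fun R => graphOver (g R) R) ?_
    rintro X Y ⟨hadj, hKX, hKY⟩
    exact ⟨(hT.liftAdjacent_graphOver hg hP₀ h0).2 hadj,
      subset_inter (subset_graphOver hadj.1 hKX) (subset_graphOver hadj.2.1 hKY)⟩

end IsTiling

end ChainLift

/-! ### Normal increments of a generatrix -/

section Normal

variable {A : Set (E' d)} {N : E' d}

lemma IsNormal.smul (hN : IsNormal A N) {r : ℝ} (hr : r ≠ 0) : IsNormal A (r • N) :=
  ⟨smul_ne_zero hr hN.1, fun x hx y hy => by rw [real_inner_smul_left, hN.2 x hx y hy, mul_zero]⟩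

lemma IsNormal.snd_ne_zero (hN : IsNormal A N) (hspan : vectorSpan ℝ (proj A) = ⊤)
    (hne : A.Nonempty) : N.snd ≠ 0 := by
  intro hsnd
  obtain ⟨q, hq⟩ := hne
  have inner_const : ∀ y ∈ proj A, inner ℝ N.fst y = inner ℝ N.fst q.fst := by
    rintro _ ⟨p, hp, rfl⟩
    simpa only [inner_sub_right, inner_eq_fst_add_snd, hsnd, zero_mul, add_zero, sub_eq_zero]
      using hN.2 p hp q hq
  have hfst : inner ℝ N.fst N.fst = 0 :=
    inner_eq_zero_of_mem_vectorSpan inner_const (hspan ▸ Submodule.mem_top)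
  exact hN.1 (ext_fst_snd (inner_self_eq_zero.1 hfst) hsnd)

lemma exists_graphNormal_eq_smul (h : N.snd ≠ 0) :
    ∃ w, ∀ c, graphNormal (w, c) = -N.snd⁻¹ • N := by
  refine ⟨-N.snd⁻¹ • N.fst, fun c => ext_fst_snd rfl ?_⟩
  change -1 = -N.snd⁻¹ * N.snd
  rw [neg_mul, inv_mul_cancel₀ h]

lemma finrank_E' (d : ℕ) : Module.finrank ℝ (E' d) = d + 1 := by
  rw [(WithLp.linearEquiv 2 ℝ (E d × ℝ)).finrank_eq, Module.finrank_prod, finrank_euclideanSpace,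
    Fintype.card_fin, Module.finrank_self]

lemma exists_isNormal (hdim : dim A ≤ d) : ∃ N, IsNormal A N := by
  have horth : (vectorSpan ℝ A)ᗮ ≠ ⊥ := fun h => by
    have := Submodule.finrank_add_finrank_orthogonal (vectorSpan ℝ A)
    rw [h, finrank_bot, finrank_E'] at this
    rw [dim] at hdim
    omega
  obtain ⟨N, hN, hN0⟩ := Submodule.exists_mem_ne_zero_of_ne_bot horth
  exact ⟨N, hN0, fun x hx y hy =>
    Submodule.inner_left_of_mem_orthogonal (vsub_mem_vectorSpan ℝ hx hy) hN⟩

lemma exists_eq_graphOver (hspan : vectorSpan ℝ (proj A) = ⊤) (hne : A.Nonempty)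
    (hdim : dim A ≤ d) : ∃ γ, A = graphOver γ (proj A) := by
  obtain ⟨N, hN⟩ := exists_isNormal hdim
  have hsnd := hN.snd_ne_zero hspan hne
  obtain ⟨w, hw⟩ := exists_graphNormal_eq_smul hsnd
  obtain ⟨q, hq⟩ := hne
  refine ⟨(w, q.snd - inner ℝ w q.fst), eq_graphOver_of_isNormal ?_ hq
    (add_sub_cancel _ _).symm⟩
  rw [hw]
  exact hN.smul (neg_ne_zero.2 (inv_ne_zero hsnd))

lemma IsNormal.eq_smul_graphNormal {g : E d × ℝ} {P : Set (E d)} (hN : IsNormal (graphOver g P) N)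
    (hspan : vectorSpan ℝ P = ⊤) (hP : P.Nonempty) :
    N.snd ≠ 0 ∧ N = -N.snd • graphNormal g := by
  have hsnd := hN.snd_ne_zero (by rwa [proj_graphOver]) (hP.image _)
  obtain ⟨w, hw⟩ := exists_graphNormal_eq_smul hsnd
  have hnormal := (hN.smul (neg_ne_zero.2 (inv_ne_zero hsnd))).eq_graphNormal hspan hP
    (by rw [← hw 0, graphNormal_snd])
  rw [← hnormal, smul_smul, neg_mul_neg, mul_inv_cancel₀ hsnd, one_smul]
  exact ⟨hsnd, rfl⟩

end Normal

theorem IsGeneratrix.exists_eq_graphComplex (hT : IsTiling T) {G : Set (Set (E' d))}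
    (hG : IsGeneratrix T G) : ∃ g, Agree T g ∧ G = graphComplex T g := by
  have graph_of_mem {A} (hA : A ∈ G) : ∃ γ, A = graphOver γ (proj A) :=
    exists_eq_graphOver (hT.vectorSpan_eq_top (hG.proj_eq ▸ mem_image_of_mem proj hA))
      (hG.isManifold.nonempty A hA) (hG.isManifold.dim_eq A hA).le
  have exists_graphOver_mem : ∀ P ∈ T, ∃ γ, graphOver γ P ∈ G := fun P hP => by
    obtain ⟨A, hA, rfl⟩ : P ∈ proj '' G := hG.proj_eq ▸ hP
    obtain ⟨γ, hγ⟩ := graph_of_mem hA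
    exact ⟨γ, hγ ▸ hA⟩
  choose! g hg using exists_graphOver_mem
  have evalPair_eq {γ γ' : E d × ℝ} {P Q x} (hP : graphOver γ P ∈ G) (hQ : graphOver γ' Q ∈ G)
      (hxP : x ∈ P) (hxQ : x ∈ Q) : evalPair γ x = evalPair γ' x :=
    congrArg WithLp.snd (hG.injOn ⟨_, hP, x, hxP, rfl⟩ ⟨_, hQ, x, hxQ, rfl⟩ rfl)
  refine ⟨g, fun P hP Q hQ x => evalPair_eq (hg P hP) (hg Q hQ), subset_antisymm ?_ ?_⟩
  · intro A hA
    have hproj : proj A ∈ T := hG.proj_eq ▸ mem_image_of_mem proj hA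
    obtain ⟨γ, hγ⟩ := graph_of_mem hA
    have hγG : graphOver γ (proj A) ∈ G := hγ ▸ hA
    rw [hγ, graphOver_congr fun x hx => evalPair_eq hγG (hg _ hproj) hx hx]
    exact mem_graphComplex hproj
  · rintro _ ⟨P, hP, rfl⟩
    exact hg P hP

section Increments

variable {s : Set (E d) → ℝ} {g : Set (E d) → E d × ℝ} {P Q : Set (E d)}

theorem IsPotential.zeroTorsion (hT : IsTiling T) (hg : IsPotential T s g) : ZeroTorsion T s := by
  refine hT.zeroTorsion_of_increments (h := fun P => (g P).1) fun F hF ν hν => ?_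
  have hadj := hT.adjacent_side hF hν
  obtain ⟨x, hx⟩ := hadj.2.2.2.1
  have hfst := congrArg Prod.fst (hg _ _ hadj x hx)
  rw [hT.side_neg_inter_side hF hν, hT.unitNormal_side hF hν] at hfst
  exact hfst.symm

lemma IsPotential.neg (hg : IsPotential T s g) : IsPotential T (-s) (-g) := fun P Q h x hx => by
  rw [Pi.neg_apply, Pi.neg_apply, Pi.neg_apply, neg_smul, ← hg P Q h x hx, neg_sub_neg, neg_sub]

lemma Agree.sub_eq_smul_affinePair (hT : IsTiling T) (hg : Agree T g) (h : Adjacent T P Q)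
    {x : E d} (hx : x ∈ P ∩ Q) :
    g Q - g P = inner ℝ (unitNormal P Q) ((g Q).1 - (g P).1) • affinePair x (unitNormal P Q) := by
  have eval_eq_zero : ∀ y ∈ P ∩ Q, evalPair (g Q - g P) y = 0 := fun y hy => by
    rw [evalPair_sub, hg P h.1 Q h.2.1 y hy.1 hy.2, sub_self]
  have gradient_eq := (hT.unitNormal_spec h).1.eq_smul h.2.2.2.2 fun v hv =>
    inner_eq_zero_of_mem_vectorSpan (a := (g Q - g P).1)
      (fun y hy => eq_neg_of_add_eq_zero_left (eval_eq_zero y hy)) hv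
  refine Prod.ext gradient_eq ?_
  rw [eq_neg_of_add_eq_zero_right (eval_eq_zero x hx), gradient_eq, real_inner_smul_left,
    real_inner_comm x, ← mul_neg]
  rfl

theorem Agree.exists_isPotential (hT : IsTiling T) (hg : Agree T g) : ∃ s, IsPotential T s g := by
  refine ⟨fun F => inner ℝ (facetNormal F)
    ((g (side T F (facetNormal F))).1 - (g (side T F (-facetNormal F))).1), fun P Q h x hx => ?_⟩
  have hF := hT.inter_mem_facets h
  obtain ⟨hn, hQ, hP⟩ := hT.unitNormal_spec h
  have hQ_side := hT.eq_side_of_onSide hF hn h.2.1 inter_subset_right hQ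
  have hP_side := hT.eq_side_of_onSide hF hn.neg h.1 inter_subset_left hP
  rw [hg.sub_eq_smul_affinePair hT h hx]
  congr 1
  beta_reduce
  rcases hn.eq_or_eq_neg h.2.2.2.2 (isFacetNormal_facetNormal hF) with hν | hν
  · rw [hν, ← hQ_side, ← hP_side]
  · rw [hν, neg_neg, ← hQ_side, ← hP_side, ← neg_sub (g Q).1, inner_neg_neg]

end Increments

/-! ### Convex generatrices -/

section Convex

variable {s : Set (E d) → ℝ} {g : Set (E d) → E d × ℝ} {P Q : Set (E d)}

lemma interior_graphOver (γ : E d × ℝ) (P : Set (E d)) : interior (graphOver γ P) = ∅ := by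
  have inner_eq : ∀ p ∈ graphOver γ P, inner ℝ (graphNormal γ) p = -γ.2 := fun p hp => by
    rw [inner_graphNormal, (mem_graphOver.1 hp).2, sub_self, zero_sub]
  refine eq_empty_of_forall_notMem fun p hp => ?_
  exact (lt_inner_of_mem_interior (isNormal_graphOver γ P).1 (fun q hq => (inner_eq q hq).ge)
    hp).ne' (inner_eq p (interior_subset hp))

lemma exists_ne_zero_mul_pos_of_isFace_graphOver {γ : E d × ℝ} {C : Set (E' d)}
    (hspan : vectorSpan ℝ P = ⊤) (hC : (interior C).Nonempty) (hface : IsFace C (graphOver γ P)) :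
    ∃ r : ℝ, r ≠ 0 ∧ ∀ p ∈ C, p ∉ graphOver γ P → 0 < r * (p.snd - evalPair γ p.fst) := by
  obtain ⟨a, c, hle, heq⟩ := hface.exists_inner
  have inner_eq : ∀ p ∈ graphOver γ P, inner ℝ a p = c := fun p hp => (heq ▸ hp).2
  obtain ⟨_, x, hx, rfl⟩ := hface.1
  have a_ne_zero : a ≠ 0 := by
    rintro rfl
    have hc : 0 = c := inner_zero_left (𝕜 := ℝ) (liftMap γ x) ▸ inner_eq _ ⟨x, hx, rfl⟩
    have hCP : C ⊆ graphOver γ P := fun p hp => heq ▸ ⟨hp, (inner_zero_left _).trans hc⟩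
    exact (hC.mono (interior_mono hCP)).ne_empty (interior_graphOver γ P)
  have hnormal : IsNormal (graphOver γ P) a := ⟨a_ne_zero, fun p hp q hq => by
    rw [inner_sub_right, inner_eq p hp, inner_eq q hq, sub_self]⟩
  obtain ⟨snd_ne_zero, a_eq⟩ := hnormal.eq_smul_graphNormal hspan ⟨x, hx⟩
  have inner_a (p : E' d) : inner ℝ a p = -a.snd * (evalPair γ p.fst - p.snd - γ.2) := by
    conv_lhs => rw [a_eq, real_inner_smul_left, inner_graphNormal]
  have c_eq : -a.snd * -γ.2 = c := by
    rw [← inner_eq _ ⟨x, hx, rfl⟩, inner_a, liftMap_fst, liftMap_snd, sub_self, zero_sub]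
  refine ⟨-a.snd, neg_ne_zero.2 snd_ne_zero, fun p hp hpP => ?_⟩
  have inner_lt : inner ℝ a p < c := (hle p hp).lt_of_ne fun h => hpP (heq ▸ ⟨hp, h⟩)
  rw [inner_a, ← c_eq] at inner_lt
  linarith

namespace IsTiling

variable (hT : IsTiling T)
include hT

lemma exists_ne_zero_mul_piecewiseFn_sub_pos (hg : Agree T g)
    (hC : BoundsConvexPolyhedron (graphComplex T g)) (hP : P ∈ T) :
    ∃ r : ℝ, r ≠ 0 ∧ ∀ x ∉ P, 0 < r * (piecewiseFn T g x - evalPair (g P) x) := by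
  obtain ⟨C, -, hCclosed, hCint, hfrontier, hface⟩ := hC
  obtain ⟨r, hr, hpos⟩ := exists_ne_zero_mul_pos_of_isFace_graphOver (hT.vectorSpan_eq_top hP)
    hCint (hface _ (mem_graphComplex hP))
  refine ⟨r, hr, fun x hx => ?_⟩
  have hxC : (WithLp.toLp 2 (x, piecewiseFn T g x) : E' d) ∈ C := by
    refine hCclosed.frontier_subset ?_
    rw [hfrontier]
    exact (hT.mem_sUnion_graphComplex hg).2 rfl
  exact hpos _ hxC fun h => hx (mem_graphOver.1 h).1

lemma mul_pos_of_adjacent (hg : IsPotential T s g) (h : Adjacent T P Q) {r : ℝ}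
    (hr : ∀ x ∉ P, 0 < r * (piecewiseFn T g x - evalPair (g P) x)) : 0 < r * s (P ∩ Q) := by
  obtain ⟨x, hx⟩ := h.2.2.2.1
  obtain ⟨q, hq⟩ := hT.fullDim Q h.2.1
  have hqP : q ∉ P := fun hqP => h.2.2.1 (hT.eq_of_mem_interior h.2.1 h.1 hq hqP).symm
  have hpos := hr q hqP
  rw [hT.piecewiseFn_eq (hg.agree hT) h.2.1 (interior_subset hq), hg.eval_sub h hx,
    ← mul_assoc] at hpos
  exact pos_of_mul_pos_left hpos (hT.inner_unitNormal_pos h hx hq).le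

theorem isCanonicalScaling_or_neg (hg : IsPotential T s g)
    (hC : BoundsConvexPolyhedron (graphComplex T g)) :
    IsCanonicalScaling T s ∨ IsCanonicalScaling T (-s) := by
  have exists_sign : ∀ P ∈ T, ∃ r : ℝ, r ≠ 0 ∧ ∀ Q, Adjacent T P Q → 0 < r * s (P ∩ Q) :=
    fun P hP => by
      obtain ⟨r, hr, hpos⟩ := hT.exists_ne_zero_mul_piecewiseFn_sub_pos (hg.agree hT) hC hP
      exact ⟨r, hr, fun Q h => hT.mul_pos_of_adjacent hg h hpos⟩
  choose! r hr hrs using exists_sign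
  have trans_pos {a b c : ℝ} (hab : 0 < a * b) (hbc : 0 < b * c) : 0 < a * c :=
    pos_of_mul_pos_left (b := b * b) (by linarith [mul_pos hab hbc]) (mul_self_nonneg b)
  obtain ⟨P₀, hP₀, -⟩ := hT.exists_mem_cell 0
  have same_sign {P} (hP : P ∈ T) : 0 < r P₀ * r P := by
    induction hT.reflTransGen_adjacent hP₀ hP with
    | refl => exact mul_self_pos.2 (hr P₀ hP₀)
    | @tail P Q _ h ih =>
      refine trans_pos (trans_pos (ih h.1) (hrs P h.1 Q h)) ?_
      rw [mul_comm, inter_comm]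
      exact hrs Q h.2.1 P h.symm
  have facet_pos : ∀ F ∈ facets T, 0 < r P₀ * s F := fun F hF => by
    have hν := isFacetNormal_facetNormal hF
    have hadj := hT.adjacent_side hF hν
    have hpos := hrs _ hadj.1 _ hadj
    rw [hT.side_neg_inter_side hF hν] at hpos
    exact trans_pos (same_sign hadj.1) hpos
  rcases (hr P₀ hP₀).lt_or_gt with hneg | hpos
  · exact Or.inr ⟨fun F hF => neg_pos.2 (neg_of_mul_pos_right (facet_pos F hF) hneg.le),
      hg.neg.zeroTorsion hT⟩
  · exact Or.inl ⟨fun F hF => pos_of_mul_pos_right (facet_pos F hF) hpos.le, hg.zeroTorsion hT⟩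

end IsTiling

end Convex

end Gen

theorem mainTheorem3 (d : ℕ) (T : Set (Set (Gen.E d))) (hT : Gen.IsTiling T) :
    -- the complex built from a canonical scaling is well defined, its incidences are the
    -- geometric ones, and it is a generatrix (which bounds a convex polyhedron)
    (∀ s : Set (Gen.E d) → ℝ, Gen.IsCanonicalScaling T s → ∀ P₀ ∈ T,
      (∀ c, Gen.IsChainFrom T P₀ c → ∃! A, ∃ N, Gen.IsChainLift T s P₀ c A N) ∧
      (∀ A ∈ Gen.liftedComplex T s P₀, ∀ B ∈ Gen.liftedComplex T s P₀,
        (Gen.LiftAdjacent T s P₀ A B ↔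
          A ≠ B ∧ (A ∩ B).Nonempty ∧ Gen.dim (A ∩ B) + 1 = d) ∧
        ∀ K, Gen.LiftCommonFace T s P₀ A B K ↔ Gen.IsFace A K ∧ Gen.IsFace B K) ∧
      Gen.IsGeneratrix T (Gen.liftedComplex T s P₀) ∧
      Gen.HasNormalIncrements T (Gen.liftedComplex T s P₀) s ∧
      Gen.BoundsConvexPolyhedron (Gen.liftedComplex T s P₀)) ∧
    -- the normal increments of a generatrix give a scaling with zero torsion, which is a
    -- canonical (that is, also positive) one, up to a common sign, if the generatrix bounds a
    -- convex polyhedron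
    (∀ G : Set (Set (Gen.E' d)), Gen.IsGeneratrix T G →
      (∃ s : Set (Gen.E d) → ℝ, Gen.ZeroTorsion T s ∧ Gen.HasNormalIncrements T G s) ∧
      (Gen.BoundsConvexPolyhedron G → ∃ s : Set (Gen.E d) → ℝ, Gen.IsCanonicalScaling T s ∧
        (Gen.HasNormalIncrements T G s ∨ Gen.HasNormalIncrements T G (-s)))) := by
  refine ⟨fun s hs P₀ hP₀ => ?_, fun G hG => ?_⟩
  · obtain ⟨g, h0, hg⟩ := hT.exists_isPotential hs.2 hP₀
    rw [hT.liftedComplex_eq hg hP₀ h0]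
    exact ⟨fun c hc => hT.existsUnique_isChainLift hg hP₀ h0 hc,
      fun A hA B hB => ⟨hT.liftAdjacent_iff hg hP₀ h0 hA hB,
        hT.liftCommonFace_iff hg hP₀ h0 hA hB⟩,
      hT.isGeneratrix_graphComplex (hg.agree hT), hT.hasNormalIncrements_graphComplex hg,
      hT.boundsConvexPolyhedron_graphComplex hs.1 hg⟩
  · obtain ⟨g, hagree, rfl⟩ := hG.exists_eq_graphComplex hT
    obtain ⟨s, hg⟩ := hagree.exists_isPotential hT
    have hinc := hT.hasNormalIncrements_graphComplex hg
    refine ⟨⟨s, hg.zeroTorsion hT, hinc⟩, fun hC => ?_⟩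
    rcases hT.isCanonicalScaling_or_neg hg hC with hs | hs
    · exact ⟨s, hs, Or.inl hinc⟩
    · exact ⟨-s, hs, Or.inr (by rwa [neg_neg])⟩
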